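/- For a finite simple graph $G=(V,E)$, a pair $(A,B)$ of disjoint subsets of $V$ is a \emph{pair of perfectly matched sets} if every vertex of $A$ has exactly one neighbour in $B$ and every vertex of $B$ has exactly one neighbour in $A$; its size is $|A|=|B|$. A \emph{cluster graph} is a vertex-disjoint union of cliques, and the \emph{distance to cluster} of $G$ is the smallest size of a set $X\subseteq V$ such that $G-X$ is a cluster graph. The optimization version of PERFECTLY MATCHED SETS asks, given $G$, for a pair of perfectly matched sets of maximum size. \textbf{Theorem.} There is an algorithm (a program for a random access machine that is given the adjacency matrix of the input graph) that solves the optimization version of PERFECTLY MATCHED SETS and that, on every $n$-vertex graph with distance to cluster at most $k$, runs in time $O(3^k\cdot k^k\cdot \mathrm{poly}(n))$, with the convention $0^0=1$. That is, there are one such algorithm and one polynomial $p$ such that, for all $n,k\ge 0$ and every $n$-vertex graph $G$ with distance to cluster at most $k$, the algorithm halts on input $G$ after at most $3^k\cdot k^k\cdot p(n)$ steps and outputs a pair $(A,B)$ of perfectly matched sets of $G$ of maximum size. -/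

import Mathlib

/-! ### Perfectly matched sets -/

/-- `(A, B)` is a pair of perfectly matched sets of `G`: the sets are disjoint, every vertex of `A`
has exactly one neighbour in `B`, and every vertex of `B` has exactly one neighbour in `A`. -/
def PerfectlyMatched {V : Type*} (G : SimpleGraph V) (A B : Finset V) : Prop :=
  Disjoint A B ∧
    (∀ a ∈ A, ∃! b, b ∈ B ∧ G.Adj a b) ∧
    (∀ b ∈ B, ∃! a, a ∈ A ∧ G.Adj b a)

/-- `(A, B)` is a pair of perfectly matched sets of maximum size `|A| = |B|`. -/
def IsMaximumPerfectlyMatched {V : Type*} (G : SimpleGraph V) (A B : Finset V) : Prop :=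
  PerfectlyMatched G A B ∧
    ∀ A' B' : Finset V, PerfectlyMatched G A' B' → A'.card ≤ A.card

/-! ### Distance to cluster -/

/-- A cluster graph is a vertex-disjoint union of cliques: the vertex set is partitioned into
classes so that two distinct vertices are adjacent exactly when they are in the same class. -/
def IsClusterGraph {V : Type*} (G : SimpleGraph V) : Prop :=
  ∃ r : Setoid V, ∀ u v : V, G.Adj u v ↔ u ≠ v ∧ r u v

/-- `X` is a cluster deletion set of `G`: the graph `G - X` is a cluster graph. -/
def IsClusterDeletionSet {V : Type*} (G : SimpleGraph V) (X : Finset V) : Prop :=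
  IsClusterGraph (G.induce {v | v ∉ X})

/-- The smallest size of a cluster deletion set. On a finite graph the set on the right is not
empty, because the set of all vertices is a cluster deletion set. -/
noncomputable def distanceToCluster {V : Type*} (G : SimpleGraph V) : ℕ :=
  sInf {m | ∃ X : Finset V, IsClusterDeletionSet G X ∧ X.card = m}

/-! ### Random access machines

A program uses finitely many registers and finitely many arrays, all holding natural numbers. The
only arithmetic operations are successor and predecessor, so that in `t` steps no number can grow
beyond the input and the constants of the program by more than `t`. Hence one step never hides an
operation on long numbers, and the unit-cost measure below is justified. -/

namespace RAM

/-- The contents of the registers and of the arrays. -/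
structure State where
  reg : ℕ → ℕ
  arr : ℕ → ℕ → ℕ

/-- Write the value `v` into register `x`. -/
def State.setReg (s : State) (x v : ℕ) : State :=
  { s with reg := Function.update s.reg x v }

/-- Write the value `v` into cell `i` of array `a`. -/
def State.setArr (s : State) (a i v : ℕ) : State :=
  { s with arr := Function.update s.arr a (Function.update (s.arr a) i v) }

/-- Elementary instructions; `x`, `y` name registers, `a` names an array, `c` is a constant. -/
inductive Instr where
  /-- `x := c` -/
  | const (x c : ℕ)
  /-- `x := y` -/
  | copy (x y : ℕ)
  /-- `x := y + 1` -/
  | succ (x y : ℕ)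
  /-- `x := y - 1` (and `0` if `y` holds `0`) -/
  | pred (x y : ℕ)
  /-- `x := a[y]` -/
  | load (x a y : ℕ)
  /-- `a[x] := y` -/
  | store (a x y : ℕ)

/-- The effect of an instruction. -/
def Instr.run : Instr → State → State
  | .const x c, s => s.setReg x c
  | .copy x y, s => s.setReg x (s.reg y)
  | .succ x y, s => s.setReg x (s.reg y + 1)
  | .pred x y, s => s.setReg x (s.reg y - 1)
  | .load x a y, s => s.setReg x (s.arr a (s.reg y))
  | .store a x y, s => s.setArr a (s.reg x) (s.reg y)

/-- Tests comparing two registers. -/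
inductive Test where
  | eq (x y : ℕ)
  | lt (x y : ℕ)

/-- The test succeeds in a given state. -/
def Test.Holds : Test → State → Prop
  | .eq x y, s => s.reg x = s.reg y
  | .lt x y, s => s.reg x < s.reg y

/-- Programs: elementary instructions, the empty program, sequential composition,
`if b then p else q`, and `while b do p`. -/
inductive Prog where
  | instr (i : Instr)
  | skip
  | seq (p q : Prog)
  | branch (b : Test) (p q : Prog)
  | loop (b : Test) (p : Prog)

/-- `Exec p s t s'`: started in state `s`, the program `p` halts after exactly `t` steps, in state
`s'`. Every elementary instruction, every empty program and every evaluation of a test counts as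
one step. -/
inductive Exec : Prog → State → ℕ → State → Prop
  | instr (i : Instr) (s : State) : Exec (.instr i) s 1 (i.run s)
  | skip (s : State) : Exec .skip s 1 s
  | seq {p q : Prog} {s s₁ s₂ : State} {t₁ t₂ : ℕ}
      (hp : Exec p s t₁ s₁) (hq : Exec q s₁ t₂ s₂) : Exec (.seq p q) s (t₁ + t₂) s₂
  | branch_true {b : Test} {p q : Prog} {s s' : State} {t : ℕ}
      (hb : b.Holds s) (hp : Exec p s t s') : Exec (.branch b p q) s (t + 1) s'
  | branch_false {b : Test} {p q : Prog} {s s' : State} {t : ℕ}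
      (hb : ¬ b.Holds s) (hq : Exec q s t s') : Exec (.branch b p q) s (t + 1) s'
  | loop_false {b : Test} {p : Prog} {s : State}
      (hb : ¬ b.Holds s) : Exec (.loop b p) s 1 s
  | loop_true {b : Test} {p : Prog} {s s₁ s₂ : State} {t₁ t₂ : ℕ}
      (hb : b.Holds s) (hp : Exec p s t₁ s₁) (hl : Exec (.loop b p) s₁ t₂ s₂) :
      Exec (.loop b p) s (t₁ + t₂ + 1) s₂

/-- Execution is deterministic, so a program has at most one run on each input. -/
theorem Exec.deterministic {p : Prog} {s s₁ : State} {t₁ : ℕ} (h₁ : Exec p s t₁ s₁) :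
    ∀ {t₂ : ℕ} {s₂ : State}, Exec p s t₂ s₂ → t₁ = t₂ ∧ s₁ = s₂ := by
  induction h₁ with
  | instr i s => intro _ _ h; cases h; exact ⟨rfl, rfl⟩
  | skip s => intro _ _ h; cases h; exact ⟨rfl, rfl⟩
  | seq _ _ ihp ihq =>
    intro _ _ h
    cases h with
    | seq hp hq =>
      obtain ⟨rfl, rfl⟩ := ihp hp
      obtain ⟨rfl, rfl⟩ := ihq hq
      exact ⟨rfl, rfl⟩
  | branch_true hb _ ih =>
    intro _ _ h
    cases h with
    | branch_true _ hp => obtain ⟨rfl, rfl⟩ := ih hp; exact ⟨rfl, rfl⟩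
    | branch_false hb' _ => exact absurd hb hb'
  | branch_false hb _ ih =>
    intro _ _ h
    cases h with
    | branch_true hb' _ => exact absurd hb' hb
    | branch_false _ hp => obtain ⟨rfl, rfl⟩ := ih hp; exact ⟨rfl, rfl⟩
  | loop_false hb =>
    intro _ _ h
    cases h with
    | loop_false _ => exact ⟨rfl, rfl⟩
    | loop_true hb' _ _ => exact absurd hb' hb
  | loop_true hb _ _ ihp ihl =>
    intro _ _ h
    cases h with
    | loop_false hb' => exact absurd hb hb'
    | loop_true _ hp hl =>
      obtain ⟨rfl, rfl⟩ := ihp hp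
      obtain ⟨rfl, rfl⟩ := ihl hl
      exact ⟨rfl, rfl⟩

open Classical in
/-- The input: register `0` holds the number `n` of vertices, and array `0` holds the adjacency
matrix of the graph in row-major order. Everything else is `0`. -/
noncomputable def graphInput {n : ℕ} (G : SimpleGraph (Fin n)) : State where
  reg x := if x = 0 then n else 0
  arr a i :=
    if a = 0 ∧ ∃ u v : Fin n, i = (u : ℕ) * n + (v : ℕ) ∧ G.Adj u v then 1 else 0

/-- The vertex set whose indicator vector is in the first `n` cells of array `a`. -/
def State.vertexSet (s : State) (a n : ℕ) : Finset (Fin n) :=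
  Finset.univ.filter fun v => s.arr a (v : ℕ) = 1

end RAM

/-!
Greedily marking disjoint induced paths on three vertices yields a set `X` such that `G - X` is a
cluster graph and `|X| ≤ 3k`, since every cluster deletion set meets each of the paths. All
`3 ^ |X|` ways of assigning the vertices of `X` to `A`, to `B` or to neither are entered into a
table, and the cliques of `G - X` are processed one after the other, by matching pairs of vertices
along edges that meet the current clique.

A clique contains at most one matching edge with both ends in it, and several vertices of the
same side in a clique rule out any vertex of the other side there. So the way in which a partial
solution can be continued depends only on the colours in `X`, the number (zero, one, or more) of
opposite neighbours that each vertex of `X` has, and the colours that occur in the current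
clique. By this exchange argument it suffices to keep one partial solution of each such type and
each weight, and there are at most `9 ^ |X| * poly(n)` of them, which gives a running time that
is single exponential in `k`.

The program is written in a small structured language. Compiled to a random access machine, it runs
in time polynomial in the largest number that occurs, which is of the order of the number of types.
-/

/-! ### Structured programs -/

namespace RAM

/-- The program halts within `T` steps, in a state satisfying `Q`. -/
def Runs (p : Prog) (s : State) (T : ℕ) (Q : State → Prop) : Prop :=
  ∃ t s', Exec p s t s' ∧ t ≤ T ∧ Q s'

namespace Runs

variable {p q : Prog} {s : State} {T U : ℕ} {Q R : State → Prop}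

theorem mono (h : Runs p s T Q) (hT : T ≤ U) (hQ : ∀ s', Q s' → R s') : Runs p s U R := by
  obtain ⟨t, s', hexec, ht, hs'⟩ := h
  exact ⟨t, s', hexec, ht.trans hT, hQ _ hs'⟩

theorem instr {i : Instr} (h : Q (i.run s)) : Runs (.instr i) s 1 Q :=
  ⟨1, _, .instr i s, le_rfl, h⟩

theorem seq (hp : Runs p s T R) (hq : ∀ s₁, R s₁ → Runs q s₁ U Q) :
    Runs (.seq p q) s (T + U) Q := by
  obtain ⟨t, s₁, hexec, ht, hs₁⟩ := hp
  obtain ⟨t', s₂, hexec', ht', hs₂⟩ := hq s₁ hs₁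
  exact ⟨_, _, .seq hexec hexec', add_le_add ht ht', hs₂⟩

theorem instr_seq {i : Instr} (h : Runs q (i.run s) U Q) :
    Runs (.seq (.instr i) q) s (1 + U) Q :=
  seq (instr (Q := (· = i.run s)) rfl) fun _ hs₁ => hs₁ ▸ h

theorem branch {b : Test} (hp : b.Holds s → Runs p s T Q) (hq : ¬ b.Holds s → Runs q s T Q) :
    Runs (.branch b p q) s (T + 1) Q := by
  by_cases hb : b.Holds s
  · obtain ⟨t, s', hexec, ht, hs'⟩ := hp hb
    exact ⟨_, _, .branch_true hb hexec, by omega, hs'⟩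
  · obtain ⟨t, s', hexec, ht, hs'⟩ := hq hb
    exact ⟨_, _, .branch_false hb hexec, by omega, hs'⟩

theorem loop {b : Test} (I : ℕ → State → Prop) (N : ℕ)
    (hb : ∀ j s, j ≤ N → I j s → (b.Holds s ↔ j < N))
    (hp : ∀ j s, j < N → I j s → Runs p s T (I (j + 1))) (h0 : I 0 s) :
    Runs (.loop b p) s (N * (T + 1) + 1) (I N) := by
  suffices remaining : ∀ m j s, j + m = N → I j s →
      Runs (.loop b p) s (m * (T + 1) + 1) (I N) from remaining N 0 s (zero_add N) h0
  intro m
  induction m with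
  | zero =>
    rintro j s rfl hI
    exact ⟨1, s, .loop_false (by simp [hb j s le_rfl hI]), by omega, hI⟩
  | succ m ih =>
    intro j s hj hI
    obtain ⟨t, s', hexec, ht, hs'⟩ := hp j s (by omega) hI
    obtain ⟨t', s'', hexec', ht', hs''⟩ := ih (j + 1) s' (by omega) hs'
    refine ⟨_, _, .loop_true ((hb j s (by omega) hI).2 (by omega)) hexec hexec', ?_, hs''⟩
    rw [Nat.succ_mul]
    omega

end Runs

namespace State

@[simp] theorem setReg_reg (s : State) (x v y : ℕ) :
    (s.setReg x v).reg y = if y = x then v else s.reg y := by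
  simp [setReg, Function.update_apply]

@[simp] theorem setReg_arr (s : State) (x v : ℕ) : (s.setReg x v).arr = s.arr := rfl

@[simp] theorem setArr_reg (s : State) (a i v : ℕ) : (s.setArr a i v).reg = s.reg := rfl

theorem setArr_arr (s : State) (a i v b : ℕ) :
    (s.setArr a i v).arr b = if b = a then Function.update (s.arr a) i v else s.arr b := by
  simp only [setArr, Function.update_apply]

end State

/-- The states have the same arrays and the same registers below `d`. -/
def Agree (d : ℕ) (s s' : State) : Prop :=
  (∀ x < d, s.reg x = s'.reg x) ∧ s.arr = s'.arr

namespace Agree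

variable {d d' : ℕ} {s s' s'' : State}

theorem refl (d : ℕ) (s : State) : Agree d s s := ⟨fun _ _ => rfl, rfl⟩

theorem symm (h : Agree d s s') : Agree d s' s := ⟨fun x hx => (h.1 x hx).symm, h.2.symm⟩

theorem trans (h : Agree d s s') (h' : Agree d s' s'') : Agree d s s'' :=
  ⟨fun x hx => (h.1 x hx).trans (h'.1 x hx), h.2.trans h'.2⟩

theorem mono (h : Agree d s s') (hd : d' ≤ d) : Agree d' s s' :=
  ⟨fun x hx => h.1 x (hx.trans_le hd), h.2⟩

theorem setReg (h : Agree d s s') (x v : ℕ) : Agree d (s.setReg x v) (s'.setReg x v) :=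
  ⟨fun y hy => by simp [h.1 y hy], h.2⟩

theorem setReg_right (h : Agree d s s') {x : ℕ} (hx : d ≤ x) (v : ℕ) :
    Agree d s (s'.setReg x v) :=
  ⟨fun y hy => by simp [h.1 y hy, show y ≠ x by omega], h.2⟩

end Agree

/-- The registers below `m` and all array cells hold numbers that are at most `M`. -/
def Bounded (m M : ℕ) (s : State) : Prop :=
  (∀ x < m, s.reg x ≤ M) ∧ ∀ a i, s.arr a i ≤ M

namespace Bounded

variable {m M M' : ℕ} {s s' : State}

theorem congr (h : Bounded m M s) (hs : Agree m s s') : Bounded m M s' :=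
  ⟨fun x hx => hs.1 x hx ▸ h.1 x hx, fun a i => hs.2 ▸ h.2 a i⟩

theorem mono (h : Bounded m M s) (hM : M ≤ M') : Bounded m M' s :=
  ⟨fun x hx => (h.1 x hx).trans hM, fun a i => (h.2 a i).trans hM⟩

theorem setReg (h : Bounded m M s) (x : ℕ) {v : ℕ} (hv : v ≤ M) :
    Bounded m M (s.setReg x v) := by
  refine ⟨fun y hy => ?_, h.2⟩
  rw [State.setReg_reg]
  split
  exacts [hv, h.1 y hy]

theorem setArr (h : Bounded m M s) (a i : ℕ) {v : ℕ} (hv : v ≤ M) :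
    Bounded m M (s.setArr a i v) := by
  refine ⟨h.1, fun b j => ?_⟩
  rw [State.setArr_arr]
  split
  · rw [Function.update_apply]
    split
    exacts [hv, h.2 a j]
  · exact h.2 b j

end Bounded

/-- Run `p` once for each value `0, …, N - 1` of the counter `c`, where register `b` holds `N`. -/
def countTo (c b : ℕ) (p : Prog) : Prog :=
  .seq (.instr (.const c 0)) (.loop (.lt c b) (.seq p (.instr (.succ c c))))

theorem countTo_runs {c b N T : ℕ} {p : Prog} {s : State} (hcb : b ≠ c) (I : ℕ → State → Prop)
    (hN : s.reg b = N) (h0 : I 0 (s.setReg c 0))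
    (hp : ∀ j < N, ∀ t, t.reg c = j → t.reg b = N → I j t →
      Runs p t T fun t' => t'.reg c = j ∧ t'.reg b = N ∧ I (j + 1) (t'.setReg c (j + 1))) :
    Runs (countTo c b p) s (N * (T + 2) + 2) (I N) := by
  have hloop : Runs (.loop (.lt c b) (.seq p (.instr (.succ c c)))) (s.setReg c 0)
      (N * (T + 1 + 1) + 1) fun t => t.reg c = N ∧ t.reg b = N ∧ I N t := by
    refine Runs.loop (fun j t => t.reg c = j ∧ t.reg b = N ∧ I j t) N ?_ ?_ ?_
    · rintro j t - ⟨hc, hb, -⟩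
      simp only [Test.Holds, hc, hb]
    · rintro j t hj ⟨hc, hb, hI⟩
      refine (hp j hj t hc hb hI).seq ?_
      rintro t' ⟨hc', hb', hI'⟩
      exact Runs.instr ⟨by simp [Instr.run, hc'], by simp [Instr.run, hcb, hb'],
        by simpa only [Instr.run, hc'] using hI'⟩
    · simp [hcb, hN, h0]
  exact (Runs.instr_seq hloop).mono (by linarith) fun t ht => ht.2.2

/-- Add register `y` to register `d`, with counter `c`. -/
def addTo (d y c : ℕ) : Prog :=
  countTo c y (.instr (.succ d d))

theorem addTo_runs {d y c : ℕ} (hdy : d ≠ y) (hdc : d ≠ c) (hyc : y ≠ c) (s : State) :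
    Runs (addTo d y c) s (3 * s.reg y + 2) fun t => t.arr = s.arr ∧
      t.reg d = s.reg d + s.reg y ∧ ∀ x, x ≠ d → x ≠ c → t.reg x = s.reg x := by
  refine (countTo_runs (T := 1) hyc (fun j t => t.arr = s.arr ∧ t.reg d = s.reg d + j ∧
    ∀ x, x ≠ d → x ≠ c → t.reg x = s.reg x) rfl ?_ ?_).mono (by omega) fun t ht => ht
  · grind [State.setReg_reg, State.setReg_arr]
  · intro j _ t hc hy ⟨harr, hd, hx⟩
    exact Runs.instr (by grind [Instr.run, State.setReg_reg, State.setReg_arr])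

/-- Let register `d` hold the truth value `0` or `1` of the test `b`. -/
def setFlag (d : ℕ) (b : Test) : Prog :=
  .branch b (.instr (.const d 1)) (.instr (.const d 0))

open Classical in
theorem setFlag_runs (d : ℕ) (b : Test) (s : State) :
    Runs (setFlag d b) s 2 (· = s.setReg d (if b.Holds s then 1 else 0)) :=
  Runs.branch (T := 1) (fun hb => Runs.instr (by simp [Instr.run, hb]))
    fun hb => Runs.instr (by simp [Instr.run, hb])

/-- Arithmetic expressions; `sum x e f` is the sum of the values of `f` for `x` from `0` to
`e - 1`. Comparisons have value `0` or `1`. -/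
inductive Expr where
  | lit (c : ℕ)
  | var (x : ℕ)
  | get (a : ℕ) (e : Expr)
  | add (e f : Expr)
  | mul (e f : Expr)
  | lt (e f : Expr)
  | eq (e f : Expr)
  | sum (x : ℕ) (e f : Expr)

namespace Expr

/-- The value of an expression. -/
def eval : Expr → State → ℕ
  | lit c, _ => c
  | var x, s => s.reg x
  | get a e, s => s.arr a (e.eval s)
  | add e f, s => e.eval s + f.eval s
  | mul e f, s => e.eval s * f.eval s
  | lt e f, s => if e.eval s < f.eval s then 1 else 0
  | eq e f, s => if e.eval s = f.eval s then 1 else 0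
  | sum x e f, s => ∑ i ∈ Finset.range (e.eval s), f.eval (s.setReg x i)

/-- All registers that occur in the expression are below this number. -/
def fresh : Expr → ℕ
  | lit _ => 0
  | var x => x + 1
  | get _ e => e.fresh
  | add e f => max e.fresh f.fresh
  | mul e f => max e.fresh f.fresh
  | lt e f => max e.fresh f.fresh
  | eq e f => max e.fresh f.fresh
  | sum x e f => max (x + 1) (max e.fresh f.fresh)

/-- A bound for the value of the expression in terms of a bound for the state. -/
noncomputable def size : Expr → Polynomial ℕ
  | lit c => Polynomial.C c
  | var _ => Polynomial.X
  | get _ _ => Polynomial.X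
  | add e f => e.size + f.size
  | mul e f => e.size * f.size
  | lt _ _ => 1
  | eq _ _ => 1
  | sum _ e f => e.size * f.size.comp (Polynomial.X + e.size)

theorem eval_congr (e : Expr) {m : ℕ} {s s' : State} (he : e.fresh ≤ m) (hs : Agree m s s') :
    e.eval s = e.eval s' := by
  induction e generalizing s s' with
  | lit c => rfl
  | var x => exact hs.1 x he
  | get a e ih => simp only [eval, ih he hs, hs.2]
  | add e f ihe ihf | mul e f ihe ihf | lt e f ihe ihf | eq e f ihe ihf =>
    simp only [fresh, max_le_iff] at he
    simp only [eval, ihe he.1 hs, ihf he.2 hs]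
  | sum x e f ihe ihf =>
    simp only [fresh, max_le_iff] at he
    simp only [eval, ihe he.2.1 hs, fun i => ihf he.2.2 (hs.setReg x i)]

theorem eval_le_size (e : Expr) {m M : ℕ} {s : State} (he : e.fresh ≤ m) (hs : Bounded m M s) :
    e.eval s ≤ e.size.eval M := by
  induction e generalizing M s with
  | lit c => simp [eval, size]
  | var x => simpa [eval, size] using hs.1 x he
  | get a e => simpa [eval, size] using hs.2 _ _
  | add e f ihe ihf =>
    simp only [fresh, max_le_iff] at he
    simpa [eval, size] using add_le_add (ihe he.1 hs) (ihf he.2 hs)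
  | mul e f ihe ihf =>
    simp only [fresh, max_le_iff] at he
    simpa [eval, size] using Nat.mul_le_mul (ihe he.1 hs) (ihf he.2 hs)
  | lt e f | eq e f =>
    simp only [eval, size, Polynomial.eval_one]
    split <;> simp
  | sum x e f ihe ihf =>
    simp only [fresh, max_le_iff] at he
    have hterm : ∀ i ∈ Finset.range (e.eval s),
        f.eval (s.setReg x i) ≤ f.size.eval (M + e.size.eval M) := by
      intro i hi
      have hile : i ≤ e.size.eval M := (Finset.mem_range.1 hi).le.trans (ihe he.2.1 hs)
      exact ihf he.2.2 ((hs.mono (Nat.le_add_right _ _)).setReg x (hile.trans (by omega)))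
    calc ∑ i ∈ Finset.range (e.eval s), f.eval (s.setReg x i)
        ≤ (Finset.range (e.eval s)).card • f.size.eval (M + e.size.eval M) :=
          Finset.sum_le_card_nsmul _ _ _ hterm
      _ ≤ e.size.eval M * f.size.eval (M + e.size.eval M) := by
          rw [Finset.card_range, smul_eq_mul]
          exact Nat.mul_le_mul_right _ (ihe he.2.1 hs)
      _ = (sum x e f).size.eval M := by simp [size]

/-- The code that evaluates an expression into register `d`; it uses registers from `d` on. -/
def compile : Expr → ℕ → Prog
  | lit c, d => .instr (.const d c)
  | var x, d => .instr (.copy d x)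
  | get a e, d => .seq (e.compile d) (.instr (.load d a d))
  | add e f, d => .seq (e.compile d) (.seq (f.compile (d + 1)) (addTo d (d + 1) (d + 2)))
  | mul e f, d => .seq (e.compile d) (.seq (f.compile (d + 1)) (.seq (.instr (.const (d + 2) 0))
      (.seq (countTo (d + 3) d (addTo (d + 2) (d + 1) (d + 4))) (.instr (.copy d (d + 2))))))
  | lt e f, d => .seq (e.compile d) (.seq (f.compile (d + 1)) (setFlag d (.lt d (d + 1))))
  | eq e f, d => .seq (e.compile d) (.seq (f.compile (d + 1)) (setFlag d (.eq d (d + 1))))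
  | sum x e f, d => .seq (e.compile (d + 1)) (.seq (.instr (.copy (d + 2) x))
      (.seq (.instr (.const d 0)) (.seq (countTo (d + 3) (d + 1) (.seq (.instr (.copy x (d + 3)))
        (.seq (f.compile (d + 4)) (addTo d (d + 4) (d + 5))))) (.instr (.copy x (d + 2))))))

/-- A bound for the running time of the code of an expression. -/
noncomputable def cost : Expr → Polynomial ℕ
  | lit _ => 1
  | var _ => 1
  | get _ e => e.cost + 1
  | add e f => e.cost + (f.cost + (3 * f.size + 2))
  | mul e f => e.cost + (f.cost + (1 + ((e.size * (3 * f.size + 2 + 2) + 2) + 1)))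
  | lt e f => e.cost + (f.cost + 2)
  | eq e f => e.cost + (f.cost + 2)
  | sum _ e f => e.cost + (1 + (1 + ((e.size * (1 + (f.cost.comp (Polynomial.X + e.size) +
      (3 * f.size.comp (Polynomial.X + e.size) + 2)) + 2) + 2) + 1)))

/-- The code of the expression is correct, within the time bound. -/
def CompilesCorrectly (e : Expr) : Prop :=
  ∀ ⦃m d M : ℕ⦄ ⦃s : State⦄, e.fresh ≤ m → m ≤ d → Bounded m M s →
    Runs (e.compile d) s (e.cost.eval M) fun t => Agree d s t ∧ t.reg d = e.eval s

namespace CompilesCorrectly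

variable {e f : Expr}

theorem lit (c : ℕ) : CompilesCorrectly (.lit c) := by
  intro m d M s _ _ _
  simp only [cost, Polynomial.eval_one]
  exact Runs.instr ⟨(Agree.refl d s).setReg_right le_rfl c, by simp [Instr.run, eval]⟩

theorem var (x : ℕ) : CompilesCorrectly (.var x) := by
  intro m d M s _ _ _
  simp only [cost, Polynomial.eval_one]
  exact Runs.instr ⟨(Agree.refl d s).setReg_right le_rfl _, by simp [Instr.run, eval]⟩

theorem get (a : ℕ) (he : e.CompilesCorrectly) : CompilesCorrectly (.get a e) := by
  intro m d M s hm hd hs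
  simp only [cost, Polynomial.eval_one, Polynomial.eval_add]
  refine (he hm hd hs).seq ?_
  rintro t ⟨hst, hval⟩
  exact Runs.instr ⟨hst.setReg_right le_rfl _, by simp [Instr.run, eval, hval, hst.2]⟩

theorem operands (he : e.CompilesCorrectly) (hf : f.CompilesCorrectly) {m d M T : ℕ} {s : State}
    {q : Prog} {Q : State → Prop} (hem : e.fresh ≤ m) (hfm : f.fresh ≤ m) (hd : m ≤ d)
    (hs : Bounded m M s)
    (hq : ∀ t, Agree d s t → t.reg d = e.eval s → t.reg (d + 1) = f.eval s → Runs q t T Q) :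
    Runs (.seq (e.compile d) (.seq (f.compile (d + 1)) q)) s
      (e.cost.eval M + (f.cost.eval M + T)) Q := by
  refine (he hem hd hs).seq ?_
  rintro t ⟨hst, htd⟩
  have hst' := hst.mono hd
  refine (hf hfm (by omega) (hs.congr hst')).seq ?_
  rintro t' ⟨htt', htd'⟩
  refine hq t' (hst.trans (htt'.mono (by omega))) ?_ ?_
  · rw [← htt'.1 d (by omega), htd]
  · rw [htd', f.eval_congr hfm hst']

theorem lt (he : e.CompilesCorrectly) (hf : f.CompilesCorrectly) :
    CompilesCorrectly (.lt e f) := by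
  intro m d M s hm hd hs
  simp only [fresh, max_le_iff] at hm
  simp only [cost, Polynomial.eval_add, Polynomial.eval_ofNat]
  refine operands he hf hm.1 hm.2 hd hs fun t hst hte htf =>
    (setFlag_runs d (.lt d (d + 1)) t).mono le_rfl ?_
  rintro _ rfl
  exact ⟨hst.setReg_right le_rfl _, by simp [Test.Holds, eval, hte, htf]⟩

theorem eq (he : e.CompilesCorrectly) (hf : f.CompilesCorrectly) :
    CompilesCorrectly (.eq e f) := by
  intro m d M s hm hd hs
  simp only [fresh, max_le_iff] at hm
  simp only [cost, Polynomial.eval_add, Polynomial.eval_ofNat]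
  refine operands he hf hm.1 hm.2 hd hs fun t hst hte htf =>
    (setFlag_runs d (.eq d (d + 1)) t).mono le_rfl ?_
  rintro _ rfl
  exact ⟨hst.setReg_right le_rfl _, by simp [Test.Holds, eval, hte, htf]⟩

theorem add (he : e.CompilesCorrectly) (hf : f.CompilesCorrectly) :
    CompilesCorrectly (.add e f) := by
  intro m d M s hm hd hs
  simp only [fresh, max_le_iff] at hm
  simp only [cost, Polynomial.eval_add, Polynomial.eval_ofNat, Polynomial.eval_mul]
  have hsize := f.eval_le_size hm.2 hs
  refine operands he hf hm.1 hm.2 hd hs fun t hst hte htf =>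
    (addTo_runs (by omega) (by omega) (by omega) t).mono (by omega) ?_
  rintro t' ⟨harr, hsum, hreg⟩
  exact ⟨⟨fun x hx => (hst.1 x hx).trans (hreg x (by omega) (by omega)).symm,
    hst.2.trans harr.symm⟩, by rw [hsum, hte, htf, eval]⟩

theorem mul (he : e.CompilesCorrectly) (hf : f.CompilesCorrectly) :
    CompilesCorrectly (.mul e f) := by
  intro m d M s hm hd hs
  simp only [fresh, max_le_iff] at hm
  simp only [cost, Polynomial.eval_add, Polynomial.eval_ofNat, Polynomial.eval_mul,
    Polynomial.eval_one]
  refine operands he hf hm.1 hm.2 hd hs fun t hst hte htf => Runs.instr_seq ?_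
  have hsize : e.eval s * (3 * f.eval s + 2 + 2) + 2 ≤
      e.size.eval M * (3 * f.size.eval M + 2 + 2) + 2 := by
    gcongr
    exacts [e.eval_le_size hm.1 hs, f.eval_le_size hm.2 hs]
  have hloop : Runs (countTo (d + 3) d (addTo (d + 2) (d + 1) (d + 4)))
      ((Instr.const (d + 2) 0).run t) (e.eval s * (3 * f.eval s + 2 + 2) + 2) fun u =>
        Agree d s u ∧ u.reg (d + 1) = f.eval s ∧ u.reg (d + 2) = e.eval s * f.eval s := by
    refine countTo_runs (by omega) (fun j u => Agree d s u ∧ u.reg (d + 1) = f.eval s ∧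
      u.reg (d + 2) = j * f.eval s) (by simp [Instr.run, hte]) ?_ ?_
    · refine ⟨(hst.setReg_right (by omega) _).setReg_right (by omega) _, ?_, ?_⟩ <;>
        simp [Instr.run, htf]
    · rintro j - u hc hN ⟨hsu, hfu, hprod⟩
      refine (addTo_runs (by omega) (by omega) (by omega) u).mono (by rw [hfu]) ?_
      rintro u' ⟨harr, hsum, hreg⟩
      refine ⟨by rw [hreg _ (by omega) (by omega), hc], by rw [hreg _ (by omega) (by omega), hN],
        Agree.setReg_right ⟨fun x hx => ?_, hsu.2.trans harr.symm⟩ (by omega) _, ?_, ?_⟩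
      · rw [hsu.1 x hx, hreg x (by omega) (by omega)]
      · simp [hreg (d + 1), hfu]
      · simp [hsum, hprod, hfu, Nat.succ_mul]
  refine (hloop.mono hsize fun _ hu => hu).seq ?_
  rintro u ⟨hsu, -, hprod⟩
  exact Runs.instr ⟨hsu.setReg_right le_rfl _, by simp [Instr.run, eval, hprod]⟩

theorem sum_loop (hf : f.CompilesCorrectly) {x m d M N : ℕ} {s t : State} (hxm : x < m)
    (hfm : f.fresh ≤ m) (hd : m ≤ d) (hs : Bounded m M s) (hNM : N ≤ M) (ht0 : t.reg d = 0)
    (htN : t.reg (d + 1) = N) (harr : t.arr = s.arr) (hreg : ∀ y < d, t.reg y = s.reg y) :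
    Runs (countTo (d + 3) (d + 1) (.seq (.instr (.copy x (d + 3)))
        (.seq (f.compile (d + 4)) (addTo d (d + 4) (d + 5))))) t
      (N * (1 + (f.cost.eval M + (3 * f.size.eval M + 2)) + 2) + 2) fun u =>
        u.reg d = ∑ i ∈ Finset.range N, f.eval (s.setReg x i) ∧ u.arr = s.arr ∧
        u.reg (d + 2) = t.reg (d + 2) ∧ ∀ y < d, y ≠ x → u.reg y = s.reg y := by
  refine countTo_runs (by omega) (fun j u => u.reg d = ∑ i ∈ Finset.range j,
    f.eval (s.setReg x i) ∧ u.arr = s.arr ∧ u.reg (d + 2) = t.reg (d + 2) ∧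
    ∀ y < d, y ≠ x → u.reg y = s.reg y) htN
    (by grind [State.setReg_reg, State.setReg_arr, Finset.sum_range_zero]) ?_
  rintro j hj u hc hN ⟨hsum, huarr, hsave, hureg⟩
  have hagree : Agree m (s.setReg x j) ((Instr.copy x (d + 3)).run u) :=
    ⟨fun y hy => by grind [Instr.run, State.setReg_reg], huarr.symm⟩
  have hbound : Bounded m M (s.setReg x j) := hs.setReg x (by omega)
  have hsize := f.eval_le_size hfm hbound
  refine Runs.instr_seq ((hf hfm (by omega) (hbound.congr hagree)).seq ?_)
  rintro u₁ ⟨huu₁, hval⟩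
  rw [← f.eval_congr hfm hagree] at hval
  refine (addTo_runs (by omega) (by omega) (by omega) u₁).mono (by omega) ?_
  rintro u₂ ⟨harr₂, hsum₂, hreg₂⟩
  have hframe : ∀ y < d + 4, u₁.reg y = if y = x then j else u.reg y := fun y hy => by
    rw [← huu₁.1 y hy]
    simp [Instr.run, hc]
  rw [Finset.sum_range_succ]
  exact ⟨by grind, by grind, by grind [State.setReg_reg], harr₂.trans (huu₁.2.symm.trans huarr),
    by grind [State.setReg_reg], by grind [State.setReg_reg]⟩

theorem sum (x : ℕ) (he : e.CompilesCorrectly) (hf : f.CompilesCorrectly) :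
    CompilesCorrectly (.sum x e f) := by
  intro m d M s hm hd hs
  simp only [fresh, max_le_iff] at hm
  simp only [cost, Polynomial.eval_add, Polynomial.eval_ofNat, Polynomial.eval_mul,
    Polynomial.eval_one, Polynomial.eval_comp, Polynomial.eval_X]
  have hsize := e.eval_le_size hm.2.1 hs
  refine (he hm.2.1 (by omega) hs).seq ?_
  rintro t ⟨hst, hte⟩
  set t' := (Instr.const d 0).run ((Instr.copy (d + 2) x).run t) with ht'
  have hreg : ∀ y < d, t'.reg y = s.reg y := fun y hy => by
    simp [ht', Instr.run, hy.ne, hst.1 y (by omega), show y ≠ d + 2 by omega]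
  have hloop := sum_loop hf (N := e.eval s) (t := t') hm.1 hm.2.2 hd
    (hs.mono (Nat.le_add_right M (e.size.eval M))) (by omega) (by simp [ht', Instr.run])
    (by simp [ht', Instr.run, hte]) hst.2.symm hreg
  refine Runs.instr_seq (Runs.instr_seq ((hloop.mono (by gcongr) fun _ hu => hu).seq ?_))
  rintro u ⟨hsum, harr, hsave, hreg⟩
  refine Runs.instr ⟨⟨fun y hy => ?_, harr.symm⟩, ?_⟩
  · grind [Instr.run, State.setReg_reg, hst.1 x]
  · grind [Instr.run, State.setReg_reg, eval]

end CompilesCorrectly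

theorem compilesCorrectly (e : Expr) : e.CompilesCorrectly := by
  induction e with
  | lit c => exact CompilesCorrectly.lit c
  | var x => exact CompilesCorrectly.var x
  | get a e ih => exact ih.get a
  | add e f ihe ihf => exact ihe.add ihf
  | mul e f ihe ihf => exact ihe.mul ihf
  | lt e f ihe ihf => exact ihe.lt ihf
  | eq e f ihe ihf => exact ihe.eq ihf
  | sum x e f ihe ihf => exact CompilesCorrectly.sum x ihe ihf

end Expr

/-- Structured statements: `assign x e` is `x := e`, `store a e f` is `a[e] := f`, `cond e p q`
runs `p` if `e` is positive and `q` otherwise, and `for_ x e p` runs `p` for `x` from `0` to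
`e - 1`, where the bound `e` is evaluated once. -/
inductive Stmt where
  | assign (x : ℕ) (e : Expr)
  | store (a : ℕ) (e f : Expr)
  | skip
  | seq (p q : Stmt)
  | cond (e : Expr) (p q : Stmt)
  | for_ (x : ℕ) (e : Expr) (p : Stmt)

namespace Stmt

/-- The state after the iterations `x = 0, …, i - 1` of a loop whose body has the effect `f`. -/
def iter (x : ℕ) (f : State → State) (s : State) : ℕ → State
  | 0 => s
  | i + 1 => f ((iter x f s i).setReg x i)

/-- The effect of a statement. -/
def eval : Stmt → State → State
  | assign x e, s => s.setReg x (e.eval s)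
  | store a e f, s => s.setArr a (e.eval s) (f.eval s)
  | skip, s => s
  | seq p q, s => q.eval (p.eval s)
  | cond e p q, s => if 0 < e.eval s then p.eval s else q.eval s
  | for_ x e p, s => iter x p.eval s (e.eval s)

/-- All registers that occur in the statement are below this number. -/
def fresh : Stmt → ℕ
  | assign x e => max (x + 1) e.fresh
  | store _ e f => max e.fresh f.fresh
  | skip => 0
  | seq p q => max p.fresh q.fresh
  | cond e p q => max e.fresh (max p.fresh q.fresh)
  | for_ x e p => max (x + 1) (max e.fresh p.fresh)

/-- The code of a statement; it uses registers from `d` on for intermediate results. -/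
def compile : Stmt → ℕ → Prog
  | assign x e, d => .seq (e.compile d) (.instr (.copy x d))
  | store a e f, d => .seq (e.compile d) (.seq (f.compile (d + 1)) (.instr (.store a d (d + 1))))
  | skip, _ => .skip
  | seq p q, d => .seq (p.compile d) (q.compile d)
  | cond e p q, d => .seq (e.compile d) (.seq (.instr (.const (d + 1) 0))
      (.branch (.lt (d + 1) d) (p.compile d) (q.compile d)))
  | for_ x e p, d => .seq (e.compile d) (countTo (d + 1) d
      (.seq (.instr (.copy x (d + 1))) (p.compile (d + 2))))

/-- A bound for the running time of the code of a statement, in terms of a bound for all states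
that occur. -/
noncomputable def cost : Stmt → Polynomial ℕ
  | assign _ e => e.cost + 1
  | store _ e f => e.cost + (f.cost + 1)
  | skip => 1
  | seq p q => p.cost + q.cost
  | cond e p q => e.cost + (1 + (p.cost + q.cost + 1))
  | for_ _ e p => e.cost + (e.size * (1 + p.cost + 2) + 2)

/-- All states that occur in the run of the statement are bounded by `M`. -/
def Safe (m M : ℕ) : Stmt → State → Prop
  | assign _ _, s => Bounded m M s
  | store _ _ _, s => Bounded m M s
  | skip, _ => True
  | seq p q, s => p.Safe m M s ∧ q.Safe m M (p.eval s)
  | cond e p q, s => Bounded m M s ∧ (0 < e.eval s → p.Safe m M s) ∧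
      (¬ 0 < e.eval s → q.Safe m M s)
  | for_ x e p, s => Bounded m M s ∧ ∀ i < e.eval s, p.Safe m M ((iter x p.eval s i).setReg x i)

/-- The code of the statement is correct, within the time bound; only the registers below `m`
matter to the statement, and those between `m` and `d` are preserved. -/
def CompilesCorrectly (p : Stmt) : Prop :=
  ∀ ⦃m d M : ℕ⦄ ⦃s s₀ : State⦄, p.fresh ≤ m → m ≤ d → Agree m s s₀ → p.Safe m M s₀ →
    Runs (p.compile d) s (p.cost.eval M) fun t =>
      Agree m t (p.eval s₀) ∧ ∀ x, m ≤ x → x < d → t.reg x = s.reg x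

theorem expr_runs {e : Expr} {m d M : ℕ} {s s₀ : State} (he : e.fresh ≤ m) (hd : m ≤ d)
    (hs : Agree m s s₀) (hM : Bounded m M s₀) :
    Runs (e.compile d) s (e.cost.eval M) fun t =>
      Agree d s t ∧ Agree m t s₀ ∧ t.reg d = e.eval s₀ :=
  (e.compilesCorrectly he hd (hM.congr hs.symm)).mono le_rfl fun _ ht =>
    ⟨ht.1, (ht.1.mono hd).symm.trans hs, ht.2.trans (e.eval_congr he hs)⟩

namespace CompilesCorrectly

variable {p q : Stmt}

theorem assign (x : ℕ) (e : Expr) : CompilesCorrectly (.assign x e) := by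
  intro m d M s s₀ hm hd hs hM
  simp only [fresh, max_le_iff] at hm
  simp only [cost, Polynomial.eval_add, Polynomial.eval_one]
  refine (expr_runs hm.2 hd hs hM).seq ?_
  rintro t ⟨hst, hts₀, hval⟩
  refine Runs.instr ⟨?_, fun y hy hyd => ?_⟩
  · simpa only [Instr.run, hval, eval] using hts₀.setReg x _
  · simp [Instr.run, show y ≠ x by omega, hst.1 y hyd]

theorem store (a : ℕ) (e f : Expr) : CompilesCorrectly (.store a e f) := by
  intro m d M s s₀ hm hd hs hM
  simp only [fresh, max_le_iff] at hm
  simp only [cost, Polynomial.eval_add, Polynomial.eval_one]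
  refine (expr_runs hm.1 hd hs hM).seq ?_
  rintro t ⟨hst, hts₀, hval⟩
  refine (expr_runs hm.2 (by omega) hts₀ hM).seq ?_
  rintro u ⟨htu, hus₀, hval'⟩
  refine Runs.instr ⟨⟨fun y hy => hus₀.1 y hy, ?_⟩, fun y _ hyd => ?_⟩
  · simp only [Instr.run, eval, State.setArr, hus₀.2, hval', ← htu.1 d (by omega), hval]
  · simp [Instr.run, ← htu.1 y (by omega), hst.1 y hyd]

theorem skip : CompilesCorrectly .skip := by
  intro m d M s s₀ _ _ hs _
  exact ⟨1, s, .skip s, by simp [cost], hs, fun _ _ _ => rfl⟩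

theorem seq (hp : p.CompilesCorrectly) (hq : q.CompilesCorrectly) :
    CompilesCorrectly (.seq p q) := by
  intro m d M s s₀ hm hd hs hM
  simp only [fresh, max_le_iff] at hm
  simp only [cost, Polynomial.eval_add]
  refine (hp hm.1 hd hs hM.1).seq ?_
  rintro t ⟨hts₀, hreg⟩
  exact (hq hm.2 hd hts₀ hM.2).mono le_rfl fun u hu =>
    ⟨hu.1, fun x hx hxd => (hu.2 x hx hxd).trans (hreg x hx hxd)⟩

theorem cond (e : Expr) (hp : p.CompilesCorrectly) (hq : q.CompilesCorrectly) :
    CompilesCorrectly (.cond e p q) := by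
  intro m d M s s₀ hm hd hs ⟨hM, hpM, hqM⟩
  simp only [fresh, max_le_iff] at hm
  simp only [cost, Polynomial.eval_add, Polynomial.eval_one]
  refine (expr_runs hm.1 hd hs hM).seq ?_
  rintro t ⟨hst, hts₀, hval⟩
  set t' := (Instr.const (d + 1) 0).run t with ht'
  have ht's₀ : Agree m t' s₀ := (hts₀.symm.setReg_right (by omega) 0).symm
  have hreg : ∀ x < d, t'.reg x = s.reg x := fun x hx => by
    simp [ht', Instr.run, show x ≠ d + 1 by omega, hst.1 x hx]
  have htest : (Test.lt (d + 1) d).Holds t' ↔ 0 < e.eval s₀ := by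
    simp [Test.Holds, ht', Instr.run, hval]
  refine Runs.instr_seq (Runs.branch (fun hb => ?_) fun hb => ?_) <;> rw [htest] at hb
  · refine (hp hm.2.1 hd ht's₀ (hpM hb)).mono (Nat.le_add_right _ _) fun u hu => ?_
    exact ⟨by simpa only [eval, if_pos hb] using hu.1,
      fun x hx hxd => (hu.2 x hx hxd).trans (hreg x hxd)⟩
  · refine (hq hm.2.2 hd ht's₀ (hqM hb)).mono (Nat.le_add_left _ _) fun u hu => ?_
    exact ⟨by simpa only [eval, if_neg hb] using hu.1,
      fun x hx hxd => (hu.2 x hx hxd).trans (hreg x hxd)⟩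

theorem for_ (x : ℕ) (e : Expr) (hp : p.CompilesCorrectly) :
    CompilesCorrectly (.for_ x e p) := by
  intro m d M s s₀ hm hd hs ⟨hM, hpM⟩
  simp only [fresh, max_le_iff] at hm
  simp only [cost, Polynomial.eval_add, Polynomial.eval_one, Polynomial.eval_mul,
    Polynomial.eval_ofNat]
  refine (expr_runs hm.2.1 hd hs hM).seq ?_
  rintro t ⟨hst, hts₀, hval⟩
  have hN := e.eval_le_size hm.2.1 hM
  refine (countTo_runs (by omega) (fun j u => Agree m u (iter x p.eval s₀ j) ∧
    ∀ y, m ≤ y → y < d → u.reg y = s.reg y) hval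
    ⟨(hts₀.symm.setReg_right (by omega) 0).symm, fun y _ hyd => ?_⟩ ?_).mono (by gcongr)
    fun _ hu => hu
  · simp [show y ≠ d + 1 by omega, hst.1 y hyd]
  · rintro j hj u hc hb ⟨hus₀, hreg⟩
    have hagree := hus₀.setReg x j
    rw [← hc] at hagree
    refine Runs.instr_seq ((hp hm.2.2 (by omega) hagree (hc ▸ hpM j hj)).mono le_rfl ?_)
    rintro u' ⟨hu's₀, hreg'⟩
    have hframe : ∀ y, m ≤ y → y < d + 2 → u'.reg y = u.reg y := fun y hy hyd => by
      simp [hreg' y hy hyd, show y ≠ x by omega]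
    refine ⟨by rw [hframe _ (by omega) (by omega), hc], by rw [hframe _ hd (by omega), hb],
      ?_, fun y hy hyd => ?_⟩
    · simpa only [iter, hc] using (hu's₀.symm.setReg_right (by omega) (j + 1)).symm
    · simp [show y ≠ d + 1 by omega, hframe y hy (by omega), hreg y hy hyd]

end CompilesCorrectly

theorem compilesCorrectly (p : Stmt) : p.CompilesCorrectly := by
  induction p with
  | assign x e => exact CompilesCorrectly.assign x e
  | store a e f => exact CompilesCorrectly.store a e f
  | skip => exact CompilesCorrectly.skip
  | seq p q ihp ihq => exact ihp.seq ihq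
  | cond e p q ihp ihq => exact ihp.cond e ihq
  | for_ x e p ih => exact ih.for_ x e

end Stmt

/-- Expressions whose value is at most `C`, or a number that is already in the state. -/
def Expr.Small (C : ℕ) : Expr → Prop
  | .lit c => c ≤ C
  | .var _ => True
  | .get _ _ => True
  | .eq _ _ => 1 ≤ C
  | _ => False

theorem Expr.Small.eval_le {C m M : ℕ} {e : Expr} {s : State} (he : e.Small C) (hC : C ≤ M)
    (hm : e.fresh ≤ m) (hs : Bounded m M s) : e.eval s ≤ M := by
  cases e with
  | lit c => exact le_trans he hC
  | var x => exact hs.1 x hm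
  | get a e => exact hs.2 _ _
  | eq e f =>
    have hone : 1 ≤ C := he
    simp only [Expr.eval]
    split <;> omega
  | add _ _ | mul _ _ | lt _ _ | sum _ _ _ => exact he.elim

namespace Stmt

variable {p : Stmt} {s : State}

/-- Statements that write only numbers up to `C` and numbers that are already in the state. -/
def Small (C : ℕ) : Stmt → Prop
  | assign _ e => e.Small C
  | store _ _ f => f.Small C
  | skip => True
  | seq p q => p.Small C ∧ q.Small C
  | cond _ p q => p.Small C ∧ q.Small C
  | for_ _ e p => e.Small C ∧ p.Small C

theorem iter_induct {x n : ℕ} {f : State → State} (I : ℕ → State → Prop) (h0 : I 0 s)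
    (hf : ∀ i < n, ∀ t, I i t → I (i + 1) (f (t.setReg x i))) : ∀ i ≤ n, I i (iter x f s i) := by
  intro i
  induction i with
  | zero => exact fun _ => h0
  | succ i ih => exact fun hi => hf i hi _ (ih (by omega))

theorem for_induct {x : ℕ} {e : Expr} (I : ℕ → State → Prop)
    (h0 : I 0 s) (hp : ∀ i < e.eval s, ∀ t, I i t → I (i + 1) (p.eval (t.setReg x i))) :
    I (e.eval s) ((for_ x e p).eval s) :=
  iter_induct I h0 hp _ le_rfl

theorem Small.safe {C m M : ℕ} (hC : C ≤ M) (hp : p.Small C) (hm : p.fresh ≤ m)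
    (hs : Bounded m M s) : p.Safe m M s ∧ Bounded m M (p.eval s) := by
  induction p generalizing s with
  | assign x e =>
    simp only [fresh, max_le_iff] at hm
    exact ⟨hs, hs.setReg _ (Expr.Small.eval_le hp hC hm.2 hs)⟩
  | store a e f =>
    simp only [fresh, max_le_iff] at hm
    exact ⟨hs, hs.setArr _ _ (Expr.Small.eval_le hp hC hm.2 hs)⟩
  | skip => exact ⟨trivial, hs⟩
  | seq p q ihp ihq =>
    simp only [fresh, max_le_iff] at hm
    obtain ⟨hsafe, hbound⟩ := ihp hp.1 hm.1 hs
    obtain ⟨hsafe', hbound'⟩ := ihq hp.2 hm.2 hbound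
    exact ⟨⟨hsafe, hsafe'⟩, hbound'⟩
  | cond e p q ihp ihq =>
    simp only [fresh, max_le_iff] at hm
    obtain ⟨hsafe, hbound⟩ := ihp hp.1 hm.2.1 hs
    obtain ⟨hsafe', hbound'⟩ := ihq hp.2 hm.2.2 hs
    refine ⟨⟨hs, fun _ => hsafe, fun _ => hsafe'⟩, ?_⟩
    simp only [eval]
    split
    exacts [hbound, hbound']
  | for_ x e p ih =>
    simp only [fresh, max_le_iff] at hm
    have he := Expr.Small.eval_le hp.1 hC hm.2.1 hs
    have hiter := iter_induct (x := x) (n := e.eval s) (fun _ => Bounded m M) hs fun i hi t ht =>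
      (ih hp.2 hm.2.2 (ht.setReg x (by omega))).2
    exact ⟨⟨hs, fun i hi => (ih hp.2 hm.2.2 ((hiter i hi.le).setReg x (by omega))).1⟩,
      hiter _ le_rfl⟩

/-- The arrays a statement writes to. -/
def arrs : Stmt → List ℕ
  | assign _ _ => []
  | store a _ _ => [a]
  | skip => []
  | seq p q => p.arrs ++ q.arrs
  | cond _ p q => p.arrs ++ q.arrs
  | for_ _ _ p => p.arrs

/-- The registers a statement writes to. -/
def regs : Stmt → List ℕ
  | assign x _ => [x]
  | store _ _ _ => []
  | skip => []
  | seq p q => p.regs ++ q.regs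
  | cond _ p q => p.regs ++ q.regs
  | for_ x _ p => x :: p.regs

theorem eval_arr {a : ℕ} (ha : a ∉ p.arrs) : (p.eval s).arr a = s.arr a := by
  induction p generalizing s with
  | assign | skip => rfl
  | store b e f =>
    simp only [arrs, List.mem_singleton] at ha
    simp only [eval, State.setArr_arr, ha, if_false]
  | seq p q ihp ihq =>
    simp only [arrs, List.mem_append, not_or] at ha
    simp only [eval, ihq ha.2, ihp ha.1]
  | cond e p q ihp ihq =>
    simp only [arrs, List.mem_append, not_or] at ha
    simp only [eval]
    split
    exacts [ihp ha.1, ihq ha.2]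
  | for_ x e p ih =>
    exact for_induct (fun _ t => t.arr a = s.arr a) rfl fun i _ t ht => (ih ha).trans ht

theorem eval_reg {y : ℕ} (hy : y ∉ p.regs) : (p.eval s).reg y = s.reg y := by
  induction p generalizing s with
  | assign x e =>
    simp only [regs, List.mem_singleton] at hy
    simp [eval, hy]
  | store | skip => rfl
  | seq p q ihp ihq =>
    simp only [regs, List.mem_append, not_or] at hy
    simp only [eval, ihq hy.2, ihp hy.1]
  | cond e p q ihp ihq =>
    simp only [regs, List.mem_append, not_or] at hy
    simp only [eval]
    split
    exacts [ihp hy.1, ihq hy.2]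
  | for_ x e p ih =>
    simp only [regs, List.mem_cons, not_or] at hy
    refine for_induct (fun _ t => t.reg y = s.reg y) rfl fun i _ t ht => ?_
    rw [ih hy.2, State.setReg_reg, if_neg hy.1, ht]

end Stmt

end RAM

/-! ### Colourings -/

section Colouring

variable {V : Type*} {G : SimpleGraph V} {X : Finset V} {S : Set V} {p q : ℕ} {v w : V}

/-- The set `S` is empty, or it is the vertex set of a component of `G - X` and a clique. -/
structure IsBlock (G : SimpleGraph V) (X : Finset V) (S : Set V) : Prop where
  notMem : ∀ v ∈ S, v ∉ X
  isClique : G.IsClique S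
  mem_of_adj : ∀ u ∈ S, ∀ v ∉ X, G.Adj u v → v ∈ S

/-- The edge `vw` has an end in the block `S`, and the other end there or in `X`. -/
structure IsLink (G : SimpleGraph V) (X : Finset V) (S : Set V) (v w : V) : Prop where
  adj : G.Adj v w
  left : v ∈ S ∨ v ∈ X
  right : w ∈ S ∨ w ∈ X
  meets : v ∈ S ∨ w ∈ S

theorem IsLink.symm (h : IsLink G X S v w) : IsLink G X S w v :=
  ⟨h.adj.symm, h.right, h.left, h.meets.symm⟩

/-- Every vertex that is coloured outside of `X` lies in one of the first `i` blocks `S 0`,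
`S 1`, …. -/
def LivesBelow (X : Finset V) (S : ℕ → Set V) (i : ℕ) (σ : V → ℕ) : Prop :=
  ∀ v ∉ X, σ v ≠ 0 → ∃ j < i, v ∈ S j

theorem LivesBelow.mono {S : ℕ → Set V} {i j : ℕ} {σ : V → ℕ} (h : LivesBelow X S i σ)
    (hij : i ≤ j) : LivesBelow X S j σ := fun v hv hv0 =>
  (h v hv hv0).imp fun _ hk => ⟨hk.1.trans_le hij, hk.2⟩

variable [Fintype V] {σ σ' ρ ρ' τ : V → ℕ}

open Classical in
/-- The number of neighbours of `v` whose colour is complementary to `p`. A colouring describes a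
pair `(A, B)` of disjoint sets: colour `1` means `A`, colour `2` means `B`, and colour `0` means
neither; the colours `1` and `2` are complementary. -/
noncomputable def rivalDegree (G : SimpleGraph V) (σ : V → ℕ) (p : ℕ) (v : V) : ℕ :=
  (Finset.univ.filter fun w => G.Adj v w ∧ p + σ w = 3).card

theorem rivalDegree_eq_zero : rivalDegree G σ p v = 0 ↔ ∀ w, G.Adj v w → p + σ w ≠ 3 := by
  simp [rivalDegree, Finset.filter_eq_empty_iff]

theorem rivalDegree_eq_one : rivalDegree G σ p v = 1 ↔ ∃! w, G.Adj v w ∧ p + σ w = 3 := by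
  simp [rivalDegree, Finset.card_eq_one, Finset.singleton_iff_unique_mem]

theorem rivalDegree_congr (h : ∀ w, G.Adj v w → (p + σ w = 3 ↔ p + ρ w = 3)) :
    rivalDegree G σ p v = rivalDegree G ρ p v := by
  classical
  unfold rivalDegree
  congr 1
  exact Finset.filter_congr fun w _ => and_congr_right (h w)

/-- The size `|A|` of the pair described by a colouring. -/
def weight (σ : V → ℕ) : ℕ :=
  (Finset.univ.filter fun v => σ v = 1).card

/-- Every coloured vertex in `S` has exactly one neighbour of the complementary colour. -/
def IsMatchedOn (G : SimpleGraph V) (S : Set V) (σ : V → ℕ) : Prop :=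
  ∀ v ∈ S, σ v ≠ 0 → rivalDegree G σ (σ v) v = 1

theorem IsMatchedOn.eq_of_adj {u : V} (h : IsMatchedOn G S σ) (hv : v ∈ S) (hσ : σ v ≠ 0)
    (hu : G.Adj v u) (hvu : σ v + σ u = 3) (hw : G.Adj v w) (hvw : σ v + σ w = 3) : u = w :=
  (rivalDegree_eq_one.1 (h v hv hσ)).unique ⟨hu, hvu⟩ ⟨hw, hvw⟩

open Classical in
/-- The colouring `σ'` arises from `σ` by joining `v` and `w` as partners with colours `p`
and `q`. The vertices of `X` have got their colours, but not their partners, in advance. -/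
structure Joins (G : SimpleGraph V) (X : Finset V) (p q : ℕ) (v w : V) (σ σ' : V → ℕ) : Prop where
  adj : G.Adj v w
  add_eq : p + q = 3
  left_ne : p ≠ 0
  right_ne : q ≠ 0
  left : σ v = if v ∈ X then p else 0
  right : σ w = if w ∈ X then q else 0
  degree_left : rivalDegree G σ p v = if w ∈ X then 1 else 0
  degree_right : rivalDegree G σ q w = if v ∈ X then 1 else 0
  new_left : σ' v = p
  new_right : σ' w = q
  other : ∀ u, u ≠ v → u ≠ w → σ' u = σ u

namespace Joins

theorem symm (h : Joins G X p q v w σ σ') : Joins G X q p w v σ σ' where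
  adj := h.adj.symm
  add_eq := by rw [add_comm, h.add_eq]
  left_ne := h.right_ne
  right_ne := h.left_ne
  left := h.right
  right := h.left
  degree_left := h.degree_right
  degree_right := h.degree_left
  new_left := h.new_right
  new_right := h.new_left
  other u huw huv := h.other u huv huw

theorem eq_right_iff (h : Joins G X p q v w σ σ') (u : V) : σ' u = q ↔ u = w ∨ σ u = q := by
  have hpq := h.add_eq
  by_cases huw : u = w
  · simp [huw, h.new_right]
  by_cases huv : u = v
  · subst huv
    have hne : p ≠ q := by omega
    rw [h.new_left, h.left]
    split_ifs <;> simp [huw, hne, h.right_ne.symm]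
  · simp [h.other u huv huw, huw]

theorem rival_iff (h : Joins G X p q v w σ σ') (u : V) : p + σ' u = 3 ↔ u = w ∨ p + σ u = 3 := by
  have hrival (x : ℕ) : p + x = 3 ↔ x = q := by have := h.add_eq; omega
  rw [hrival, hrival, h.eq_right_iff]

theorem rivalDegree_left (h : Joins G X p q v w σ σ') : rivalDegree G σ' p v = 1 := by
  by_cases hw : w ∈ X
  · rw [← (h.degree_left.trans (if_pos hw))]
    refine rivalDegree_congr fun u _ => (h.rival_iff u).trans (or_iff_right_of_imp ?_)
    rintro rfl
    rw [h.right, if_pos hw, h.add_eq]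
  · have hnone := rivalDegree_eq_zero.1 (h.degree_left.trans (if_neg hw))
    refine rivalDegree_eq_one.2 ⟨w, ⟨h.adj, (h.rival_iff w).2 (Or.inl rfl)⟩, ?_⟩
    rintro u ⟨hvu, hu⟩
    exact ((h.rival_iff u).1 hu).resolve_right (hnone u hvu)

theorem rivalDegree_of_ne {z : V} (h : Joins G X p q v w σ σ') (hz : z ≠ v) (hzp : σ z = p) :
    rivalDegree G σ' p z = rivalDegree G σ p z := by
  have hpq := h.add_eq
  refine rivalDegree_congr fun u hzu => (h.rival_iff u).trans (or_iff_right_of_imp ?_)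
  rintro rfl
  exfalso
  by_cases hvX : v ∈ X
  · have hσv := h.left.trans (if_pos hvX)
    exact hz ((rivalDegree_eq_one.1 (h.degree_right.trans (if_pos hvX))).unique
      ⟨hzu.symm, by omega⟩ ⟨h.adj.symm, by omega⟩)
  · exact rivalDegree_eq_zero.1 (h.degree_right.trans (if_neg hvX)) z hzu.symm (by omega)

theorem le_two (h : Joins G X p q v w σ σ') (hσ : ∀ u, σ u ≤ 2) (u : V) : σ' u ≤ 2 := by
  have hpq := h.add_eq
  have hp := h.left_ne
  have hq := h.right_ne
  by_cases huv : u = v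
  · rw [huv, h.new_left]
    omega
  by_cases huw : u = w
  · rw [huw, h.new_right]
    omega
  · exact h.other u huv huw ▸ hσ u

open Classical in
theorem rivalDegree_eq (h : Joins G X p q v w σ σ') (hσ : ∀ u, σ u ≤ 2) (u : V) :
    rivalDegree G σ' (σ' u) u =
      if u = v ∨ u = w then 1 else rivalDegree G σ (σ u) u := by
  have hpq := h.add_eq
  have hp := h.left_ne
  have hq := h.right_ne
  split_ifs with huvw
  · rcases huvw with rfl | rfl
    · rw [h.new_left, h.rivalDegree_left]
    · rw [h.new_right, h.symm.rivalDegree_left]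
  · obtain ⟨huv, huw⟩ := not_or.1 huvw
    rw [h.other u huv huw]
    obtain hup | huq | hu0 : σ u = p ∨ σ u = q ∨ σ u = 0 := by have := hσ u; omega
    · rw [hup, h.rivalDegree_of_ne huv hup]
    · rw [huq, h.symm.rivalDegree_of_ne huw huq]
    · have hne (y : V) : σ u + σ y ≠ 3 := by have := hσ y; omega
      have hne' (y : V) : σ u + σ' y ≠ 3 := by have := h.le_two hσ y; omega
      exact rivalDegree_congr fun y _ => iff_of_false (hne' y) (hne y)

theorem isMatchedOn (h : Joins G X p q v w σ σ') (hσ : ∀ u, σ u ≤ 2) (hS : IsMatchedOn G S σ) :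
    IsMatchedOn G S σ' := by
  intro u hu hu0
  rw [h.rivalDegree_eq hσ u]
  split_ifs with huvw
  · rfl
  · obtain ⟨huv, huw⟩ := not_or.1 huvw
    exact hS u hu (h.other u huv huw ▸ hu0)

open Classical in
theorem weight_eq (h : Joins G X 1 2 v w σ σ') :
    weight σ' = weight σ + if v ∈ X then 0 else 1 := by
  have hclass : (Finset.univ.filter fun u => σ' u = 1) =
      insert v (Finset.univ.filter fun u => σ u = 1) := by
    ext u
    simpa using h.symm.eq_right_iff u
  unfold weight
  rw [hclass]
  split_ifs with hv
  · rw [Finset.insert_eq_of_mem (by simp [h.left, hv]), add_zero]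
  · rw [Finset.card_insert_of_notMem (by simp [h.left, hv])]

end Joins

theorem joins_one_two_iff [DecidableEq V] (hvw : G.Adj v w) :
    Joins G X 1 2 v w σ σ' ↔
      ((σ v = (if v ∈ X then 1 else 0) ∧ σ w = if w ∈ X then 2 else 0) ∧
        rivalDegree G σ 1 v = (if w ∈ X then 1 else 0) ∧
        rivalDegree G σ 2 w = if v ∈ X then 1 else 0) ∧
      σ' = Function.update (Function.update σ v 1) w 2 := by
  constructor
  · intro h
    refine ⟨⟨⟨?_, ?_⟩, ?_, ?_⟩, funext fun u => ?_⟩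
    rotate_right
    · simp only [Function.update_apply]
      split_ifs with hw hv
      exacts [hw ▸ h.new_right, hv ▸ h.new_left, h.other u hv hw]
    exacts [by convert h.left, by convert h.right, by convert h.degree_left,
      by convert h.degree_right]
  · rintro ⟨⟨⟨hv, hw⟩, hdv, hdw⟩, rfl⟩
    exact ⟨hvw, rfl, one_ne_zero, two_ne_zero, by convert hv, by convert hw, by convert hdv,
      by convert hdw, by simp [hvw.ne], by simp,
      fun u huv huw => by simp [huv, huw]⟩

/-- The colourings look alike from outside of the part of the graph that has been dealt with: they
have the same weight and agree on `X`, its vertices have equally many rivals (where two is as bad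
as more), and the same colours occur in the block `S`. -/
structure IsSimilar (G : SimpleGraph V) (X : Finset V) (S : Set V) (σ ρ : V → ℕ) : Prop where
  weight_eq : weight σ = weight ρ
  colour_eq : ∀ x ∈ X, σ x = ρ x
  degree_eq : ∀ x ∈ X, min (rivalDegree G σ (σ x) x) 2 = min (rivalDegree G ρ (ρ x) x) 2
  occurs_iff : ∀ q, q = 1 ∨ q = 2 → ((∃ v ∈ S, σ v = q) ↔ ∃ v ∈ S, ρ v = q)

theorem IsSimilar.refl (G : SimpleGraph V) (X : Finset V) (S : Set V) (σ : V → ℕ) :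
    IsSimilar G X S σ σ :=
  ⟨rfl, fun _ _ => rfl, fun _ _ => rfl, fun _ _ => Iff.rfl⟩

theorem IsSimilar.trans {π : V → ℕ} (h : IsSimilar G X S σ ρ) (h' : IsSimilar G X S ρ π) :
    IsSimilar G X S σ π where
  weight_eq := h.weight_eq.trans h'.weight_eq
  colour_eq x hx := (h.colour_eq x hx).trans (h'.colour_eq x hx)
  degree_eq x hx := (h.degree_eq x hx).trans (h'.degree_eq x hx)
  occurs_iff q hq := (h.occurs_iff q hq).trans (h'.occurs_iff q hq)

theorem IsSimilar.isMatchedOn (h : IsSimilar G X S σ ρ) (hρ : IsMatchedOn G X ρ) :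
    IsMatchedOn G X σ := by
  intro x hx hx0
  have hdeg := h.degree_eq x hx
  rw [hρ x hx (h.colour_eq x hx ▸ hx0)] at hdeg
  omega

theorem Joins.similar (h : Joins G X 1 2 v w σ σ') (h' : Joins G X 1 2 v w ρ ρ')
    (hσ : ∀ u, σ u ≤ 2) (hρ : ∀ u, ρ u ≤ 2) (hsim : IsSimilar G X S σ ρ) :
    IsSimilar G X S σ' ρ' where
  weight_eq := by rw [h.weight_eq, h'.weight_eq, hsim.weight_eq]
  colour_eq x hx := by
    by_cases hxv : x = v
    · rw [hxv, h.new_left, h'.new_left]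
    · by_cases hxw : x = w
      · rw [hxw, h.new_right, h'.new_right]
      · rw [h.other x hxv hxw, h'.other x hxv hxw, hsim.colour_eq x hx]
  degree_eq x hx := by
    rw [h.rivalDegree_eq hσ x, h'.rivalDegree_eq hρ x]
    split_ifs
    exacts [rfl, hsim.degree_eq x hx]
  occurs_iff q hq := by
    rcases hq with rfl | rfl
    · have hocc := hsim.occurs_iff 1 (Or.inl rfl)
      simp only [h.symm.eq_right_iff, h'.symm.eq_right_iff, and_or_left, exists_or, hocc]
    · have hocc := hsim.occurs_iff 2 (Or.inr rfl)
      simp only [h.eq_right_iff, h'.eq_right_iff, and_or_left, exists_or, hocc]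

theorem IsSimilar.of_livesBelow {S : ℕ → Set V} {S' : Set V} {i : ℕ} (h : IsSimilar G X S' σ ρ)
    (hX : ∀ v ∈ S i, v ∉ X) (hS : ∀ j < i, Disjoint (S j) (S i)) (hσ : LivesBelow X S i σ)
    (hρ : LivesBelow X S i ρ) : IsSimilar G X (S i) σ ρ where
  weight_eq := h.weight_eq
  colour_eq := h.colour_eq
  degree_eq := h.degree_eq
  occurs_iff q hq := by
    have not_occurs {π : V → ℕ} (hπ : LivesBelow X S i π) : ¬ ∃ v ∈ S i, π v = q := by
      rintro ⟨v, hv, hvq⟩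
      obtain ⟨j, hj, hvj⟩ := hπ v (hX v hv) (by omega)
      exact Set.disjoint_left.1 (hS j hj) hvj hv
    exact iff_of_false (not_occurs hσ) (not_occurs hρ)

/-- The colouring describes a pair of perfectly matched sets. -/
structure IsSolution (G : SimpleGraph V) (τ : V → ℕ) : Prop where
  le_two : ∀ v, τ v ≤ 2
  isMatchedOn : IsMatchedOn G Set.univ τ

/-- The link `vw` is an edge of the solution `τ` that has not been dealt with: the part `T` of the
solution contains the ends of `vw` only as far as they are in `X`. -/
structure IsNewEdge (G : SimpleGraph V) (X : Finset V) (S : Set V) (τ : V → ℕ) (T : Set V)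
    (v w : V) : Prop where
  isLink : IsLink G X S v w
  isSolution : IsSolution G τ
  add_eq : τ v + τ w = 3
  subset : ∀ x ∈ X, x ∈ T
  left_mem : v ∈ T → v ∈ X
  right_mem : w ∈ T → w ∈ X

namespace IsNewEdge

variable {T : Set V} {y : V}

theorem symm (h : IsNewEdge G X S τ T v w) : IsNewEdge G X S τ T w v where
  isLink := h.isLink.symm
  isSolution := h.isSolution
  add_eq := by rw [add_comm, h.add_eq]
  subset := h.subset
  left_mem := h.right_mem
  right_mem := h.left_mem

theorem left_ne_zero (h : IsNewEdge G X S τ T v w) : τ v ≠ 0 := by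
  have hsum := h.add_eq
  have hw := h.isSolution.le_two w
  omega

theorem partner_eq (h : IsNewEdge G X S τ T v w) (hy : G.Adj v y) (hvy : τ v + τ y = 3) : y = w :=
  h.isSolution.isMatchedOn.eq_of_adj trivial h.left_ne_zero hy hvy h.isLink.adj h.add_eq

/-- Since `S` is a clique, the partner of `v` is the only vertex of its colour that `S` contains. -/
theorem not_occurs (h : IsNewEdge G X S τ T v w) (hS : IsBlock G X S)
    (hsim : IsSimilar G X S σ (T.indicator τ)) (hv : v ∈ S) : ∀ z ∈ S, σ z ≠ τ w := by
  intro z hz hzw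
  have hsum := h.add_eq
  have hw0 := h.symm.left_ne_zero
  have hv0 := h.left_ne_zero
  obtain ⟨y, hy, hyw⟩ := (hsim.occurs_iff (τ w) (by omega)).1 ⟨z, hz, hzw⟩
  have hyT : y ∈ T := Set.mem_of_indicator_ne_zero (hyw ▸ hw0)
  rw [Set.indicator_of_mem hyT] at hyw
  have hvy : v ≠ y := by
    rintro rfl
    omega
  obtain rfl := h.partner_eq (hS.isClique hv hy hvy) (by omega)
  exact hS.notMem y hy (h.right_mem hyT)

theorem colour_eq (h : IsNewEdge G X S τ T v w) (hsim : IsSimilar G X S σ (T.indicator τ))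
    (hy : y ∈ X) : σ y = τ y := by
  rw [hsim.colour_eq y hy, Set.indicator_of_mem (h.subset y hy)]

theorem degree_eq_zero (h : IsNewEdge G X S τ T v w)
    (hsim : IsSimilar G X S σ (T.indicator τ)) (hv : v ∈ X) (hw : w ∉ X) :
    rivalDegree G σ (τ v) v = 0 := by
  have hzero : rivalDegree G (T.indicator τ) (T.indicator τ v) v = 0 := by
    rw [Set.indicator_of_mem (h.subset v hv)]
    refine rivalDegree_eq_zero.2 fun y hy hvy => ?_
    have hv2 := h.isSolution.le_two v
    have hyT : y ∈ T := Set.mem_of_indicator_ne_zero (f := τ) (by omega)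
    rw [Set.indicator_of_mem hyT] at hvy
    exact hw (h.right_mem (h.partner_eq hy hvy ▸ hyT))
  have hdegree := hsim.degree_eq v hv
  rw [hzero, h.colour_eq hsim hv] at hdegree
  omega

open Classical in
theorem colour_left (h : IsNewEdge G X S τ T v w) (hS : IsBlock G X S)
    (hsim : IsSimilar G X S σ (T.indicator τ)) (hσ : ∀ u, σ u ≤ 2) :
    σ v = if v ∈ X then τ v else 0 := by
  split_ifs with hvX
  · exact h.colour_eq hsim hvX
  have hsum := h.add_eq
  have hvS := h.isLink.left.resolve_right hvX
  have hvw : σ v ≠ τ w := h.not_occurs hS hsim hvS v hvS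
  have hvv : σ v ≠ τ v := by
    rcases h.isLink.right with hwS | hwX
    · exact h.symm.not_occurs hS hsim hwS v hvS
    · have hnone := h.symm.degree_eq_zero hsim hwX hvX
      have := rivalDegree_eq_zero.1 hnone v h.isLink.adj.symm
      omega
  have hσv := hσ v
  have hv0 := h.left_ne_zero
  have hw0 := h.symm.left_ne_zero
  omega

open Classical in
theorem degree_left (h : IsNewEdge G X S τ T v w) (hS : IsBlock G X S)
    (hsim : IsSimilar G X S σ (T.indicator τ)) :
    rivalDegree G σ (τ v) v = if w ∈ X then 1 else 0 := by
  by_cases hvX : v ∈ X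
  · have hwX : w ∉ X := hS.notMem w (h.isLink.meets.resolve_left fun hvS => hS.notMem v hvS hvX)
    rw [if_neg hwX, h.degree_eq_zero hsim hvX hwX]
  have hsum := h.add_eq
  have hvS := h.isLink.left.resolve_right hvX
  have eq_partner (y : V) (hy : G.Adj v y) (hvy : τ v + σ y = 3) : y = w ∧ w ∈ X := by
    have hyX : y ∈ X := by
      by_contra hyX
      exact h.not_occurs hS hsim hvS y (hS.mem_of_adj v hvS y hyX hy) (by omega)
    rw [h.colour_eq hsim hyX] at hvy
    obtain rfl := h.partner_eq hy hvy
    exact ⟨rfl, hyX⟩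
  split_ifs with hwX
  · refine rivalDegree_eq_one.2 ⟨w, ⟨h.isLink.adj, ?_⟩, fun y hy => (eq_partner y hy.1 hy.2).1⟩
    rw [h.colour_eq hsim hwX, hsum]
  · exact rivalDegree_eq_zero.2 fun y hy hvy => hwX (eq_partner y hy hvy).2

theorem joins (h : IsNewEdge G X S τ T v w) (hS : IsBlock G X S)
    (hsim : IsSimilar G X S σ (T.indicator τ)) (hσ : ∀ u, σ u ≤ 2) (hv : σ' v = τ v)
    (hw : σ' w = τ w) (hother : ∀ u, u ≠ v → u ≠ w → σ' u = σ u) :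
    Joins G X (τ v) (τ w) v w σ σ' where
  adj := h.isLink.adj
  add_eq := h.add_eq
  left_ne := h.left_ne_zero
  right_ne := h.symm.left_ne_zero
  left := h.colour_left hS hsim hσ
  right := h.symm.colour_left hS hsim hσ
  degree_left := h.degree_left hS hsim
  degree_right := h.symm.degree_left hS hsim
  new_left := hv
  new_right := hw
  other := hother

theorem joins_indicator (h : IsNewEdge G X S τ T v w) (hS : IsBlock G X S) :
    Joins G X (τ v) (τ w) v w (T.indicator τ) ((insert v (insert w T)).indicator τ) := by
  classical
  refine h.joins hS (.refl G X S _) (fun u => ?_) ?_ ?_ fun u huv huw => ?_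
  · exact (Set.indicator_le_self' (fun _ _ => zero_le) u).trans (h.isSolution.le_two u)
  · simp
  · simp
  · simp [Set.indicator_apply, huv, huw]

end IsNewEdge

/-- The colourings `rows` of a table are extended to `rows'` by means of the rule `R`, which
derives new colourings from old ones, keeping only one of each class of similar colourings. -/
structure Extends (G : SimpleGraph V) (X : Finset V) (S : Set V)
    (R : (V → ℕ) → (V → ℕ) → Prop) (rows rows' : Set (V → ℕ)) : Prop where
  subset : rows ⊆ rows'
  derivable : ∀ P : (V → ℕ) → Prop, (∀ σ ∈ rows, P σ) → (∀ σ σ', P σ → R σ σ' → P σ') →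
    ∀ σ ∈ rows', P σ
  complete : ∀ σ ∈ rows, ∀ σ', R σ σ' → ∃ ρ ∈ rows', IsSimilar G X S ρ σ'

section Table

variable {S : ℕ → Set V} {B : Set V} {i : ℕ} {D D' : V → V → Prop} {T : Set V}
  {rows rows' : Set (V → ℕ)}

/-- The vertices in `T` form a part of the solution `τ` that contains the matching edges dealt
with, which are those in `D`, and is otherwise made up of `X` and of some matching edges. -/
structure IsPartial (X : Finset V) (S : ℕ → Set V) (i : ℕ) (G : SimpleGraph V)
    (D : V → V → Prop) (τ : V → ℕ) (T : Set V) : Prop where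
  subset : ∀ x ∈ X, x ∈ T
  partner_mem : ∀ v ∈ T, v ∉ X → ∀ w, G.Adj v w → τ v + τ w = 3 → w ∈ T
  livesBelow : LivesBelow X S i (T.indicator τ)
  mem : ∀ v w, D v w → τ v = 1 → τ w = 2 → v ∈ T ∧ w ∈ T

theorem IsPartial.isNewEdge (hT : IsPartial X S i G D τ T) (hl : IsLink G X B v w)
    (hτ : IsSolution G τ) (hv : τ v = 1) (hw : τ w = 2) (hvw : ¬(v ∈ T ∧ w ∈ T)) :
    IsNewEdge G X B τ T v w where
  isLink := hl
  isSolution := hτ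
  add_eq := by rw [hv, hw]
  subset := hT.subset
  left_mem hvT := by
    by_contra hvX
    exact hvw ⟨hvT, hT.partner_mem v hvT hvX w hl.adj (by omega)⟩
  right_mem hwT := by
    by_contra hwX
    exact hvw ⟨hT.partner_mem w hwT hwX v hl.adj.symm (by omega), hwT⟩

theorem IsPartial.insert (hT : IsPartial X S (i + 1) G D τ T)
    (h : IsNewEdge G X (S i) τ T v w)
    (hD : ∀ x y, D' x y → D x y ∨ x = v ∧ y = w) :
    IsPartial X S (i + 1) G D' τ (insert v (insert w T)) where
  subset x hx := .inr (.inr (hT.subset x hx))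
  partner_mem := by
    rintro u (rfl | rfl | huT) huX y hy huy
    · exact .inr (.inl (h.partner_eq hy huy))
    · exact .inl (h.symm.partner_eq hy huy)
    · exact .inr (.inr (hT.partner_mem u huT huX y hy huy))
  livesBelow u huX hu := by
    rcases Set.mem_of_indicator_ne_zero hu with rfl | rfl | huT
    · exact ⟨i, i.lt_succ_self, h.isLink.left.resolve_right huX⟩
    · exact ⟨i, i.lt_succ_self, h.isLink.right.resolve_right huX⟩
    · rw [Set.indicator_of_mem (.inr (.inr huT))] at hu
      exact hT.livesBelow u huX (by rwa [Set.indicator_of_mem huT])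
  mem x y hxy hx hy := by
    rcases hD x y hxy with hxy | ⟨rfl, rfl⟩
    · exact (hT.mem x y hxy hx hy).imp (.inr <| .inr ·) (.inr <| .inr ·)
    · exact ⟨.inl rfl, .inr (.inl rfl)⟩

/-- The colourings in a table of the dynamic program when the blocks before `S i` or the links in
`D` have been dealt with: they may become solutions, and every solution restricts to one of them,
up to similarity as seen from `B`. -/
structure IsTable (G : SimpleGraph V) (X : Finset V) (S : ℕ → Set V) (i : ℕ) (B : Set V)
    (D : V → V → Prop) (rows : Set (V → ℕ)) : Prop where
  le_two : ∀ σ ∈ rows, ∀ u, σ u ≤ 2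
  isMatchedOn : ∀ σ ∈ rows, IsMatchedOn G (X : Set V)ᶜ σ
  livesBelow : ∀ σ ∈ rows, LivesBelow X S i σ
  complete : ∀ τ, IsSolution G τ →
    ∃ T, IsPartial X S i G D τ T ∧ ∃ σ ∈ rows, IsSimilar G X B σ (T.indicator τ)

theorem IsTable.next_block (h : IsTable G X S i B D rows) (hX : ∀ v ∈ S i, v ∉ X)
    (hS : ∀ j < i, Disjoint (S j) (S i)) : IsTable G X S (i + 1) (S i) D rows where
  le_two := h.le_two
  isMatchedOn := h.isMatchedOn
  livesBelow σ hσ := (h.livesBelow σ hσ).mono i.le_succ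
  complete τ hτ := by
    obtain ⟨T, hT, σ, hσ, hsim⟩ := h.complete τ hτ
    exact ⟨T, ⟨hT.subset, hT.partner_mem, hT.livesBelow.mono i.le_succ, hT.mem⟩, σ, hσ,
      hsim.of_livesBelow hX hS (h.livesBelow σ hσ) hT.livesBelow⟩

theorem Joins.livesBelow (h : Joins G X p q v w σ σ') (hl : IsLink G X (S i) v w)
    (hσ : LivesBelow X S (i + 1) σ) : LivesBelow X S (i + 1) σ' := by
  intro u huX hu
  by_cases huv : u = v
  · exact ⟨i, i.lt_succ_self, huv ▸ hl.left.resolve_right (huv ▸ huX)⟩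
  by_cases huw : u = w
  · exact ⟨i, i.lt_succ_self, huw ▸ hl.right.resolve_right (huw ▸ huX)⟩
  · exact hσ u huX (h.other u huv huw ▸ hu)

theorem IsTable.join (h : IsTable G X S (i + 1) (S i) D rows) (hS : IsBlock G X (S i))
    (hext : Extends G X (S i) (fun σ σ' => IsLink G X (S i) v w ∧ Joins G X 1 2 v w σ σ')
      rows rows')
    (hD : ∀ x y, D' x y → D x y ∨ IsLink G X (S i) v w ∧ x = v ∧ y = w) :
    IsTable G X S (i + 1) (S i) D' rows' := by
  classical
  have hrows' := hext.derivable
    (fun σ => (∀ u, σ u ≤ 2) ∧ IsMatchedOn G (X : Set V)ᶜ σ ∧ LivesBelow X S (i + 1) σ)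
    (fun σ hσ => ⟨h.le_two σ hσ, h.isMatchedOn σ hσ, h.livesBelow σ hσ⟩)
    (fun σ σ' hσ hj => ⟨hj.2.le_two hσ.1, hj.2.isMatchedOn hσ.1 hσ.2.1,
      hj.2.livesBelow hj.1 hσ.2.2⟩)
  refine ⟨fun σ hσ => (hrows' σ hσ).1, fun σ hσ => (hrows' σ hσ).2.1,
    fun σ hσ => (hrows' σ hσ).2.2, fun τ hτ => ?_⟩
  obtain ⟨T, hT, σ, hσ, hsim⟩ := h.complete τ hτ
  by_cases hnew : (IsLink G X (S i) v w ∧ τ v = 1 ∧ τ w = 2) ∧ ¬(v ∈ T ∧ w ∈ T)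
  · obtain ⟨⟨hl, hv, hw⟩, hvw⟩ := hnew
    have hedge := hT.isNewEdge hl hτ hv hw hvw
    have hjoin : Joins G X 1 2 v w σ (Function.update (Function.update σ v 1) w 2) :=
      hw ▸ hv ▸ hedge.joins hS hsim (h.le_two σ hσ) (by simp [hl.adj.ne, hv]) (by simp [hw])
        fun u huv huw => by simp [huv, huw]
    obtain ⟨ρ, hρ, hsimρ⟩ := hext.complete σ hσ _ ⟨hl, hjoin⟩
    refine ⟨_, hT.insert hedge fun x y hxy => (hD x y hxy).imp_right And.right, ρ, hρ,
      hsimρ.trans (hjoin.similar (hw ▸ hv ▸ hedge.joins_indicator hS) (h.le_two σ hσ) ?_ hsim)⟩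
    exact fun u => (Set.indicator_le_self' (fun _ _ => zero_le) u).trans (hτ.le_two u)
  · refine ⟨T, ⟨hT.subset, hT.partner_mem, hT.livesBelow, fun x y hxy hx hy => ?_⟩, σ,
      hext.subset hσ, hsim⟩
    rcases hD x y hxy with hxy | ⟨hl, rfl, rfl⟩
    · exact hT.mem x y hxy hx hy
    · by_contra hvw
      exact hnew ⟨⟨hl, hx, hy⟩, hvw⟩

theorem IsTable.exists_isSolution (h : IsTable G X S i B D rows)
    (hD : ∀ v w, G.Adj v w → D v w ∨ v ∈ X ∧ w ∈ X) (hτ : IsSolution G τ) :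
    ∃ σ ∈ rows, IsSolution G σ ∧ weight σ = weight τ := by
  obtain ⟨T, hT, σ, hσ, hsim⟩ := h.complete τ hτ
  have mem (v w : V) (hvw : G.Adj v w) (hv : τ v = 1) (hw : τ w = 2) : v ∈ T ∧ w ∈ T :=
    (hD v w hvw).elim (hT.mem v w · hv hw) (.imp (hT.subset v) (hT.subset w))
  have hTτ : T.indicator τ = τ := by
    refine Set.indicator_eq_self.2 fun v hv => ?_
    obtain ⟨w, hvw, hsum⟩ := (rivalDegree_eq_one.1 (hτ.isMatchedOn v trivial hv)).exists
    have hv2 := hτ.le_two v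
    have hw2 := hτ.le_two w
    obtain hv1 | hv2 : τ v = 1 ∨ τ v = 2 := by rw [Function.mem_support] at hv; omega
    · exact (mem v w hvw hv1 (by omega)).1
    · exact (mem w v hvw.symm (by omega) hv2).2
  rw [hTτ] at hsim
  refine ⟨σ, hσ, ⟨h.le_two σ hσ, fun v _ => ?_⟩, hsim.weight_eq⟩
  by_cases hv : v ∈ X
  · exact hsim.isMatchedOn (fun v _ => hτ.isMatchedOn v trivial) v hv
  · exact h.isMatchedOn σ hσ v hv

/-- The colourings in a table after the colours of the vertices in `Y` have been chosen. -/
structure ListsColourings (X Y : Finset V) (rows : Set (V → ℕ)) : Prop where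
  le_two : ∀ σ ∈ rows, ∀ v, σ v ≤ 2
  eq_zero : ∀ σ ∈ rows, ∀ v ∉ X, σ v = 0
  complete : ∀ σ : V → ℕ, (∀ v, σ v ≤ 2) → (∀ v ∉ Y, σ v = 0) → σ ∈ rows

theorem ListsColourings.of_extends [DecidableEq V] {Y : Finset V} {c : ℕ}
    (h : ListsColourings X Y rows) (hv : v ∈ X) (hc : c ≤ 2)
    (hext : Extends G X B (fun σ σ' => σ' = Function.update σ v c) rows rows') :
    ListsColourings X Y rows' := by
  have hrows' := hext.derivable (fun σ => (∀ u, σ u ≤ 2) ∧ ∀ u ∉ X, σ u = 0)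
    (fun σ hσ => ⟨h.le_two σ hσ, h.eq_zero σ hσ⟩) (by
      rintro σ _ ⟨hσ, hσX⟩ rfl
      refine ⟨fun u => ?_, fun u hu => ?_⟩
      · rw [Function.update_apply]
        split_ifs
        exacts [hc, hσ u]
      · rw [Function.update_of_ne (ne_of_mem_of_not_mem hv hu).symm, hσX u hu])
  exact ⟨fun σ hσ => (hrows' σ hσ).1, fun σ hσ => (hrows' σ hσ).2,
    fun σ hσ hσY => hext.subset (h.complete σ hσ hσY)⟩

theorem ListsColourings.mem_of_extends [DecidableEq V] {Y : Finset V} {c : ℕ}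
    (h : ListsColourings X Y rows) (h' : ListsColourings X Y rows') (hY : insert v Y ⊆ X)
    (hext : Extends G X B (fun σ σ' => σ' = Function.update σ v c) rows rows')
    (hσ : ∀ u, σ u ≤ 2) (hσY : ∀ u ∉ insert v Y, σ u = 0) (hv : σ v = c) : σ ∈ rows' := by
  have herased : Function.update σ v 0 ∈ rows := by
    refine h.complete _ (fun u => ?_) fun u hu => ?_ <;> rw [Function.update_apply] <;>
      split_ifs with huv
    exacts [zero_le, hσ u, rfl, hσY u (by simp [huv, hu])]
  obtain ⟨ρ, hρ, hsim⟩ := hext.complete _ herased σ (by simp [← hv])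
  suffices ρ = σ from this ▸ hρ
  ext u
  by_cases hu : u ∈ X
  · exact hsim.colour_eq u hu
  · rw [h'.eq_zero ρ hρ u hu, hσY u fun h => hu (hY h)]

theorem ListsColourings.insert [DecidableEq V] {Y : Finset V} {rows₁ rows₂ : Set (V → ℕ)}
    (h : ListsColourings X Y rows) (hY : insert v Y ⊆ X)
    (h₁ : Extends G X B (fun σ σ' => σ' = Function.update σ v 1) rows rows₁)
    (h₂ : Extends G X B (fun σ σ' => σ' = Function.update σ v 2) rows₁ rows₂) :
    ListsColourings X (insert v Y) rows₂ := by
  have hv : v ∈ X := hY (Finset.mem_insert_self v Y)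
  have hrows₁ := h.of_extends hv one_le_two h₁
  have hrows₂ := hrows₁.of_extends hv le_rfl h₂
  refine ⟨hrows₂.le_two, hrows₂.eq_zero, fun σ hσ hσY => ?_⟩
  obtain hv0 | hv1 | hv2 : σ v = 0 ∨ σ v = 1 ∨ σ v = 2 := by have := hσ v; omega
  · refine hrows₂.complete σ hσ fun u hu => ?_
    by_cases huv : u = v
    · rw [huv, hv0]
    · exact hσY u (by simp [huv, hu])
  · exact h₂.subset (h.mem_of_extends hrows₁ hY h₁ hσ hσY hv1)
  · exact hrows₁.mem_of_extends hrows₂ hY h₂ hσ hσY hv2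

theorem ListsColourings.isTable (h : ListsColourings X X rows) :
    IsTable G X S 0 B (fun _ _ => False) rows where
  le_two := h.le_two
  isMatchedOn σ hσ v hv hv0 := absurd (h.eq_zero σ hσ v hv) hv0
  livesBelow σ hσ v hv hv0 := absurd (h.eq_zero σ hσ v hv) hv0
  complete τ hτ := by
    have hzero (v : V) (hv : v ∉ X) : (X : Set V).indicator τ v = 0 :=
      Set.indicator_of_notMem (by simpa using hv) τ
    refine ⟨X, ⟨fun _ hx => hx, fun _ hv hvX => absurd hv hvX,
      fun v hv hv0 => absurd (hzero v hv) hv0, fun _ _ => False.elim⟩, _,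
      h.complete _ (fun u => ?_) hzero, .refl G X B _⟩
    exact (Set.indicator_le_self' (fun _ _ => zero_le) u).trans (hτ.le_two u)

end Table

end Colouring

section PerfectlyMatched

variable {V : Type*} {G : SimpleGraph V} {A B : Finset V}

open Classical in
/-- The colouring that describes the pair `(A, B)`. -/
noncomputable def colouringOf (A B : Finset V) (v : V) : ℕ :=
  if v ∈ A then 1 else if v ∈ B then 2 else 0

theorem colouringOf_eq_one {v : V} : colouringOf A B v = 1 ↔ v ∈ A := by
  grind [colouringOf]

theorem colouringOf_eq_two (h : Disjoint A B) {v : V} : colouringOf A B v = 2 ↔ v ∈ B := by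
  have hdisj : v ∈ A → v ∉ B := fun hv => Finset.disjoint_left.1 h hv
  grind [colouringOf]

variable [Fintype V]

theorem weight_colouringOf (A B : Finset V) : weight (colouringOf A B) = A.card := by
  classical
  simp [weight, colouringOf_eq_one]

theorem rivalDegree_eq_one_iff_existsUnique {σ : V → ℕ} {p q : ℕ} {v : V} (hpq : p + q = 3)
    (hB : ∀ w, σ w = q ↔ w ∈ B) : rivalDegree G σ p v = 1 ↔ ∃! w, w ∈ B ∧ G.Adj v w := by
  have hrival (w : V) : p + σ w = 3 ↔ w ∈ B := by rw [← hB]; omega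
  simp only [rivalDegree_eq_one, hrival, and_comm]

theorem PerfectlyMatched.isSolution_colouringOf (h : PerfectlyMatched G A B) :
    IsSolution G (colouringOf A B) := by
  obtain ⟨hdisj, hA, hB⟩ := h
  have hle (v : V) : colouringOf A B v ≤ 2 := by grind [colouringOf]
  refine ⟨hle, fun v _ hv0 => ?_⟩
  obtain hv | hv : colouringOf A B v = 1 ∨ colouringOf A B v = 2 := by have := hle v; omega
  · rw [hv, rivalDegree_eq_one_iff_existsUnique rfl fun w => colouringOf_eq_two hdisj]
    exact hA v (colouringOf_eq_one.1 hv)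
  · rw [hv, rivalDegree_eq_one_iff_existsUnique rfl fun w => colouringOf_eq_one]
    exact hB v ((colouringOf_eq_two hdisj).1 hv)

theorem IsSolution.perfectlyMatched {σ : V → ℕ} (h : IsSolution G σ) (hA : ∀ v, σ v = 1 ↔ v ∈ A)
    (hB : ∀ v, σ v = 2 ↔ v ∈ B) : PerfectlyMatched G A B := by
  refine ⟨Finset.disjoint_left.2 fun v hvA hvB => ?_, fun a ha => ?_, fun b hb => ?_⟩
  · have hv := (hA v).2 hvA
    rw [(hB v).2 hvB] at hv
    omega
  · have ha := (hA a).2 ha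
    exact (rivalDegree_eq_one_iff_existsUnique rfl hB).1 (ha ▸ h.isMatchedOn a trivial (by omega))
  · have hb := (hB b).2 hb
    exact (rivalDegree_eq_one_iff_existsUnique rfl hA).1 (hb ▸ h.isMatchedOn b trivial (by omega))

theorem isMaximumPerfectlyMatched_of_weight_le {σ : V → ℕ} (h : IsSolution G σ)
    (hmax : ∀ τ, IsSolution G τ → weight τ ≤ weight σ) (hA : ∀ v, σ v = 1 ↔ v ∈ A)
    (hB : ∀ v, σ v = 2 ↔ v ∈ B) : IsMaximumPerfectlyMatched G A B := by
  classical
  refine ⟨h.perfectlyMatched hA hB, fun A' B' h' => ?_⟩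
  have hweight : weight σ = A.card := by simp [weight, hA]
  have hle := hmax _ h'.isSolution_colouringOf
  rwa [weight_colouringOf, hweight] at hle

end PerfectlyMatched

/-! ### Cluster deletion sets -/

section Cluster

variable {V : Type*} {G : SimpleGraph V} {X D : Finset V} {u v w : V}

/-- The vertices `u`, `v`, `w` induce a path in this order. Cluster graphs are the graphs without
such paths. -/
structure IsInducedPath (G : SimpleGraph V) (u v w : V) : Prop where
  adj_left : G.Adj u v
  adj_right : G.Adj v w
  ne : u ≠ w
  not_adj : ¬ G.Adj u w

/-- Deleting `X` leaves no induced path on three vertices. -/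
def HitsInducedPaths (G : SimpleGraph V) (X : Finset V) : Prop :=
  ∀ u v w, IsInducedPath G u v w → u ∈ X ∨ v ∈ X ∨ w ∈ X

theorem IsClusterDeletionSet.hitsInducedPaths (hD : IsClusterDeletionSet G D) :
    HitsInducedPaths G D := by
  rintro u v w ⟨huv, hvw, hne, hnot⟩
  by_contra! hout
  obtain ⟨r, hr⟩ := hD
  have hruv := ((hr ⟨u, hout.1⟩ ⟨v, hout.2.1⟩).1 huv).2
  have hrvw := ((hr ⟨v, hout.2.1⟩ ⟨w, hout.2.2⟩).1 hvw).2
  exact hnot ((hr ⟨u, hout.1⟩ ⟨w, hout.2.2⟩).2 ⟨by simpa using hne, r.trans hruv hrvw⟩)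

theorem exists_isClusterDeletionSet_card_le [Finite V] {k : ℕ} (h : distanceToCluster G ≤ k) :
    ∃ D, IsClusterDeletionSet G D ∧ D.card ≤ k := by
  have := Fintype.ofFinite V
  have hne : {m | ∃ X : Finset V, IsClusterDeletionSet G X ∧ X.card = m}.Nonempty :=
    ⟨_, Finset.univ, ⟨⊤, fun u => absurd (Finset.mem_univ _) u.2⟩, rfl⟩
  obtain ⟨D, hD, hcard⟩ := Nat.sInf_mem hne
  exact ⟨D, hD, hcard.trans_le h⟩

/-- Every cluster deletion set contains at least a third of the vertices of `X`, as it does when `X`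
is a union of disjoint induced paths on three vertices. -/
def IsPathPacking [DecidableEq V] (G : SimpleGraph V) (X : Finset V) : Prop :=
  ∀ D, IsClusterDeletionSet G D → X.card ≤ 3 * (X ∩ D).card

theorem IsPathPacking.card_le [DecidableEq V] [Finite V] (hX : IsPathPacking G X) {k : ℕ}
    (hk : distanceToCluster G ≤ k) : X.card ≤ 3 * k := by
  obtain ⟨D, hD, hcard⟩ := exists_isClusterDeletionSet_card_le hk
  have hXD := hX D hD
  have hinter := Finset.card_le_card (Finset.inter_subset_right (s₁ := X) (s₂ := D))
  omega

theorem IsPathPacking.union_path [DecidableEq V] (hX : IsPathPacking G X)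
    (h : IsInducedPath G u v w) (hu : u ∉ X) (hv : v ∉ X) (hw : w ∉ X) :
    IsPathPacking G (X ∪ {u, v, w}) := by
  intro D hD
  obtain ⟨z, hz, hzX, hzD⟩ : ∃ z ∈ ({u, v, w} : Finset V), z ∉ X ∧ z ∈ D := by
    rcases hD.hitsInducedPaths u v w h with h | h | h
    exacts [⟨u, by simp, hu, h⟩, ⟨v, by simp, hv, h⟩, ⟨w, by simp, hw, h⟩]
  have hssub : X ∩ D ⊂ (X ∪ {u, v, w}) ∩ D := by
    refine Finset.ssubset_iff_of_subset
      (Finset.inter_subset_inter_right Finset.subset_union_left) |>.2 ⟨z, ?_, ?_⟩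
    · exact Finset.mem_inter.2 ⟨Finset.mem_union_right X hz, hzD⟩
    · exact fun hz => hzX (Finset.mem_inter.1 hz).1
  have hpath : ({u, v, w} : Finset V).card ≤ 3 := Finset.card_le_three
  have hunion := Finset.card_union_le X {u, v, w}
  have hXD := hX D hD
  have hlt := Finset.card_lt_card hssub
  omega

/-- The vertex `u` is in the closed neighbourhood of `v` in `G - X`, for `v` not in `X`. -/
def InClosedNeighborhood (G : SimpleGraph V) (X : Finset V) (u v : V) : Prop :=
  u ∉ X ∧ (u = v ∨ G.Adj u v)

theorem InClosedNeighborhood.symm (h : InClosedNeighborhood G X u v) (hv : v ∉ X) :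
    InClosedNeighborhood G X v u :=
  ⟨hv, h.2.imp Eq.symm fun h => h.symm⟩

theorem HitsInducedPaths.inClosedNeighborhood_trans (hX : HitsInducedPaths G X)
    (huv : InClosedNeighborhood G X u v) (hvw : InClosedNeighborhood G X v w) (hw : w ∉ X) :
    InClosedNeighborhood G X u w := by
  obtain ⟨hu, rfl | huv⟩ := huv
  · exact hvw
  obtain ⟨hv, rfl | hvw⟩ := hvw
  · exact ⟨hu, .inr huv⟩
  refine ⟨hu, ?_⟩
  by_contra! huw
  rcases hX u v w ⟨huv, hvw, huw.1, huw.2⟩ with h | h | h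
  exacts [hu h, hv h, hw h]

end Cluster

section Clique

variable {n : ℕ} {G : SimpleGraph (Fin n)} {X : Finset (Fin n)} {r r' : ℕ} {v : Fin n}

/-- The clique of the cluster graph `G - X` whose first vertex is `r`; it is empty if no clique
starts with `r`. -/
def cliqueAt (G : SimpleGraph (Fin n)) (X : Finset (Fin n)) (r : ℕ) : Set (Fin n) :=
  {v | v ∉ X ∧ IsLeast (Fin.val '' {u | InClosedNeighborhood G X u v}) r}

theorem HitsInducedPaths.isBlock_cliqueAt (hX : HitsInducedPaths G X) (r : ℕ) :
    IsBlock G X (cliqueAt G X r) where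
  notMem v hv := hv.1
  isClique := by
    rintro u ⟨hu, ⟨y, hyu, rfl⟩, -⟩ v ⟨hv, ⟨z, hzv, hzy⟩, -⟩ huv
    obtain rfl := Fin.ext hzy
    exact (hX.inClosedNeighborhood_trans (hyu.symm hu) hzv hv).2.resolve_left huv
  mem_of_adj u hu v hv huv := by
    have hadj : InClosedNeighborhood G X u v := ⟨hu.1, .inr huv⟩
    have hnbhd : {z | InClosedNeighborhood G X z u} = {z | InClosedNeighborhood G X z v} :=
      Set.ext fun z => ⟨fun hz => hX.inClosedNeighborhood_trans hz hadj hv,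
        fun hz => hX.inClosedNeighborhood_trans hz (hadj.symm hv) hu.1⟩
    exact ⟨hv, hnbhd ▸ hu.2⟩

theorem disjoint_cliqueAt (h : r ≠ r') : Disjoint (cliqueAt G X r) (cliqueAt G X r') :=
  Set.disjoint_left.2 fun _ hv hv' => h (hv.2.unique hv'.2)

theorem exists_mem_cliqueAt (hv : v ∉ X) : ∃ r < n, v ∈ cliqueAt G X r := by
  have hne : (Fin.val '' {u | InClosedNeighborhood G X u v}).Nonempty := ⟨v, v, ⟨hv, .inl rfl⟩, rfl⟩
  refine ⟨_, ?_, hv, Nat.sInf_mem hne, fun _ => Nat.sInf_le⟩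
  obtain ⟨u, -, hu⟩ := Nat.sInf_mem hne
  exact hu ▸ u.2

theorem HitsInducedPaths.exists_isLink (hX : HitsInducedPaths G X) {v w : Fin n}
    (hvw : G.Adj v w) (hnot : ¬(v ∈ X ∧ w ∈ X)) : ∃ r < n, IsLink G X (cliqueAt G X r) v w := by
  have link_of_notMem {v w : Fin n} (hvw : G.Adj v w) (hv : v ∉ X) :
      ∃ r < n, IsLink G X (cliqueAt G X r) v w := by
    obtain ⟨r, hr, hvr⟩ := exists_mem_cliqueAt (G := G) hv
    refine ⟨r, hr, hvw, .inl hvr, or_iff_not_imp_right.2 fun hw => ?_, .inl hvr⟩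
    exact (hX.isBlock_cliqueAt r).mem_of_adj v hvr w hw hvw
  by_cases hv : v ∈ X
  · obtain ⟨r, hr, h⟩ := link_of_notMem hvw.symm fun hw => hnot ⟨hv, hw⟩
    exact ⟨r, hr, h.symm⟩
  · exact link_of_notMem hvw hv

end Clique

/-! ### Arithmetic -/

theorem mul_add_eq_mul_add_iff {m a b c d : ℕ} (hb : b < m) (hd : d < m) :
    a * m + b = c * m + d ↔ a = c ∧ b = d := by
  refine ⟨fun h => ?_, by rintro ⟨rfl, rfl⟩; rfl⟩
  have hbd : b = d := by
    simpa [Nat.mul_add_mod', Nat.mod_eq_of_lt, hb, hd] using congrArg (· % m) h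
  exact ⟨Nat.eq_of_mul_eq_mul_right (by omega) (by omega : a * m = c * m), hbd⟩

theorem mul_add_lt_mul {m k a b : ℕ} (ha : a < k) (hb : b < m) : a * m + b < k * m :=
  calc a * m + b < a * m + m := by gcongr
    _ = (a + 1) * m := by ring
    _ ≤ k * m := by gcongr; exact ha

section Digits

variable {ι : Type*} [LinearOrder ι] {X : Finset ι} {b : ℕ} {d e : ι → ℕ}

/-- The number of elements of `X` before `x`. -/
def rank (X : Finset ι) (x : ι) : ℕ :=
  (X.filter (· < x)).card

/-- The number whose digits to the base `b` are the values of `d` on `X`. -/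
def ofDigitsOn (X : Finset ι) (b : ℕ) (d : ι → ℕ) : ℕ :=
  ∑ x ∈ X, d x * b ^ rank X x

theorem ofDigitsOn_insert {a : ι} (ha : ∀ x ∈ X, x < a) :
    ofDigitsOn (insert a X) b d = d a * b ^ X.card + ofDigitsOn X b d := by
  have haX : a ∉ X := fun h => (ha a h).false
  have rank_self : rank (insert a X) a = X.card := by
    rw [rank, Finset.filter_insert, if_neg (lt_irrefl a), Finset.filter_true_of_mem ha]
  have rank_old (x : ι) (hx : x ∈ X) : rank (insert a X) x = rank X x := by
    rw [rank, Finset.filter_insert, if_neg (ha x hx).not_gt, rank]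
  rw [ofDigitsOn, Finset.sum_insert haX, rank_self]
  exact congrArg _ (Finset.sum_congr rfl fun x hx => by rw [rank_old x hx])

theorem ofDigitsOn_lt (hd : ∀ x ∈ X, d x < b) : ofDigitsOn X b d < b ^ X.card := by
  induction X using Finset.induction_on_max with
  | empty => simp [ofDigitsOn]
  | insert a X ha ih =>
    have hlt := ih fun x hx => hd x (Finset.mem_insert_of_mem hx)
    rw [ofDigitsOn_insert ha, Finset.card_insert_of_notMem fun h => (ha a h).false, pow_succ']
    exact mul_add_lt_mul (hd a (Finset.mem_insert_self a X)) hlt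

theorem eqOn_of_ofDigitsOn_eq (hd : ∀ x ∈ X, d x < b) (he : ∀ x ∈ X, e x < b)
    (h : ofDigitsOn X b d = ofDigitsOn X b e) : ∀ x ∈ X, d x = e x := by
  induction X using Finset.induction_on_max with
  | empty => simp
  | insert a X ha ih =>
    rw [Finset.forall_mem_insert] at hd he ⊢
    rw [ofDigitsOn_insert ha, ofDigitsOn_insert ha] at h
    obtain ⟨hhigh, hlow⟩ :=
      (mul_add_eq_mul_add_iff (ofDigitsOn_lt hd.2) (ofDigitsOn_lt he.2)).1 h
    exact ⟨hhigh, ih hd.2 he.2 hlow⟩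

end Digits

theorem exists_polynomial_eval_le_mul_pow (p : Polynomial ℕ) :
    ∃ C d, ∀ x, 1 ≤ x → p.eval x ≤ C * x ^ d := by
  refine ⟨∑ i ∈ Finset.range (p.natDegree + 1), p.coeff i, p.natDegree, fun x hx => ?_⟩
  rw [Polynomial.eval_eq_sum_range, Finset.sum_mul]
  gcongr with i hi
  exact Finset.mem_range_succ_iff.1 hi

theorem pow_le_pow_self_mul_pow_self (b k : ℕ) : b ^ k ≤ b ^ b * k ^ k := by
  obtain hbk | hkb := le_or_gt b k
  · exact (Nat.pow_le_pow_left hbk k).trans (Nat.le_mul_of_pos_left _ Nat.pow_self_pos)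
  · exact (Nat.pow_le_pow_right (by omega) hkb.le).trans
      (Nat.le_mul_of_pos_right _ Nat.pow_self_pos)

/-! ### Keys -/

section Key

variable {n : ℕ} {G : SimpleGraph (Fin n)} {X : Finset (Fin n)} {S : Set (Fin n)} {r r' q : ℕ}
  {σ σ' : Fin n → ℕ} {x : Fin n}

/-- The part of the key of `σ` that describes the vertex `x` of `X`: its colour and the capped
number of its possible partners. -/
noncomputable def digit (G : SimpleGraph (Fin n)) (σ : Fin n → ℕ) (x : Fin n) : ℕ :=
  min (rivalDegree G σ (σ x) x) 2 * 3 + σ x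

open Classical in
/-- The part of the key of `σ` that describes the block `S`: whether the colour `q` occurs there. -/
noncomputable def occurrence (S : Set (Fin n)) (q : ℕ) (σ : Fin n → ℕ) : ℕ :=
  if ∃ v ∈ S, σ v = q then 1 else 0

/-- The slot of `σ` in the table while the clique number `r` is processed. Of several colourings
with the same key, the dynamic program keeps only one. -/
noncomputable def key (G : SimpleGraph (Fin n)) (X : Finset (Fin n)) (r : ℕ) (σ : Fin n → ℕ) : ℕ :=
  (((ofDigitsOn X 9 (digit G σ) * (n + 1) + r) * (n + 1) + weight σ) * 2 +
    occurrence (cliqueAt G X r) 2 σ) * 2 + occurrence (cliqueAt G X r) 1 σ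

/-- A bound for the keys of colourings, when `X` has `m` vertices. -/
def keyBound (n m : ℕ) : ℕ := 9 ^ m * (n + 1) * (n + 1) * 2 * 2

theorem digit_lt (h : σ x ≤ 2) : digit G σ x < 9 := by
  have hmin := min_le_right (rivalDegree G σ (σ x) x) 2
  unfold digit
  omega

theorem occurrence_lt : occurrence S q σ < 2 := by
  unfold occurrence
  split_ifs <;> omega

theorem occurrence_eq_iff :
    occurrence S q σ = occurrence S q σ' ↔ ((∃ v ∈ S, σ v = q) ↔ ∃ v ∈ S, σ' v = q) := by
  unfold occurrence
  split_ifs with h h' h' <;> simp [h, h']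

theorem weight_lt (σ : Fin n → ℕ) : weight σ < n + 1 :=
  Nat.lt_succ_of_le ((Finset.card_le_univ _).trans_eq (Fintype.card_fin n))

theorem key_lt (hr : r ≤ n) (hσ : ∀ v, σ v ≤ 2) : key G X r σ < keyBound n X.card :=
  mul_add_lt_mul (mul_add_lt_mul (mul_add_lt_mul (mul_add_lt_mul
    (ofDigitsOn_lt fun x _ => digit_lt (hσ x)) (Nat.lt_succ_of_le hr)) (weight_lt σ))
    occurrence_lt) occurrence_lt

theorem isSimilar_of_key_eq (hr : r ≤ n) (hr' : r' ≤ n) (hσ : ∀ v, σ v ≤ 2) (hσ' : ∀ v, σ' v ≤ 2)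
    (h : key G X r σ = key G X r' σ') : IsSimilar G X (cliqueAt G X r') σ σ' := by
  rw [key, key, mul_add_eq_mul_add_iff occurrence_lt occurrence_lt,
    mul_add_eq_mul_add_iff occurrence_lt occurrence_lt,
    mul_add_eq_mul_add_iff (weight_lt σ) (weight_lt σ'),
    mul_add_eq_mul_add_iff (Nat.lt_succ_of_le hr) (Nat.lt_succ_of_le hr')] at h
  obtain ⟨⟨⟨⟨hdigits, rfl⟩, hweight⟩, htwo⟩, hone⟩ := h
  have hdigit (x : Fin n) (hx : x ∈ X) := (mul_add_eq_mul_add_iff (Nat.lt_succ_of_le (hσ x))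
    (Nat.lt_succ_of_le (hσ' x))).1 (eqOn_of_ofDigitsOn_eq (fun x _ => digit_lt (hσ x))
      (fun x _ => digit_lt (hσ' x)) hdigits x hx)
  refine ⟨hweight, fun x hx => (hdigit x hx).2, fun x hx => (hdigit x hx).1, ?_⟩
  rintro q (rfl | rfl)
  exacts [occurrence_eq_iff.1 hone, occurrence_eq_iff.1 htwo]

theorem key_zero (G : SimpleGraph (Fin n)) (X : Finset (Fin n)) : key G X 0 0 = 0 := by
  simp [key, occurrence, weight, ofDigitsOn, digit, rivalDegree]

end Key

/-! ### Tests and keys -/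

namespace RAM

variable {n : ℕ} {G : SimpleGraph (Fin n)} {X : Finset (Fin n)} {s s' : State} {r : ℕ}
  {v w : Fin n} {p x y : ℕ}

/-- The first `n` cells of array `a`, as a function on the vertices. -/
def State.col (s : State) (a : ℕ) : Fin n → ℕ := fun v => s.arr a v

open Classical in
/-- Register `0` holds the number of vertices, and array `0` the adjacency matrix of `G`. -/
structure HoldsGraph (G : SimpleGraph (Fin n)) (s : State) : Prop where
  reg_zero : s.reg 0 = n
  adj : ∀ u v : Fin n, s.arr 0 (u * n + v) = if G.Adj u v then 1 else 0

/-- Besides the graph, the state holds the indicator vector of `X` in array `3`. -/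
structure HoldsMarks (G : SimpleGraph (Fin n)) (X : Finset (Fin n)) (s : State) : Prop
    extends HoldsGraph G s where
  mark : ∀ v : Fin n, s.arr 3 v = if v ∈ X then 1 else 0

theorem HoldsGraph.congr (h : HoldsGraph G s) (hreg : s'.reg 0 = s.reg 0)
    (harr : s'.arr 0 = s.arr 0) : HoldsGraph G s' :=
  ⟨hreg.trans h.reg_zero, harr ▸ h.adj⟩

theorem HoldsMarks.congr (h : HoldsMarks G X s) (hreg : s'.reg 0 = s.reg 0)
    (harr : s'.arr 0 = s.arr 0) (harr' : s'.arr 3 = s.arr 3) : HoldsMarks G X s' :=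
  ⟨h.toHoldsGraph.congr hreg harr, harr' ▸ h.mark⟩

theorem HoldsMarks.setReg (h : HoldsMarks G X s) (hx : x ≠ 0) (i : ℕ) :
    HoldsMarks G X (s.setReg x i) :=
  h.congr (by simp [hx.symm]) rfl rfl

namespace Expr

variable {e f : Expr}

/-- Expressions serve as truth values, where every positive number is true. -/
def Holds (e : Expr) (s : State) : Prop := 0 < e.eval s

def not (e : Expr) : Expr := .eq e (.lit 0)

def and (e f : Expr) : Expr := .mul e f

def or (e f : Expr) : Expr := .add e f

/-- The number of values below register `0` of register `x` for which `e` is true. -/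
def count (x : ℕ) (e : Expr) : Expr := .sum x (.var 0) (.lt (.lit 0) e)

/-- Whether `e` is true for some value below register `0` of register `x`. -/
def any (x : ℕ) (e : Expr) : Expr := .lt (.lit 0) (.count x e)

theorem holds_not : (not e).Holds s ↔ ¬ e.Holds s := by
  simp only [Holds, not, eval, not_lt, Nat.le_zero]
  split_ifs with h <;> simp [h]

theorem holds_and : (and e f).Holds s ↔ e.Holds s ∧ f.Holds s :=
  CanonicallyOrderedAdd.mul_pos

theorem holds_or : (or e f).Holds s ↔ e.Holds s ∨ f.Holds s :=
  add_pos_iff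

theorem holds_eq : (Expr.eq e f).Holds s ↔ e.eval s = f.eval s := by
  simp only [Holds, eval]
  split <;> simp_all

theorem holds_lt : (Expr.lt e f).Holds s ↔ e.eval s < f.eval s := by
  simp only [Holds, eval]
  split <;> simp_all

theorem eval_sum_vertices (hn : s.reg 0 = n) :
    (Expr.sum x (.var 0) e).eval s = ∑ v : Fin n, e.eval (s.setReg x v) := by
  simp only [eval, hn, Finset.sum_range]

theorem eval_count (hn : s.reg 0 = n) {P : Fin n → Prop} [DecidablePred P]
    (hP : ∀ v : Fin n, e.Holds (s.setReg x v) ↔ P v) :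
    (count x e).eval s = (Finset.univ.filter P).card := by
  rw [count, eval_sum_vertices hn, Finset.card_filter]
  exact Finset.sum_congr rfl fun v _ => if_congr (hP v) rfl rfl

theorem holds_any (hn : s.reg 0 = n) {P : Fin n → Prop}
    (hP : ∀ v : Fin n, e.Holds (s.setReg x v) ↔ P v) : (any x e).Holds s ↔ ∃ v, P v := by
  classical
  simp [any, holds_lt, eval_count hn hP, eval, Finset.card_pos, Finset.filter_nonempty_iff]

open Classical in
theorem eval_any : (any x e).eval s = if (any x e).Holds s then 1 else 0 :=
  if_congr holds_lt.symm rfl rfl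

/-- The entry of the adjacency matrix for the vertices in registers `x` and `y`. -/
def adj (x y : ℕ) : Expr := .get 0 (.add (.mul (.var x) (.var 0)) (.var y))

/-- Whether the vertex in register `x` is marked. -/
def marked (x : ℕ) : Expr := .get 3 (.var x)

/-- The colour of the vertex in register `x` in the buffer, which is array `9`. -/
def colour (x : ℕ) : Expr := .get 9 (.var x)

/-- Membership of the vertex in register `x` in the clique that is numbered by register `2`. -/
def inClique (x : ℕ) : Expr :=
  let closed : Expr := and (not (marked 9)) (or (eq (var 9) (var x)) (adj 9 x))
  and (not (marked x)) (and (any 9 (and (eq (var 9) (var 2)) closed))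
    (not (any 9 (and (lt (var 9) (var 2)) closed))))

/-- The number of neighbours of the vertex in register `x` whose colour in the buffer is
complementary to `e`. -/
def rivals (e : Expr) (x : ℕ) : Expr :=
  count 8 (and (adj x 8) (eq (add e (colour 8)) (lit 3)))

/-- The minimum of `e` and `2`. -/
def cap (e : Expr) : Expr := .add (.lt (.lit 0) e) (.lt (.lit 1) e)

theorem holds_adj (h : HoldsGraph G s) (hx : s.reg x = v) (hy : s.reg y = w) :
    (adj x y).Holds s ↔ G.Adj v w := by
  simp [Holds, adj, eval, hx, hy, h.reg_zero, h.adj, pos_iff_ne_zero]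

theorem eval_marked (h : HoldsMarks G X s) (hx : s.reg x = v) :
    (marked x).eval s = if v ∈ X then 1 else 0 := by
  simp only [marked, eval, hx, h.mark]

theorem holds_marked (h : HoldsMarks G X s) (hx : s.reg x = v) : (marked x).Holds s ↔ v ∈ X := by
  simp [Holds, eval_marked h hx, pos_iff_ne_zero]

theorem holds_inClique (h : HoldsMarks G X s) (hr : s.reg 2 = r) (hx : s.reg x = v) (hx9 : x ≠ 9) :
    (inClique x).Holds s ↔ v ∈ cliqueAt G X r := by
  have holds_closed (u : Fin n) : (and (not (marked 9)) (or (eq (var 9) (var x)) (adj 9 x))).Holds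
      (s.setReg 9 u) ↔ InClosedNeighborhood G X u v := by
    have hu := h.setReg (x := 9) (by decide) u
    rw [holds_and, holds_not, holds_or, holds_eq, holds_marked hu (v := u) (by simp),
      holds_adj hu.toHoldsGraph (v := u) (w := v) (by simp) (by simp [hx9, hx])]
    simp [eval, hx9, hx, InClosedNeighborhood, Fin.ext_iff]
  rw [inClique, holds_and, holds_and, holds_not, holds_not, holds_marked h hx,
    holds_any h.reg_zero (P := fun u => u.val = r ∧ InClosedNeighborhood G X u v),
    holds_any h.reg_zero (P := fun u => u.val < r ∧ InClosedNeighborhood G X u v)]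
  · simp only [cliqueAt, IsLeast, lowerBounds, Set.mem_ofPred_eq, Set.mem_image, not_exists,
      not_and, forall_exists_index, and_imp, and_comm, ← not_lt]
    grind
  all_goals
    intro u
    rw [holds_and, holds_closed]
    simp [holds_eq, holds_lt, eval, hr]

open Classical in
theorem eval_rivals (h : HoldsGraph G s) (he : ∀ i, e.eval (s.setReg 8 i) = p) (hx : s.reg x = v)
    (hx8 : x ≠ 8) : (rivals e x).eval s = rivalDegree G (s.col 9) p v := by
  refine eval_count h.reg_zero (P := fun w => G.Adj v w ∧ p + s.col 9 w = 3) fun w => ?_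
  have hw : HoldsGraph G (s.setReg 8 w) := h.congr (by simp) rfl
  rw [holds_and, holds_adj hw (v := v) (w := w) (by simp [hx8, hx]) (by simp), holds_eq]
  simp [eval, he, colour, State.col]

theorem eval_cap : (cap e).eval s = min (e.eval s) 2 := by
  simp only [cap, eval]
  rcases e.eval s with _ | _ | i <;> simp

/-- The part of the key of the colouring in the buffer that describes the vertex in register `x`. -/
def digit (x : ℕ) : Expr := .add (.mul (cap (rivals (colour x) x)) (.lit 3)) (colour x)

/-- Whether the colour `q` occurs in the clique that is numbered by register `2`. -/
def occurrence (q : ℕ) : Expr := any 7 (and (inClique 7) (eq (colour 7) (lit q)))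

/-- The number of vertices that have the colour `1` in array `a`. -/
def weight (a : ℕ) : Expr := count 7 (eq (get a (var 7)) (lit 1))

def succOrder : Expr := add (var 0) (lit 1)

/-- The key of the colouring in the buffer, for the clique that is numbered by register `2`. -/
def key : Expr :=
  let digits : Expr := sum 7 (var 0) (mul (marked 7) (mul (digit 7) (get 4 (var 7))))
  add (mul (add (mul (add (mul (add (mul digits succOrder) (var 2)) succOrder) (weight 9)) (lit 2))
    (occurrence 2)) (lit 2)) (occurrence 1)

theorem eval_digit (h : HoldsGraph G s) (hx : s.reg x = v) (hx8 : x ≠ 8) :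
    (digit x).eval s = _root_.digit G (s.col 9) v := by
  have hcolour (i : ℕ) : (colour x).eval (s.setReg 8 i) = s.col 9 v := by
    simp [colour, eval, hx8, hx, State.col]
  have hcolour' : (colour x).eval s = s.col 9 v := by simp [colour, eval, hx, State.col]
  simp only [digit, eval, eval_cap, eval_rivals h hcolour hx hx8, hcolour', _root_.digit]

open Classical in
theorem eval_occurrence (h : HoldsMarks G X s) (hr : s.reg 2 = r) (q : ℕ) :
    (occurrence q).eval s = _root_.occurrence (cliqueAt G X r) q (s.col 9) := by
  refine eval_any.trans (if_congr (holds_any h.reg_zero fun v => ?_) rfl rfl)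
  rw [holds_and, holds_inClique (h.setReg (by decide) v) (r := r) (v := v) (by simp [hr]) (by simp)
    (by decide), holds_eq]
  simp [colour, eval, State.col]

theorem eval_weight (hn : s.reg 0 = n) (a : ℕ) :
    (weight a).eval s = _root_.weight (s.col a : Fin n → ℕ) :=
  eval_count hn fun v => by simp [holds_eq, eval, State.col]

end Expr

/-- Besides the graph and the marks, the state holds the place values of keys in array `4`, and the
bound for keys in register `1`. -/
structure IsPrepared (G : SimpleGraph (Fin n)) (X : Finset (Fin n)) (s : State) : Prop
    extends HoldsMarks G X s where
  place : ∀ x ∈ X, s.arr 4 x = 9 ^ rank X x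
  reg_one : s.reg 1 = keyBound n X.card

namespace IsPrepared

theorem congr (h : IsPrepared G X s) (hreg : ∀ x < 2, s'.reg x = s.reg x)
    (harr : ∀ a ∈ [0, 3, 4], s'.arr a = s.arr a) : IsPrepared G X s' :=
  ⟨h.toHoldsMarks.congr (hreg 0 (by decide)) (harr 0 (by simp)) (harr 3 (by simp)),
    harr 4 (by simp) ▸ h.place, (hreg 1 (by decide)).trans h.reg_one⟩

theorem setReg (h : IsPrepared G X s) (hx : 2 ≤ x) (i : ℕ) : IsPrepared G X (s.setReg x i) :=
  h.congr (fun y hy => by simp [show y ≠ x by omega]) fun _ _ => rfl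

theorem eval (h : IsPrepared G X s) (p : Stmt) (hreg : ∀ x < 2, x ∉ p.regs)
    (harr : ∀ a ∈ [0, 3, 4], a ∉ p.arrs) : IsPrepared G X (p.eval s) :=
  h.congr (fun x hx => Stmt.eval_reg (hreg x hx)) fun a ha => Stmt.eval_arr (harr a ha)

theorem eval_key (h : IsPrepared G X s) (hr : s.reg 2 = r) :
    Expr.key.eval s = key G X r (s.col 9) := by
  have hdigits : (Expr.sum 7 (.var 0)
      (.mul (.marked 7) (.mul (.digit 7) (.get 4 (.var 7))))).eval s =
        ofDigitsOn X 9 (digit G (s.col 9)) := by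
    rw [Expr.eval_sum_vertices h.reg_zero, ofDigitsOn, ← Finset.univ_inter X,
      ← Finset.sum_ite_mem]
    refine Finset.sum_congr rfl fun v _ => ?_
    have hv := h.setReg (x := 7) (by decide) v
    rw [Expr.eval, Expr.eval, Expr.eval_marked hv.toHoldsMarks (x := 7) (v := v) (by simp),
      Expr.eval_digit hv.toHoldsGraph (x := 7) (v := v) (by simp) (by decide)]
    split_ifs with hvX
    · simp [Expr.eval, h.place v hvX]
      rfl
    · simp
  have hone := Expr.eval_occurrence h.toHoldsMarks hr 1
  have htwo := Expr.eval_occurrence h.toHoldsMarks hr 2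
  simp only [Expr.key, Expr.succOrder, Expr.eval] at hdigits hone htwo ⊢
  rw [hdigits, hone, htwo, Expr.eval_weight h.reg_zero, h.reg_zero, hr, key]

end IsPrepared

end RAM

/-! ### Marking vertices and preparing the keys -/

namespace RAM

variable {n : ℕ} {G : SimpleGraph (Fin n)} {X : Finset (Fin n)} {s : State} {p : Stmt}
  {x y : ℕ} {u v w : Fin n}

namespace Stmt

theorem for_vertices_induct (I : Set (Fin n) → State → Prop) (hn : s.reg 0 = n) (h0 : I ∅ s)
    (hp : ∀ U v t, v ∉ U → I U t → I (insert v U) (p.eval (t.setReg x v))) :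
    I Set.univ ((for_ x (.var 0) p).eval s) := by
  have h := for_induct (x := x) (e := .var 0) (p := p) (s := s) (fun i => I {v : Fin n | v.val < i})
    (by simpa using h0) fun i hi t ht => ?_
  · simpa [Expr.eval, hn] using h
  · have hin : i < n := hn ▸ hi
    convert hp _ ⟨i, hin⟩ t (by simp) ht using 1
    ext v
    simp [Fin.ext_iff, le_iff_eq_or_lt]

theorem for_pairs_induct (I : Set (Fin n × Fin n) → State → Prop) (h0 : I ∅ s) (hx : x ∉ p.regs)
    (hxy : x ≠ y) (hreg : ∀ E t, I E t → t.reg 0 = n) (hI : ∀ E t i, I E t → I E (t.setReg x i))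
    (hp : ∀ E (v w : Fin n) t, I E t → t.reg x = v → I (insert (v, w) E) (p.eval (t.setReg y w))) :
    I Set.univ ((for_ x (.var 0) (for_ y (.var 0) p)).eval s) := by
  have h := for_vertices_induct (x := x) (p := for_ y (.var 0) p) (s := s)
    (fun U => I (U ×ˢ Set.univ)) (hreg _ _ h0) (by simpa using h0) fun U v t _ ht => ?_
  · simpa using h
  have hinner := for_vertices_induct (x := y) (p := p) (s := t.setReg x v)
    (fun W t' => I (U ×ˢ Set.univ ∪ {v} ×ˢ W) t' ∧ t'.reg x = v) (hreg _ _ (hI _ _ v ht))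
    ⟨by simpa using hI _ _ v ht, by simp⟩ fun W w t' _ ht' => ⟨?_, ?_⟩
  · rw [← Set.singleton_union, Set.union_prod, Set.union_comm]
    exact hinner.1
  · convert hp _ v w t' ht'.1 ht'.2 using 1
    ext ⟨a, b⟩
    simp only [Set.mem_union, Set.mem_prod, Set.mem_insert_iff, Set.mem_singleton_iff,
      Prod.mk.injEq]
    tauto
  · rw [eval_reg hx, State.setReg_reg, if_neg hxy, ht'.2]

theorem eval_fill {a : ℕ} {e f : Expr} {i g : Fin n → ℕ} (hn : s.reg 0 = n)
    (hi : Function.Injective i)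
    (hef : ∀ t : State, (∀ y ≠ x, t.reg y = s.reg y) → (∀ b ≠ a, t.arr b = s.arr b) →
      ∀ v : Fin n, t.reg x = v → e.eval t = i v ∧ f.eval t = g v) :
    (∀ v, ((for_ x (.var 0) (store a e f)).eval s).arr a (i v) = g v) ∧
      ∀ j ∉ Set.range i, ((for_ x (.var 0) (store a e f)).eval s).arr a j = s.arr a j := by
  have h := for_vertices_induct (x := x) (p := store a e f) (fun U t =>
    (∀ y ≠ x, t.reg y = s.reg y) ∧ (∀ b ≠ a, t.arr b = s.arr b) ∧ (∀ v ∈ U, t.arr a (i v) = g v) ∧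
      ∀ j ∉ Set.range i, t.arr a j = s.arr a j) hn (by simp) ?_
  · exact ⟨fun v => h.2.2.1 v trivial, h.2.2.2⟩
  rintro U v t hv ⟨hreg, harr, hU, hrange⟩
  obtain ⟨he, hf⟩ := hef (t.setReg x v) (fun y hy => by simp [hy, hreg y hy]) harr v (by simp)
  refine ⟨fun y hy => by simp [eval, hy, hreg y hy, State.setArr],
    fun b hb => by simp [eval, State.setArr_arr, hb, harr b hb], ?_, fun j hj => ?_⟩
  · rintro w (rfl | hw)
    · simp [eval, State.setArr_arr, he, hf]
    · simp [eval, State.setArr_arr, he, hi.ne (ne_of_mem_of_not_mem hw hv), hU w hw]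
  · simp [eval, State.setArr_arr, he, show j ≠ i v from fun h => hj ⟨v, h.symm⟩, hrange j hj]

end Stmt

/-- Whether the vertices in registers `2`, `3`, `4` are unmarked and form an induced path. -/
def pathTest : Expr :=
  .and (.and (.adj 2 3) (.adj 3 4)) (.and (.not (.or (.eq (.var 2) (.var 4)) (.adj 2 4)))
    (.not (.or (.marked 2) (.or (.marked 3) (.marked 4)))))

/-- Mark the vertices in registers `2`, `3`, `4` if they form an unmarked induced path. -/
def markPath : Stmt :=
  .cond pathTest (.seq (.store 3 (.var 2) (.lit 1)) (.seq (.store 3 (.var 3) (.lit 1))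
    (.store 3 (.var 4) (.lit 1)))) .skip

/-- Mark the vertices of induced paths until all induced paths are hit. -/
def markPaths : Stmt := .for_ 2 (.var 0) (.for_ 3 (.var 0) (.for_ 4 (.var 0) markPath))

theorem HoldsMarks.store (h : HoldsMarks G X s) (hx : s.reg x = v) :
    HoldsMarks G (insert v X) ((Stmt.store 3 (.var x) (.lit 1)).eval s) where
  reg_zero := h.reg_zero
  adj := by simpa [Stmt.eval, State.setArr_arr] using h.adj
  mark w := by
    by_cases hwv : w = v <;>
      simp [Stmt.eval, Expr.eval, State.setArr_arr, hx, hwv, Fin.val_inj, h.mark]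

theorem holds_pathTest (h : HoldsMarks G X s) (hu : s.reg 2 = u) (hv : s.reg 3 = v)
    (hw : s.reg 4 = w) :
    pathTest.Holds s ↔ IsInducedPath G u v w ∧ u ∉ X ∧ v ∉ X ∧ w ∉ X := by
  simp only [pathTest, Expr.holds_and, Expr.holds_not, Expr.holds_or, Expr.holds_eq, Expr.eval,
    Expr.holds_adj h.toHoldsGraph hu hv, Expr.holds_adj h.toHoldsGraph hv hw,
    Expr.holds_adj h.toHoldsGraph hu hw, Expr.holds_marked h hu, Expr.holds_marked h hv,
    Expr.holds_marked h hw, hu, hw, Fin.val_inj]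
  exact ⟨fun ⟨⟨huv, hvw⟩, hnot, hX⟩ => ⟨⟨huv, hvw, by tauto, by tauto⟩, by tauto⟩,
    fun ⟨⟨huv, hvw, hne, hnot⟩, hX⟩ => by tauto⟩

/-- The marked vertices consist of disjoint induced paths, and hit the paths in `E`. -/
def MarksPaths (G : SimpleGraph (Fin n)) (E : Set (Fin n × Fin n × Fin n)) (s : State) : Prop :=
  ∃ X, HoldsMarks G X s ∧ IsPathPacking G X ∧
    ∀ u v w, (u, v, w) ∈ E → IsInducedPath G u v w → u ∈ X ∨ v ∈ X ∨ w ∈ X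

theorem MarksPaths.setReg {E : Set (Fin n × Fin n × Fin n)} (h : MarksPaths G E s) (hx : x ≠ 0)
    (i : ℕ) : MarksPaths G E (s.setReg x i) :=
  h.imp fun _ h => ⟨h.1.setReg hx i, h.2⟩

theorem MarksPaths.markPath {E : Set (Fin n × Fin n × Fin n)} (h : MarksPaths G E s)
    (hu : s.reg 2 = u) (hv : s.reg 3 = v) (hw : s.reg 4 = w) :
    MarksPaths G (insert (u, v, w) E) (markPath.eval s) := by
  obtain ⟨X, hX, hpacking, hE⟩ := h
  have htest := holds_pathTest hX hu hv hw
  rw [Expr.Holds] at htest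
  rw [RAM.markPath, Stmt.eval]
  split_ifs with h
  · obtain ⟨hpath, huX, hvX, hwX⟩ := htest.1 h
    refine ⟨insert w (insert v (insert u X)), ((hX.store hu).store hv).store hw, ?_, ?_⟩
    · convert hpacking.union_path hpath huX hvX hwX using 1
      ext a
      simp only [Finset.mem_insert, Finset.mem_union, Finset.mem_singleton]
      tauto
    · rintro u' v' w' (h | hE') hpath'
      · cases h
        simp
      · have := hE u' v' w' hE' hpath'
        simp only [Finset.mem_insert]
        tauto
  · refine ⟨X, hX, hpacking, ?_⟩
    rintro u' v' w' (h' | hE') hpath'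
    · cases h'
      by_contra! hnot
      exact h (htest.2 ⟨hpath', hnot⟩)
    · exact hE u' v' w' hE' hpath'

theorem HoldsMarks.eval_markPaths (h : HoldsMarks G ∅ s) :
    ∃ X, HoldsMarks G X (markPaths.eval s) ∧ IsPathPacking G X ∧ HitsInducedPaths G X := by
  have hall := Stmt.for_vertices_induct (x := 2) (p := .for_ 3 (.var 0) (.for_ 4 (.var 0) markPath))
    (fun U => MarksPaths G (U ×ˢ Set.univ)) h.reg_zero
    ⟨∅, h, fun D _ => by simp, by simp⟩ fun U u t _ ht => ?_
  · obtain ⟨X, hX, hpacking, hhits⟩ := hall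
    exact ⟨X, hX, hpacking, fun u v w => hhits u v w (by simp)⟩
  have hinner := Stmt.for_pairs_induct (x := 3) (y := 4) (p := markPath) (s := t.setReg 2 u)
    (fun E t => MarksPaths G (U ×ˢ Set.univ ∪ {u} ×ˢ E) t ∧ t.reg 2 = u)
    ⟨by simpa using ht.setReg (by decide) u, by simp⟩ (by decide) (by decide)
    (fun _ _ h => h.1.choose_spec.1.reg_zero)
    (fun E t i h => ⟨h.1.setReg (by decide) i, by simpa using h.2⟩) fun E v w t ht hv => ⟨?_, ?_⟩
  · rw [← Set.singleton_union, Set.union_prod, Set.union_comm]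
    exact hinner.1
  · convert (ht.1.setReg (x := 4) (by decide) w).markPath (u := u) (v := v) (w := w)
      (by simp [ht.2]) (by simp [hv]) (by simp) using 1
    ext ⟨a, b, c⟩
    simp only [Set.mem_union, Set.mem_prod, Set.mem_insert_iff, Set.mem_singleton_iff,
      Prod.mk.injEq]
    tauto
  · rw [Stmt.eval_reg (by decide), State.setReg_reg, if_neg (by decide), ht.2]

/-- Write the place value of the vertex in register `2`, which is in register `1`, to array `4` if
the vertex is marked. -/
def placeVertex : Stmt :=
  .cond (.marked 2) (.seq (.store 4 (.var 2) (.var 1)) (.assign 1 (.mul (.lit 9) (.var 1)))) .skip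

/-- Compute the place values and the bound for keys. -/
def prepare : Stmt :=
  .seq (.assign 1 (.lit 1)) (.seq (.for_ 2 (.var 0) placeVertex) (.assign 1
    (.mul (.mul (.mul (.mul (.var 1) .succOrder) .succOrder) (.lit 2)) (.lit 2))))

/-- The place values of the vertices below `i` are in array `4`, and the next one is in
register `1`. -/
structure HoldsPlaces (G : SimpleGraph (Fin n)) (X : Finset (Fin n)) (i : ℕ) (s : State) : Prop
    extends HoldsMarks G X s where
  place : ∀ x ∈ X, x < i → s.arr 4 x = 9 ^ rank X x
  reg_one : s.reg 1 = 9 ^ (X.filter fun y => y.val < i).card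

theorem HoldsPlaces.succ (h : HoldsPlaces G X v s) (hv : s.reg 2 = v) :
    HoldsPlaces G X (v + 1) (placeVertex.eval s) := by
  have hfilter : X.filter (fun y => y.val < v.val + 1) = if v ∈ X
      then insert v (X.filter fun y => y.val < v.val) else X.filter fun y => y.val < v.val := by
    ext y
    split_ifs with hvX <;> simp only [Finset.mem_filter, Finset.mem_insert] <;> grind
  have hmark := Expr.eval_marked h.toHoldsMarks hv
  rw [placeVertex, Stmt.eval, hmark]
  by_cases hvX : v ∈ X
  · rw [if_pos (by simp [hvX])]
    refine ⟨⟨⟨h.reg_zero, h.adj⟩, h.mark⟩, fun x hx hxv => ?_, ?_⟩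
    · obtain rfl | hne := eq_or_ne x v
      · simp [Stmt.eval, Expr.eval, State.setArr_arr, hv, h.reg_one, rank]
      · have hlt : x.val < v := by grind
        simpa [Stmt.eval, Expr.eval, State.setArr_arr, hv, Fin.val_inj, hne] using h.place x hx hlt
    · rw [hfilter, if_pos hvX, Finset.card_insert_of_notMem (by simp)]
      simp [Stmt.eval, Expr.eval, h.reg_one, pow_succ']
  · rw [if_neg (by simp [hvX])]
    refine ⟨h.toHoldsMarks, fun x hx hxv => h.place x hx ?_, ?_⟩
    · have hne := ne_of_mem_of_not_mem hx hvX
      grind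
    · rw [hfilter, if_neg hvX, Stmt.eval, h.reg_one]

theorem HoldsPlaces.safe_placeVertex {m M : ℕ} (h : HoldsPlaces G X v s) (hv : s.reg 2 = v)
    (hs : Bounded m M s) (hm : 1 < m) (hM : 9 ^ X.card ≤ M) :
    placeVertex.Safe m M s ∧ Bounded m M (placeVertex.eval s) := by
  have hstore : Bounded m M ((Stmt.store 4 (.var 2) (.var 1)).eval s) := hs.setArr _ _ (hs.1 1 hm)
  have hone : (placeVertex.eval s).reg 1 ≤ M := by
    rw [(h.succ hv).reg_one]
    exact (Nat.pow_le_pow_right (by decide) (Finset.card_filter_le _ _)).trans hM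
  refine ⟨⟨hs, fun _ => ⟨hs, hstore⟩, fun _ => trivial⟩, ?_⟩
  rw [placeVertex, Stmt.eval] at hone ⊢
  split_ifs at hone ⊢
  exacts [hstore.setReg 1 (by simpa [Stmt.eval, Expr.eval] using hone), hs]

theorem HoldsMarks.isPrepared_eval {m M : ℕ} (h : HoldsMarks G X s) (hs : Bounded m M s)
    (hm : 2 < m) (hn : n ≤ M) (hM : keyBound n X.card ≤ M) :
    prepare.Safe m M s ∧ Bounded m M (prepare.eval s) ∧ IsPrepared G X (prepare.eval s) := by
  have hpow : 9 ^ X.card ≤ M := by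
    refine le_trans ?_ hM
    simp only [keyBound, mul_assoc]
    exact Nat.le_mul_of_pos_right _ (by positivity)
  have hone : Bounded m M (s.setReg 1 1) :=
    hs.setReg 1 ((Nat.one_le_pow _ _ (by decide)).trans hpow)
  have hbody (i : ℕ) (hi : i < n) (t : State) (ht : HoldsPlaces G X i t ∧ Bounded m M t) :
      HoldsPlaces G X (i + 1) (placeVertex.eval (t.setReg 2 i)) ∧
        placeVertex.Safe m M (t.setReg 2 i) ∧ Bounded m M (placeVertex.eval (t.setReg 2 i)) := by
    have ht' : HoldsPlaces G X i (t.setReg 2 i) :=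
      ⟨ht.1.toHoldsMarks.setReg (by decide) i, ht.1.place, by simpa using ht.1.reg_one⟩
    exact ⟨ht'.succ (v := ⟨i, hi⟩) (by simp), ht'.safe_placeVertex (v := ⟨i, hi⟩) (by simp)
      (ht.2.setReg 2 (hi.le.trans hn)) (by omega) hpow⟩
  have hloop := Stmt.iter_induct (x := 2) (n := n) (f := placeVertex.eval)
    (fun i t => HoldsPlaces G X i t ∧ Bounded m M t)
    ⟨⟨h.setReg (by decide) 1, by simp, by simp⟩, hone⟩
    fun i hi t ht => ⟨(hbody i hi t ht).1, (hbody i hi t ht).2.2⟩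
  obtain ⟨hplaces, hb⟩ := hloop n le_rfl
  have hall : X.filter (fun y => y.val < n) = X := Finset.filter_true_of_mem fun y _ => y.isLt
  have heval : prepare.eval s = (Stmt.iter 2 placeVertex.eval (s.setReg 1 1) n).setReg 1
      (keyBound n X.card) := by
    simp only [prepare, Stmt.eval, Expr.eval, Expr.succOrder, State.setReg_reg, h.reg_zero,
      hplaces.reg_one, hplaces.reg_zero, hall, keyBound, if_false, zero_ne_one]
  refine ⟨⟨hs, ⟨hone, fun i hi => ?_⟩, ?_⟩, heval ▸ hb.setReg 1 hM, heval ▸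
    ⟨hplaces.toHoldsMarks.setReg one_ne_zero _, fun x hx => hplaces.place x hx x.isLt, by simp⟩⟩
  · have hin : i < n := by simpa [Expr.eval, Stmt.eval, h.reg_zero] using hi
    exact (hbody i hin _ (hloop i hin.le)).2.1
  · simpa [Stmt.Safe, Stmt.eval, Expr.eval, h.reg_zero] using hb

end RAM

/-! ### The table of colourings -/

namespace RAM

variable {n : ℕ} {G : SimpleGraph (Fin n)} {X : Finset (Fin n)} {s s' : State} {r q c m : ℕ}
  {v w : Fin n} {σ ρ : Fin n → ℕ} {R : (Fin n → ℕ) → (Fin n → ℕ) → Prop} {test : Expr}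
  {p paint : Stmt}

/-- The states agree on the registers and arrays below `m`. -/
structure AgreeBelow (m : ℕ) (s s' : State) : Prop where
  reg : ∀ x < m, s'.reg x = s.reg x
  arr : ∀ a < m, s'.arr a = s.arr a

theorem AgreeBelow.trans {s'' : State} (h : AgreeBelow m s s') (h' : AgreeBelow m s' s'') :
    AgreeBelow m s s'' :=
  ⟨fun x hx => (h'.reg x hx).trans (h.reg x hx), fun a ha => (h'.arr a ha).trans (h.arr a ha)⟩

theorem AgreeBelow.setReg {x : ℕ} (h : AgreeBelow m s s') (hx : m ≤ x) (i : ℕ) :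
    AgreeBelow m s (s'.setReg x i) :=
  ⟨fun y hy => by simp [h.reg y hy, show y ≠ x by omega], h.arr⟩

theorem Stmt.agreeBelow (hreg : ∀ x ∈ p.regs, m ≤ x) (harr : ∀ a ∈ p.arrs, m ≤ a) (s : State) :
    AgreeBelow m s (p.eval s) :=
  ⟨fun _ hx => eval_reg fun h => (hreg _ h).not_gt hx,
    fun _ ha => eval_arr fun h => (harr _ h).not_gt ha⟩

theorem IsPrepared.agreeBelow (h : IsPrepared G X s) (hs : AgreeBelow 5 s s') :
    IsPrepared G X s' :=
  h.congr (fun x hx => hs.reg x (by omega)) (by simp [hs.arr])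

/-- Cell `c` of the table holds the colouring `σ`: array `5` tells which cells are occupied, and
array `6` holds the colourings, one after the other. -/
structure Stores (s : State) (c : ℕ) (σ : Fin n → ℕ) : Prop where
  occupied : 0 < s.arr 5 c
  row : ∀ v : Fin n, s.arr 6 (c * n + v) = σ v

theorem Stores.unique (h : Stores s c σ) (h' : Stores s c ρ) : σ = ρ :=
  funext fun v => (h.row v).symm.trans (h'.row v)

theorem stores_congr (h5 : s'.arr 5 = s.arr 5) (h6 : s'.arr 6 = s.arr 6) :
    Stores s' c σ ↔ Stores s c σ :=
  ⟨fun h => ⟨h5 ▸ h.occupied, h6 ▸ h.row⟩, fun h => ⟨h5 ▸ h.occupied, h6 ▸ h.row⟩⟩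

theorem stores_setReg {x i : ℕ} : Stores (s.setReg x i) c σ ↔ Stores s c σ :=
  stores_congr (s := s) rfl rfl

/-- The colourings in the table. -/
def rows (n : ℕ) (s : State) : Set (Fin n → ℕ) := {σ | ∃ c, Stores s c σ}

theorem rows_setReg {x i : ℕ} : rows n (s.setReg x i) = rows n s := by
  simp only [rows, stores_setReg]

/-- Besides the data for keys, the state holds a table, whose cells are indexed by keys. -/
structure HoldsTable (G : SimpleGraph (Fin n)) (X : Finset (Fin n)) (s : State) : Prop
    extends IsPrepared G X s where
  le_two : ∀ c (σ : Fin n → ℕ), Stores s c σ → ∀ v, σ v ≤ 2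
  key_eq : ∀ c (σ : Fin n → ℕ), Stores s c σ → ∃ r ≤ n, key G X r σ = c

theorem HoldsTable.setReg {x : ℕ} (h : HoldsTable G X s) (hx : 2 ≤ x) (i : ℕ) :
    HoldsTable G X (s.setReg x i) :=
  ⟨h.toIsPrepared.setReg hx i, fun c σ hσ => h.le_two c σ (stores_setReg.1 hσ),
    fun c σ hσ => h.key_eq c σ (stores_setReg.1 hσ)⟩

theorem HoldsTable.lt_reg_one (h : HoldsTable G X s) (hσ : Stores s c σ) : c < s.reg 1 := by
  obtain ⟨r, hr, rfl⟩ := h.key_eq c σ hσ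
  exact (key_lt hr (h.le_two _ σ hσ)).trans_eq h.reg_one.symm

/-- Copy cell `c` of the table, where `c` is in register `5`, to the buffer. -/
def load : Stmt :=
  .for_ 6 (.var 0) (.store 9 (.var 6) (.get 6 (.add (.mul (.var 5) (.var 0)) (.var 6))))

/-- Store the colouring in the buffer in the table if the cell for its key is free. -/
def enter : Stmt :=
  .cond (.get 5 .key) .skip (.seq
    (.for_ 6 (.var 0) (.store 6 (.add (.mul .key (.var 0)) (.var 6)) (.get 9 (.var 6))))
    (.store 5 .key (.lit 1)))

theorem col_load (h : Stores s c σ) (hn : s.reg 0 = n) (hc : s.reg 5 = c) :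
    (load.eval s).col 9 = σ := by
  refine funext (Stmt.eval_fill (i := Fin.val) hn Fin.val_injective fun t hreg harr v hv => ?_).1
  simp only [Expr.eval, hv, hreg 0 (by decide), hreg 5 (by decide), harr 6 (by decide), hn, hc,
    h.row v, and_self]

theorem eval_enter_of_free (h : IsPrepared G X s) (hr : s.reg 2 = r) {k : ℕ}
    (hk : key G X r (s.col 9) = k) (hfree : s.arr 5 k = 0) :
    (enter.eval s).arr 5 = Function.update (s.arr 5) k 1 ∧
      (∀ v : Fin n, (enter.eval s).arr 6 (k * n + v) = s.col 9 v) ∧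
      ∀ j ∉ Set.range fun v : Fin n => k * n + v.val, (enter.eval s).arr 6 j = s.arr 6 j := by
  have hkey (t : State) (ht : AgreeBelow 5 s t) (h9 : t.arr 9 = s.arr 9) : Expr.key.eval t = k :=
    ((h.agreeBelow ht).eval_key ((ht.reg 2 (by decide)).trans hr)).trans
      ((congrArg (key G X r) (funext fun v => congrFun h9 v)).trans hk)
  have hn := h.reg_zero
  set t := (Stmt.for_ 6 (.var 0)
    (.store 6 (.add (.mul .key (.var 0)) (.var 6)) (.get 9 (.var 6)))).eval s with ht
  have hbelow : AgreeBelow 5 s t := Stmt.agreeBelow (by simp [Stmt.regs]) (by simp [Stmt.arrs]) s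
  have harr (a : ℕ) (ha : a ≠ 6) : t.arr a = s.arr a := Stmt.eval_arr (by simp [Stmt.arrs, ha])
  have henter : enter.eval s = t.setArr 5 k 1 := by
    rw [enter, Stmt.eval, if_neg, Stmt.eval, ← ht, Stmt.eval, hkey t hbelow (harr 9 (by decide)),
      Expr.eval]
    rw [Expr.eval, hkey s ⟨fun _ _ => rfl, fun _ _ => rfl⟩ rfl, hfree]
    exact lt_irrefl 0
  rw [henter]
  refine ⟨by simp only [State.setArr_arr, if_pos, harr 5 (by decide)],
    Stmt.eval_fill hn (fun v w hvw => Fin.ext (Nat.add_left_cancel hvw)) ?_⟩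
  intro u hreg harr v hv
  have hu : AgreeBelow 5 s u := ⟨fun x hx => hreg x (by omega), fun a ha => harr a (by omega)⟩
  simp only [Expr.eval, hkey u hu (harr 9 (by decide)), hu.reg 0 (by decide), hn, hv,
    harr 9 (by decide), State.col, and_self]

theorem enter_eq_of_occupied (h : IsPrepared G X s) (hr : s.reg 2 = r)
    (hocc : 0 < s.arr 5 (key G X r (s.col 9))) : enter.eval s = s := by
  rw [enter, Stmt.eval, Expr.eval, h.eval_key hr, if_pos hocc, Stmt.eval]

theorem stores_enter_iff (h : IsPrepared G X s) (hr : s.reg 2 = r) {k : ℕ}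
    (hk : key G X r (s.col 9) = k) :
    Stores (enter.eval s) c σ ↔ Stores s c σ ∨ c = k ∧ σ = s.col 9 ∧ s.arr 5 k = 0 := by
  rcases Nat.eq_zero_or_pos (s.arr 5 k) with hfree | hocc
  · obtain ⟨h5, hnew, hold⟩ := eval_enter_of_free h hr hk hfree
    have hk' : ¬ Stores s k σ := fun hσ => hσ.occupied.ne' hfree
    by_cases hc : c = k
    · subst hc
      simp only [hk', false_or, hfree, true_and, and_true]
      exact ⟨fun hσ => funext fun v => (hσ.row v).symm.trans (hnew v),
        fun hσ => ⟨by simp [h5], fun v => (hnew v).trans (congrFun hσ.symm v)⟩⟩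
    · have hrow (v : Fin n) : (enter.eval s).arr 6 (c * n + v) = s.arr 6 (c * n + v) :=
        hold _ fun ⟨w, hw⟩ => hc ((mul_add_eq_mul_add_iff w.2 v.2).1 hw).1.symm
      simp only [hc, false_and, or_false]
      exact ⟨fun hσ => ⟨by simpa [h5, hc] using hσ.occupied,
          fun v => (hrow v).symm.trans (hσ.row v)⟩,
        fun hσ => ⟨by simpa [h5, hc] using hσ.occupied, fun v => (hrow v).trans (hσ.row v)⟩⟩
  · rw [enter_eq_of_occupied h hr (hk ▸ hocc)]
    simp [hocc.ne']

/-- Enter the modified colouring in the buffer if it passes the test before the modification. -/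
def attempt (test : Expr) (paint : Stmt) : Stmt := .cond test (.seq paint enter) .skip

/-- If cell `c` of the table, where `c` is in register `5`, holds a colouring, attempt to modify
it. -/
def update (test : Expr) (paint : Stmt) : Stmt :=
  .cond (.get 5 (.var 5)) (.seq load (attempt test paint)) .skip

/-- Modify all colourings in the table that pass the test, including those that are entered on the
way in cells not yet visited. -/
def pass (test : Expr) (paint : Stmt) : Stmt := .for_ 5 (.var 1) (update test paint)

/-- In states that agree with `s` below `5`, the colouring `σ` in the buffer passes the test if and
only if it is related to some colouring `σ'`, and `σ'` is then what `paint` makes of `σ`. -/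
structure Implements (s : State) (test : Expr) (paint : Stmt)
    (R : (Fin n → ℕ) → (Fin n → ℕ) → Prop) : Prop where
  regs_eq_nil : paint.regs = []
  eq_nine : ∀ a ∈ paint.arrs, a = 9
  le_two : ∀ σ σ', (∀ v, σ v ≤ 2) → R σ σ' → ∀ v, σ' v ≤ 2
  rel_iff : ∀ t, AgreeBelow 5 s t → ∀ σ',
    R (t.col 9) σ' ↔ test.Holds t ∧ σ' = (paint.eval t).col 9

theorem Implements.agreeBelow (h : Implements s test paint R) (hs : AgreeBelow 5 s s') :
    Implements s' test paint R :=
  ⟨h.regs_eq_nil, h.eq_nine, h.le_two, fun t ht => h.rel_iff t (hs.trans ht)⟩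

theorem agreeBelow_enter (s : State) : AgreeBelow 5 s (enter.eval s) :=
  Stmt.agreeBelow (by simp [enter, Stmt.regs]) (by simp [enter, Stmt.arrs]) s

theorem agreeBelow_load (s : State) : AgreeBelow 5 s (load.eval s) :=
  Stmt.agreeBelow (by simp [load, Stmt.regs]) (by simp [load, Stmt.arrs]) s

theorem Implements.agreeBelow_paint (h : Implements s test paint R) (t : State) :
    AgreeBelow 5 t (paint.eval t) :=
  Stmt.agreeBelow (by simp [h.regs_eq_nil]) (fun a ha => by have := h.eq_nine a ha; omega) t

theorem Implements.agreeBelow_update (h : Implements s test paint R) (t : State) :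
    AgreeBelow 5 t ((update test paint).eval t) := by
  simp only [update, attempt, Stmt.eval]
  split_ifs
  · exact (agreeBelow_load t).trans ((h.agreeBelow_paint _).trans (agreeBelow_enter _))
  · exact agreeBelow_load t
  · exact ⟨fun _ _ => rfl, fun _ _ => rfl⟩

theorem Implements.stores_attempt_iff (h : Implements s test paint R) (hs : IsPrepared G X s)
    (hr : s.reg 2 = r) {k : ℕ} :
    Stores ((attempt test paint).eval s) k ρ ↔
      Stores s k ρ ∨ R (s.col 9) ρ ∧ k = key G X r ρ ∧ s.arr 5 k = 0 := by
  have hbelow := h.agreeBelow_paint s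
  have hpaint (a : ℕ) (ha : a ≠ 9) : (paint.eval s).arr a = s.arr a :=
    Stmt.eval_arr fun hmem => ha (h.eq_nine a hmem)
  rw [h.rel_iff s ⟨fun _ _ => rfl, fun _ _ => rfl⟩, attempt, Stmt.eval]
  by_cases htest : 0 < test.eval s
  · rw [if_pos htest, Stmt.eval, stores_enter_iff (hs.agreeBelow hbelow)
      ((hbelow.reg 2 (by decide)).trans hr) rfl, hpaint 5 (by decide),
      stores_congr (hpaint 5 (by decide)) (hpaint 6 (by decide))]
    constructor
    · rintro (hρ | ⟨rfl, rfl, hfree⟩)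
      exacts [.inl hρ, .inr ⟨⟨htest, rfl⟩, rfl, hfree⟩]
    · rintro (hρ | ⟨⟨-, rfl⟩, rfl, hfree⟩)
      exacts [.inl hρ, .inr ⟨rfl, rfl, hfree⟩]
  · rw [if_neg htest, Stmt.eval]
    simp [Expr.Holds, htest]

theorem exists_stores (n : ℕ) (h : 0 < s.arr 5 c) : ∃ σ : Fin n → ℕ, Stores s c σ :=
  ⟨_, h, fun _ => rfl⟩

theorem Implements.stores_update_iff (h : Implements s test paint R) (hs : IsPrepared G X s)
    (hr : s.reg 2 = r) (hc : s.reg 5 = c) {k : ℕ} :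
    Stores ((update test paint).eval s) k ρ ↔
      Stores s k ρ ∨ ∃ σ, Stores s c σ ∧ R σ ρ ∧ k = key G X r ρ ∧ s.arr 5 k = 0 := by
  by_cases hocc : 0 < s.arr 5 c
  · obtain ⟨σ, hσ⟩ := exists_stores n hocc
    have hload := agreeBelow_load s
    have harr (a : ℕ) (ha : a ≠ 9) : (load.eval s).arr a = s.arr a :=
      Stmt.eval_arr (by simp [load, Stmt.arrs, ha])
    rw [update, Stmt.eval, Expr.eval, Expr.eval, hc, if_pos hocc, Stmt.eval,
      (h.agreeBelow hload).stores_attempt_iff (hs.agreeBelow hload)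
        ((hload.reg 2 (by decide)).trans hr),
      col_load hσ hs.reg_zero hc, stores_congr (harr 5 (by decide)) (harr 6 (by decide)),
      harr 5 (by decide)]
    exact or_congr_right
      ⟨fun hR => ⟨σ, hσ, hR⟩, fun ⟨σ', hσ', hR⟩ => hσ.unique hσ' ▸ hR⟩
  · have hσ (σ : Fin n → ℕ) : ¬ Stores s c σ := fun hσ => hocc hσ.occupied
    simp [update, Stmt.eval, Expr.eval, hc, hocc, hσ]

theorem Implements.holdsTable_update (h : Implements s test paint R) (hs : HoldsTable G X s)
    (hr : s.reg 2 = r) (hrn : r ≤ n) : HoldsTable G X ((update test paint).eval s) := by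
  refine ⟨hs.toIsPrepared.agreeBelow (h.agreeBelow_update s), fun k ρ hρ => ?_, fun k ρ hρ => ?_⟩
  all_goals rcases (h.stores_update_iff hs.toIsPrepared hr rfl).1 hρ with hρ | ⟨σ, hσ, hR, hk, -⟩
  exacts [hs.le_two k ρ hρ, h.le_two σ ρ (hs.le_two _ σ hσ) hR, hs.key_eq k ρ hρ, ⟨r, hrn, hk.symm⟩]

theorem Implements.exists_stores_update (h : Implements s test paint R) (hs : HoldsTable G X s)
    (hr : s.reg 2 = r) (hrn : r ≤ n) (hc : s.reg 5 = c) (hσ : Stores s c σ) (hR : R σ ρ) :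
    ∃ k ρ', Stores ((update test paint).eval s) k ρ' ∧ IsSimilar G X (cliqueAt G X r) ρ' ρ := by
  have hiff {k : ℕ} {ρ : Fin n → ℕ} := h.stores_update_iff hs.toIsPrepared hr hc (k := k) (ρ := ρ)
  have hρ : ∀ v, ρ v ≤ 2 := h.le_two σ ρ (hs.le_two c σ hσ) hR
  rcases Nat.eq_zero_or_pos (s.arr 5 (key G X r ρ)) with hfree | hocc
  · exact ⟨_, ρ, hiff.2 (.inr ⟨σ, hσ, hR, rfl, hfree⟩), .refl G X _ _⟩
  · obtain ⟨ρ', hρ'⟩ := exists_stores n hocc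
    obtain ⟨r', hr', hkey⟩ := hs.key_eq _ ρ' hρ'
    exact ⟨_, ρ', hiff.2 (.inl hρ'), isSimilar_of_key_eq hr' hrn (hs.le_two _ ρ' hρ') hρ hkey⟩

/-- The effect of a pass whose visits to the cells below `c` have led from the state `s` to the
state `t`. -/
structure IsPassed (G : SimpleGraph (Fin n)) (X : Finset (Fin n)) (r : ℕ)
    (R : (Fin n → ℕ) → (Fin n → ℕ) → Prop) (s : State) (c : ℕ) (t : State) : Prop
    extends HoldsTable G X t where
  agreeBelow : AgreeBelow 5 s t
  mono : ∀ k (σ : Fin n → ℕ), Stores s k σ → Stores t k σ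
  derivable : ∀ P : (Fin n → ℕ) → Prop, (∀ σ ∈ rows n s, P σ) →
    (∀ σ σ', P σ → R σ σ' → P σ') → ∀ σ ∈ rows n t, P σ
  complete : ∀ c' < c, ∀ σ σ', Stores s c' σ → R σ σ' →
    ∃ ρ ∈ rows n t, IsSimilar G X (cliqueAt G X r) ρ σ'

theorem IsPassed.setReg {t : State} (h : IsPassed G X r R s c t) :
    IsPassed G X r R s c (t.setReg 5 c) where
  toHoldsTable := h.toHoldsTable.setReg (by decide) c
  agreeBelow := h.agreeBelow.setReg le_rfl c
  mono k σ hσ := stores_setReg.2 (h.mono k σ hσ)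
  derivable P h0 hstep σ := fun ⟨k, hσ⟩ => h.derivable P h0 hstep σ ⟨k, stores_setReg.1 hσ⟩
  complete c' hc' σ σ' hσ hR :=
    have ⟨ρ, ⟨k, hρ⟩, hsim⟩ := h.complete c' hc' σ σ' hσ hR
    ⟨ρ, ⟨k, stores_setReg.2 hρ⟩, hsim⟩

theorem IsPassed.update {t : State} (h : Implements s test paint R) (hr : s.reg 2 = r)
    (hrn : r ≤ n) (ht : IsPassed G X r R s c t) (hc : t.reg 5 = c) :
    IsPassed G X r R s (c + 1) ((update test paint).eval t) := by
  have himp := h.agreeBelow ht.agreeBelow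
  have hr' : t.reg 2 = r := (ht.agreeBelow.reg 2 (by decide)).trans hr
  have hiff {k : ℕ} {ρ : Fin n → ℕ} :=
    himp.stores_update_iff ht.toIsPrepared hr' hc (k := k) (ρ := ρ)
  refine ⟨himp.holdsTable_update ht.toHoldsTable hr' hrn,
    ht.agreeBelow.trans (himp.agreeBelow_update _),
    fun k σ hσ => hiff.2 (.inl (ht.mono k σ hσ)), fun P h0 hstep ρ ⟨k, hρ⟩ => ?_,
    fun c' hc' σ σ' hσ hR => ?_⟩
  · rcases hiff.1 hρ with hρ | ⟨σ, hσ, hR, -⟩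
    exacts [ht.derivable P h0 hstep ρ ⟨k, hρ⟩,
      hstep σ ρ (ht.derivable P h0 hstep σ ⟨c, hσ⟩) hR]
  · rcases Nat.lt_succ_iff_lt_or_eq.1 hc' with hlt | rfl
    · obtain ⟨ρ, ⟨k, hρ⟩, hsim⟩ := ht.complete c' hlt σ σ' hσ hR
      exact ⟨ρ, ⟨k, hiff.2 (.inl hρ)⟩, hsim⟩
    · obtain ⟨k, ρ, hρ, hsim⟩ := himp.exists_stores_update ht.toHoldsTable hr' hrn hc
        (ht.mono c' σ hσ) hR
      exact ⟨ρ, ⟨k, hρ⟩, hsim⟩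

theorem Implements.extends_pass (h : Implements s test paint R) (hs : HoldsTable G X s)
    (hr : s.reg 2 = r) (hrn : r ≤ n) :
    AgreeBelow 5 s ((pass test paint).eval s) ∧ HoldsTable G X ((pass test paint).eval s) ∧
      Extends G X (cliqueAt G X r) R (rows n s) (rows n ((pass test paint).eval s)) := by
  have hpass : IsPassed G X r R s (s.reg 1) ((pass test paint).eval s) :=
    Stmt.for_induct (e := .var 1) (IsPassed G X r R s)
      ⟨hs, ⟨fun _ _ => rfl, fun _ _ => rfl⟩, fun _ _ => id, fun _ h0 _ => h0, by simp⟩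
      fun _ _ _ ht => ht.setReg.update h hr hrn (by simp)
  exact ⟨hpass.agreeBelow, hpass.toHoldsTable, fun σ ⟨c, hσ⟩ => ⟨c, hpass.mono c σ hσ⟩,
    hpass.derivable, fun σ ⟨c, hσ⟩ _ => hpass.complete c (hs.lt_reg_one hσ) σ _ hσ⟩

/-- Store the colouring `0` in cell `0` of an empty table. -/
def seed : Stmt := .store 5 (.lit 0) (.lit 1)

/-- Colour the vertex in register `3`, in all colourings in the table and in both colours. -/
def recolour : Stmt :=
  .seq (pass (.lit 1) (.store 9 (.var 3) (.lit 1))) (pass (.lit 1) (.store 9 (.var 3) (.lit 2)))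

/-- Enter all colourings of the marked vertices. -/
def colourMarked : Stmt :=
  .seq (.assign 2 (.lit 0)) (.for_ 3 (.var 0) (.cond (.marked 3) recolour .skip))

theorem IsPrepared.eval_seed (h : IsPrepared G X s) (h5 : s.arr 5 = 0) (h6 : s.arr 6 = 0) :
    HoldsTable G X (seed.eval s) ∧ ListsColourings X ∅ (rows n (seed.eval s)) := by
  have hiff {c : ℕ} {σ : Fin n → ℕ} : Stores (seed.eval s) c σ ↔ c = 0 ∧ σ = 0 := by
    constructor
    · rintro ⟨hocc, hrow⟩
      refine ⟨by_contra fun hc => hocc.ne' ?_, funext fun v => (hrow v).symm.trans ?_⟩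
      · simp [seed, Stmt.eval, State.setArr_arr, Expr.eval, hc, h5]
      · simp [seed, Stmt.eval, State.setArr_arr, h6]
    · rintro ⟨rfl, rfl⟩
      constructor <;> simp [seed, Stmt.eval, State.setArr_arr, Expr.eval, h6]
  have hrows {σ : Fin n → ℕ} (hσ : σ ∈ rows n (seed.eval s)) : σ = 0 :=
    hσ.elim fun c hc => (hiff.1 hc).2
  refine ⟨⟨h.agreeBelow (Stmt.agreeBelow (by simp [seed, Stmt.regs])
    (by simp [seed, Stmt.arrs]) s), fun c σ hσ v => ?_, fun c σ hσ => ?_⟩,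
    fun σ hσ v => ?_, fun σ hσ v _ => ?_, fun σ _ h0 => ?_⟩
  · simp [(hiff.1 hσ).2]
  · obtain ⟨rfl, rfl⟩ := hiff.1 hσ
    exact ⟨0, n.zero_le, key_zero G X⟩
  · simp [hrows hσ]
  · simp [hrows hσ]
  · exact ⟨0, hiff.2 ⟨rfl, funext fun v => h0 v (Finset.notMem_empty v)⟩⟩

theorem implements_update (h3 : s.reg 3 = v) (hq : q ≤ 2) :
    Implements s (.lit 1) (.store 9 (.var 3) (.lit q))
      fun σ σ' => σ' = Function.update σ v q where
  regs_eq_nil := rfl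
  eq_nine := by simp [Stmt.arrs]
  le_two σ σ' hσ := by
    rintro rfl u
    rw [Function.update_apply]
    split_ifs
    exacts [hq, hσ u]
  rel_iff t ht σ' := by
    have hcol : ((Stmt.store 9 (.var 3) (.lit q)).eval t).col 9 =
        Function.update (t.col 9) v q := by
      funext u
      simp [State.col, Stmt.eval, Expr.eval, State.setArr_arr, Function.update_apply,
        ht.reg 3 (by decide), h3, Fin.val_inj]
    simp [Expr.Holds, Expr.eval, hcol]

theorem HoldsTable.eval_recolour {Y : Finset (Fin n)} (hs : HoldsTable G X s)
    (h : ListsColourings X Y (rows n s)) (h2 : s.reg 2 = 0) (h3 : s.reg 3 = v)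
    (hY : insert v Y ⊆ X) :
    HoldsTable G X (recolour.eval s) ∧ AgreeBelow 5 s (recolour.eval s) ∧
      ListsColourings X (insert v Y) (rows n (recolour.eval s)) := by
  obtain ⟨hs₁, htable₁, hext₁⟩ :=
    (implements_update h3 (q := 1) (by decide)).extends_pass hs h2 n.zero_le
  obtain ⟨hs₂, htable₂, hext₂⟩ :=
    (implements_update ((hs₁.reg 3 (by decide)).trans h3) le_rfl).extends_pass htable₁
      ((hs₁.reg 2 (by decide)).trans h2) n.zero_le
  exact ⟨htable₂, hs₁.trans hs₂, h.insert hY hext₁ hext₂⟩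

theorem HoldsTable.eval_colourMarked (hs : HoldsTable G X s) (h : ListsColourings X ∅ (rows n s)) :
    HoldsTable G X (colourMarked.eval s) ∧
      ListsColourings X X (rows n (colourMarked.eval s)) := by
  have hs' : HoldsTable G X (s.setReg 2 0) := hs.setReg le_rfl 0
  have hloop := Stmt.for_vertices_induct (x := 3) (p := .cond (.marked 3) recolour .skip)
    (s := s.setReg 2 0) (fun U t => HoldsTable G X t ∧ t.reg 2 = 0 ∧
      ∃ Y, (∀ u, u ∈ Y ↔ u ∈ X ∧ u ∈ U) ∧ ListsColourings X Y (rows n t)) hs'.reg_zero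
    ⟨hs', by simp, ∅, by simp, rows_setReg.symm ▸ h⟩ fun U v t _ ⟨ht, h2, Y, hY, hlist⟩ => ?_
  · obtain ⟨htable, -, Y, hY, hlist⟩ := hloop
    obtain rfl : Y = X := Finset.ext fun u => by simp [hY]
    exact ⟨htable, hlist⟩
  have ht' : HoldsTable G X (t.setReg 3 v) := ht.setReg (by decide) v
  have h2' : (t.setReg 3 v).reg 2 = 0 := by simp [h2]
  rw [← rows_setReg (x := 3) (i := v)] at hlist
  have hmark := Expr.holds_marked (x := 3) (v := v) ht'.toHoldsMarks (by simp)
  rw [Stmt.eval]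
  by_cases hvX : v ∈ X
  · rw [if_pos (show 0 < _ from hmark.2 hvX)]
    obtain ⟨htable, hagree, hlist'⟩ := ht'.eval_recolour hlist h2' (v := v) (by simp) (by grind)
    exact ⟨htable, (hagree.reg 2 (by decide)).trans h2', insert v Y, by grind, hlist'⟩
  · rw [if_neg (show ¬ 0 < _ from mt hmark.1 hvX)]
    exact ⟨ht', h2', Y, by grind, hlist⟩

/-- Whether the vertices in registers `3` and `4` form a link of the clique that is numbered by
register `2`, and whether the colouring in the buffer can be modified so as to match them. -/
def joinTest : Expr :=
  .and (.and (.adj 3 4) (.and (.or (.inClique 3) (.marked 3)) (.and (.or (.inClique 4) (.marked 4))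
    (.or (.inClique 3) (.inClique 4)))))
    (.and (.and (.eq (.colour 3) (.marked 3)) (.eq (.colour 4) (.add (.marked 4) (.marked 4))))
      (.and (.eq (.rivals (.lit 1) 3) (.marked 4)) (.eq (.rivals (.lit 2) 4) (.marked 3))))

/-- Give the vertices in registers `3` and `4` the colours `1` and `2`. -/
def paintPair : Stmt := .seq (.store 9 (.var 3) (.lit 1)) (.store 9 (.var 4) (.lit 2))

theorem col_paintPair (h3 : s.reg 3 = v) (h4 : s.reg 4 = w) :
    (paintPair.eval s).col 9 = Function.update (Function.update (s.col 9) v 1) w 2 := by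
  funext u
  simp [State.col, paintPair, Stmt.eval, Expr.eval, State.setArr_arr, Function.update_apply, h3,
    h4, Fin.val_inj]

theorem holds_joinTest (h : HoldsMarks G X s) (h2 : s.reg 2 = r) (h3 : s.reg 3 = v)
    (h4 : s.reg 4 = w) : joinTest.Holds s ↔ IsLink G X (cliqueAt G X r) v w ∧
      (s.col 9 v = (if v ∈ X then 1 else 0) ∧ s.col 9 w = if w ∈ X then 2 else 0) ∧
      rivalDegree G (s.col 9) 1 v = (if w ∈ X then 1 else 0) ∧
      rivalDegree G (s.col 9) 2 w = if v ∈ X then 1 else 0 := by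
  have hlink : IsLink G X (cliqueAt G X r) v w ↔ G.Adj v w ∧
      (v ∈ cliqueAt G X r ∨ v ∈ X) ∧ (w ∈ cliqueAt G X r ∨ w ∈ X) ∧
      (v ∈ cliqueAt G X r ∨ w ∈ cliqueAt G X r) :=
    ⟨fun h => ⟨h.adj, h.left, h.right, h.meets⟩, fun h => ⟨h.1, h.2.1, h.2.2.1, h.2.2.2⟩⟩
  have hcolour {x : ℕ} {u : Fin n} (hx : s.reg x = u) : (Expr.colour x).eval s = s.col 9 u := by
    simp only [Expr.colour, Expr.eval, hx, State.col]
  have htwo : (if w ∈ X then 2 else 0) = (if w ∈ X then 1 else 0) + if w ∈ X then 1 else 0 := by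
    split_ifs <;> rfl
  simp only [joinTest, Expr.holds_and, Expr.holds_or, Expr.holds_eq, hlink, htwo,
    Expr.holds_adj h.toHoldsGraph h3 h4, Expr.holds_marked h h3, Expr.holds_marked h h4,
    Expr.holds_inClique h h2 h3 (by decide), Expr.holds_inClique h h2 h4 (by decide),
    Expr.eval_marked h h3, Expr.eval_marked h h4, hcolour h3, hcolour h4, Expr.eval,
    Expr.eval_rivals h.toHoldsGraph (e := .lit 1) (fun _ => rfl) h3 (by decide),
    Expr.eval_rivals h.toHoldsGraph (e := .lit 2) (fun _ => rfl) h4 (by decide)]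

theorem implements_join (h : IsPrepared G X s) (h2 : s.reg 2 = r) (h3 : s.reg 3 = v)
    (h4 : s.reg 4 = w) : Implements s joinTest paintPair
      fun σ σ' => IsLink G X (cliqueAt G X r) v w ∧ Joins G X 1 2 v w σ σ' where
  regs_eq_nil := rfl
  eq_nine := by simp [paintPair, Stmt.arrs]
  le_two σ σ' hσ hR := hR.2.le_two hσ
  rel_iff t ht σ' := by
    have h3' := (ht.reg 3 (by decide)).trans h3
    have h4' := (ht.reg 4 (by decide)).trans h4
    rw [holds_joinTest (h.agreeBelow ht).toHoldsMarks ((ht.reg 2 (by decide)).trans h2) h3' h4',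
      col_paintPair h3' h4', and_assoc]
    exact and_congr_right fun hlink => joins_one_two_iff hlink.adj

/-- Match the vertices of each link of each clique, in all colourings in the table. -/
def processCliques : Stmt :=
  .for_ 2 (.var 0) (.for_ 3 (.var 0) (.for_ 4 (.var 0) (pass joinTest paintPair)))

theorem HoldsTable.eval_joinPairs {D : Fin n → Fin n → Prop} (hs : HoldsTable G X s)
    (hX : HitsInducedPaths G X) (h2 : s.reg 2 = r) (hr : r ≤ n)
    (h : IsTable G X (cliqueAt G X) (r + 1) (cliqueAt G X r) D (rows n s)) :
    let s' := (Stmt.for_ 3 (.var 0) (.for_ 4 (.var 0) (pass joinTest paintPair))).eval s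
    HoldsTable G X s' ∧ IsTable G X (cliqueAt G X) (r + 1) (cliqueAt G X r)
      (fun v w => D v w ∨ IsLink G X (cliqueAt G X r) v w) (rows n s') := by
  have hpairs := Stmt.for_pairs_induct (x := 3) (y := 4) (p := pass joinTest paintPair) (s := s)
    (fun E t => HoldsTable G X t ∧ t.reg 2 = r ∧
      IsTable G X (cliqueAt G X) (r + 1) (cliqueAt G X r)
        (fun v w => D v w ∨ (v, w) ∈ E ∧ IsLink G X (cliqueAt G X r) v w) (rows n t))
    ⟨hs, h2, by simpa using h⟩ (by decide) (by decide) (fun _ _ h => h.1.reg_zero)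
    (fun E t i ⟨ht, ht2, h⟩ => ⟨ht.setReg (by decide) i, by simpa using ht2, by rwa [rows_setReg]⟩)
    fun E v w t ⟨ht, ht2, h⟩ hv => ?_
  · exact ⟨hpairs.1, by simpa using hpairs.2.2⟩
  rw [← rows_setReg (x := 4) (i := w)] at h
  have ht' : HoldsTable G X (t.setReg 4 w) := ht.setReg (by decide) w
  have ht2' : (t.setReg 4 w).reg 2 = r := by simp [ht2]
  obtain ⟨hagree, htable, hext⟩ := (implements_join (v := v) (w := w) ht'.toIsPrepared ht2'
    (by simp [hv]) (by simp)).extends_pass ht' ht2' hr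
  refine ⟨htable, (hagree.reg 2 (by decide)).trans ht2',
    h.join (hX.isBlock_cliqueAt r) hext fun x y hxy => ?_⟩
  rcases hxy with hD | ⟨hmem, hlink⟩
  · exact .inl (.inl hD)
  · rcases hmem with heq | hE
    · obtain ⟨rfl, rfl⟩ := Prod.mk.inj heq
      exact .inr ⟨hlink, rfl, rfl⟩
    · exact .inl (.inr ⟨hE, hlink⟩)

theorem HoldsTable.eval_processCliques (hs : HoldsTable G X s) (hX : HitsInducedPaths G X)
    (h : ListsColourings X X (rows n s)) :
    HoldsTable G X (processCliques.eval s) ∧ ∀ τ, IsSolution G τ →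
      ∃ σ ∈ rows n (processCliques.eval s), IsSolution G σ ∧ weight σ = weight τ := by
  have hloop := Stmt.for_induct (x := 2) (e := .var 0) (s := s)
    (p := .for_ 3 (.var 0) (.for_ 4 (.var 0) (pass joinTest paintPair)))
    (fun i t => HoldsTable G X t ∧ ∃ B, IsTable G X (cliqueAt G X) i B
      (fun v w => ∃ r < i, IsLink G X (cliqueAt G X r) v w) (rows n t))
    ⟨hs, ∅, by simpa using h.isTable⟩ fun i hi t ⟨ht, B, hB⟩ => ?_
  · obtain ⟨htable, B, hB⟩ := hloop
    refine ⟨htable, fun τ => hB.exists_isSolution fun v w hvw =>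
      or_iff_not_imp_right.2 fun hnot => ?_⟩
    obtain ⟨r, hr, hlink⟩ := hX.exists_isLink hvw hnot
    exact ⟨r, hr.trans_eq hs.reg_zero.symm, hlink⟩
  rw [Expr.eval, hs.reg_zero] at hi
  rw [← rows_setReg (x := 2) (i := i)] at hB
  obtain ⟨htable, hB'⟩ := (ht.setReg le_rfl i).eval_joinPairs hX (by simp) hi.le
    (hB.next_block (hX.isBlock_cliqueAt i).notMem fun j hj => disjoint_cliqueAt hj.ne)
  refine ⟨htable, cliqueAt G X i, ?_⟩
  convert hB' using 4
  exact Nat.exists_lt_succ_right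

end RAM

/-! ### The algorithm -/

namespace RAM

variable {n k : ℕ} {G : SimpleGraph (Fin n)} {X : Finset (Fin n)} {s s' : State}

/-- Whether the colouring in the buffer is a solution. -/
def solutionTest : Expr :=
  .not (.any 7 (.and (.lt (.lit 0) (.colour 7)) (.not (.eq (.rivals (.colour 7) 7) (.lit 1)))))

/-- If cell `c` of the table, where `c` is in register `5`, holds a solution that is heavier than
the colouring in array `10`, copy it to array `10`. -/
def improve : Stmt :=
  .cond (.get 5 (.var 5)) (.seq load (.cond (.and solutionTest (.lt (.weight 10) (.weight 9)))
    (.for_ 6 (.var 0) (.store 10 (.var 6) (.colour 6))) .skip)) .skip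

/-- Copy a solution of maximum weight from the table to array `10`. -/
def selectBest : Stmt := .for_ 5 (.var 1) improve

/-- Write the indicator vector of the vertices with colour `q` in array `10` to array `q`. -/
def output (q : ℕ) : Stmt :=
  .for_ 6 (.var 0) (.store q (.var 6) (.eq (.get 10 (.var 6)) (.lit q)))

/-- Enter all colourings of the marked set `X` into a table, extend them over the cliques of
`G - X`, where of all colourings with the same key only one is kept, and output a solution of
maximum weight from the table. -/
def solve : Stmt :=
  .seq seed (.seq colourMarked (.seq processCliques
    (.seq selectBest (.seq (output 1) (output 2)))))

/-- The algorithm: mark a set of vertices that hits all induced paths with three vertices, and run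
the dynamic program for it. -/
def algorithm : Stmt := .seq markPaths (.seq prepare solve)

theorem holds_solutionTest (h : HoldsGraph G s) :
    solutionTest.Holds s ↔ IsMatchedOn G Set.univ (s.col 9) := by
  rw [solutionTest, Expr.holds_not, Expr.holds_any h.reg_zero
    (P := fun v => s.col 9 v ≠ 0 ∧ rivalDegree G (s.col 9) (s.col 9 v) v ≠ 1)]
  · simp [IsMatchedOn]
  · intro v
    have hv : HoldsGraph G (s.setReg 7 v) := h.congr (by simp) rfl
    rw [Expr.holds_and, Expr.holds_lt, Expr.holds_not, Expr.holds_eq,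
      Expr.eval_rivals hv (p := s.col 9 v) (v := v) (by simp [Expr.colour, Expr.eval, State.col])
        (by simp) (by decide)]
    have hcol : (s.setReg 7 v).col 9 = (s.col 9 : Fin n → ℕ) := rfl
    simp [hcol, Expr.colour, Expr.eval, pos_iff_ne_zero, State.col]

open Classical in
theorem HoldsTable.col_improve {c : ℕ} {σ : Fin n → ℕ} (hs : HoldsTable G X s)
    (hc : s.reg 5 = c) (hσ : Stores s c σ) : (improve.eval s).col 10 =
      if IsMatchedOn G Set.univ σ ∧ weight (s.col 10 : Fin n → ℕ) < weight σ
        then σ else s.col 10 := by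
  have hn := hs.reg_zero
  have hload := agreeBelow_load s
  have hn' : (load.eval s).reg 0 = n := (hload.reg 0 (by decide)).trans hn
  have hten : (load.eval s).col 10 = (s.col 10 : Fin n → ℕ) :=
    funext fun v => congrFun (Stmt.eval_arr (by decide)) _
  have htest := (Expr.holds_and (e := solutionTest) (f := .lt (.weight 10) (.weight 9))).trans
    (and_congr (holds_solutionTest (hs.toIsPrepared.agreeBelow hload).toHoldsGraph) Expr.holds_lt)
  rw [Expr.eval_weight hn', Expr.eval_weight hn', col_load hσ hn hc, hten] at htest
  rw [improve, Stmt.eval, Expr.eval, Expr.eval, hc, if_pos hσ.occupied, Stmt.eval, Stmt.eval]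
  by_cases h : IsMatchedOn G Set.univ σ ∧ weight (s.col 10 : Fin n → ℕ) < weight σ
  · rw [if_pos h, if_pos (show 0 < _ from htest.2 h)]
    refine funext (Stmt.eval_fill (i := Fin.val) hn' Fin.val_injective
      fun t _ harr v hv => ?_).1
    simp [Expr.colour, Expr.eval, hv, harr 9 (by decide), ← col_load hσ hn hc, State.col]
  · rw [if_neg h, if_neg (show ¬ 0 < _ from mt htest.1 h), Stmt.eval, hten]

theorem HoldsTable.eval_improve {c : ℕ} (hs : HoldsTable G X s) (hc : s.reg 5 = c)
    (hbest : IsSolution G (s.col 10)) : IsSolution G ((improve.eval s).col 10) ∧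
      weight (s.col 10 : Fin n → ℕ) ≤ weight ((improve.eval s).col 10 : Fin n → ℕ) ∧
      ∀ σ : Fin n → ℕ, Stores s c σ → IsSolution G σ →
        weight σ ≤ weight ((improve.eval s).col 10 : Fin n → ℕ) := by
  by_cases hocc : 0 < s.arr 5 c
  · obtain ⟨σ, hσ⟩ := exists_stores n hocc
    rw [hs.col_improve hc hσ]
    split_ifs with h
    · exact ⟨⟨hs.le_two c σ hσ, h.1⟩, h.2.le, fun σ' hσ' _ => (hσ'.unique hσ ▸ le_rfl)⟩
    · refine ⟨hbest, le_rfl, fun σ' hσ' hsol => not_lt.1 fun hlt => h ?_⟩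
      exact hσ'.unique hσ ▸ ⟨hsol.isMatchedOn, hlt⟩
  · rw [improve, Stmt.eval, Expr.eval, Expr.eval, hc, if_neg hocc]
    exact ⟨hbest, le_rfl, fun σ hσ => absurd hσ.occupied hocc⟩

theorem HoldsTable.eval_selectBest (hs : HoldsTable G X s) (hbest : IsSolution G (s.col 10)) :
    (selectBest.eval s).reg 0 = n ∧ IsSolution G ((selectBest.eval s).col 10) ∧
      ∀ σ ∈ rows n s, IsSolution G σ →
        weight σ ≤ weight ((selectBest.eval s).col 10 : Fin n → ℕ) := by
  have hstores {t : State} (h5 : t.arr 5 = s.arr 5) (h6 : t.arr 6 = s.arr 6)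
      (ht : IsPrepared G X t) : HoldsTable G X t :=
    ⟨ht, fun c σ hσ => hs.le_two c σ ((stores_congr h5 h6).1 hσ),
      fun c σ hσ => hs.key_eq c σ ((stores_congr h5 h6).1 hσ)⟩
  obtain ⟨hprep, -, -, hsol, hmax⟩ := Stmt.for_induct (x := 5) (e := .var 1) (p := improve) (s := s)
    (fun c t => IsPrepared G X t ∧ t.arr 5 = s.arr 5 ∧ t.arr 6 = s.arr 6 ∧
      IsSolution G (t.col 10) ∧ ∀ c' < c, ∀ σ : Fin n → ℕ, Stores s c' σ → IsSolution G σ →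
        weight σ ≤ weight (t.col 10 : Fin n → ℕ))
    ⟨hs.toIsPrepared, rfl, rfl, hbest, by simp⟩ fun c hc t ⟨ht, h5, h6, hsol, hmax⟩ => by
      have htable := (hstores h5 h6 ht).setReg (x := 5) (by decide) c
      obtain ⟨hsol', hle, hmax'⟩ := htable.eval_improve (c := c) (by simp) hsol
      refine ⟨htable.toIsPrepared.eval _ (by decide) (by decide),
        (Stmt.eval_arr (by decide)).trans h5, (Stmt.eval_arr (by decide)).trans h6, hsol',
        fun c' hc' σ hσ hσsol => ?_⟩
      rcases Nat.lt_succ_iff_lt_or_eq.1 hc' with hlt | rfl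
      · exact (hmax c' hlt σ hσ hσsol).trans hle
      · exact hmax' σ (stores_setReg.2 ((stores_congr h5 h6).2 hσ)) hσsol
  exact ⟨hprep.reg_zero, hsol, fun σ ⟨c, hσ⟩ => hmax c (hs.lt_reg_one hσ) σ hσ⟩

theorem mem_vertexSet_output {q : ℕ} (hn : s.reg 0 = n) (hq : q ≠ 10) (v : Fin n) :
    v ∈ ((output q).eval s).vertexSet q n ↔ s.col 10 v = q := by
  have hfill := (Stmt.eval_fill (x := 6) (a := q) (e := .var 6)
    (f := .eq (.get 10 (.var 6)) (.lit q)) (i := Fin.val)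
    (g := fun v : Fin n => if s.arr 10 v = q then 1 else 0) hn Fin.val_injective
    fun t _ harr v hv => by simp only [Expr.eval, hv, harr 10 hq.symm, and_self]).1 v
  rw [State.vertexSet, Finset.mem_filter, output, hfill]
  simp [State.col]

theorem vertexSet_congr {a : ℕ} (h : s'.arr a = s.arr a) : s'.vertexSet a n = s.vertexSet a n := by
  simp only [State.vertexSet, h]

theorem IsPrepared.eval_solve (h : IsPrepared G X s) (hX : HitsInducedPaths G X)
    (hzero : ∀ a ∈ [5, 6, 10], s.arr a = 0) :
    IsMaximumPerfectlyMatched G ((solve.eval s).vertexSet 1 n) ((solve.eval s).vertexSet 2 n) := by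
  obtain ⟨hseed, hlist⟩ := h.eval_seed (hzero 5 (by simp)) (hzero 6 (by simp))
  obtain ⟨hcoloured, hlist'⟩ := hseed.eval_colourMarked hlist
  obtain ⟨htable, hrows⟩ := hcoloured.eval_processCliques hX hlist'
  set t := processCliques.eval (colourMarked.eval (seed.eval s)) with ht
  have hten : t.col 10 = (0 : Fin n → ℕ) := by
    have harr : t.arr 10 = 0 := by
      rw [ht, Stmt.eval_arr (by decide), Stmt.eval_arr (by decide), Stmt.eval_arr (by decide),
        hzero 10 (by simp)]
    exact funext fun v => congrFun harr _
  obtain ⟨hn, hsol, hmax⟩ := htable.eval_selectBest (hten ▸ ⟨by simp, by simp [IsMatchedOn]⟩)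
  refine isMaximumPerfectlyMatched_of_weight_le hsol (fun τ hτ => ?_) (fun v => ?_) fun v => ?_
  · obtain ⟨σ, hσ, hσsol, hweight⟩ := hrows τ hτ
    exact hweight ▸ hmax σ hσ hσsol
  · exact (mem_vertexSet_output hn (by decide) v).symm.trans
      (by rw [← vertexSet_congr (Stmt.eval_arr (p := output 2) (by decide))]; rfl)
  · have hcol : ((output 1).eval (selectBest.eval t)).col 10 =
        ((selectBest.eval t).col 10 : Fin n → ℕ) :=
      funext fun v => congrFun (Stmt.eval_arr (by decide)) _
    rw [← hcol]
    exact (mem_vertexSet_output ((Stmt.eval_reg (by decide)).trans hn) (by decide) v).symm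

open Classical in
theorem holdsMarks_graphInput (G : SimpleGraph (Fin n)) : HoldsMarks G ∅ (graphInput G) where
  reg_zero := rfl
  adj u v := by
    refine if_congr ⟨?_, fun h => ⟨rfl, u, v, rfl, h⟩⟩ rfl rfl
    rintro ⟨-, u', v', heq, hadj⟩
    obtain ⟨hu, hv⟩ := (mul_add_eq_mul_add_iff v.2 v'.2).1 heq
    rwa [Fin.ext hu, Fin.ext hv]
  mark v := by simp [graphInput]

theorem bounded_graphInput (G : SimpleGraph (Fin n)) (m : ℕ) {M : ℕ} (hn : n ≤ M) (hM : 1 ≤ M) :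
    Bounded m M (graphInput G) :=
  ⟨fun x _ => by simp only [graphInput]; split_ifs <;> omega,
    fun a i => by simp only [graphInput]; split_ifs <;> omega⟩

theorem keyBound_mono (n : ℕ) : Monotone (keyBound n) := fun m m' h => by
  unfold keyBound
  gcongr
  decide

theorem order_add_two_le_keyBound (n m : ℕ) : n + 2 ≤ keyBound n m := by
  have hpow : 1 ≤ 9 ^ m := Nat.one_le_pow _ _ (by decide)
  have hle : 1 * (n + 1) * (n + 1) * 2 * 2 ≤ keyBound n m := by
    unfold keyBound
    gcongr
  nlinarith

theorem small_markPaths : markPaths.Small 2 := by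
  simp [markPaths, markPath, Stmt.Small, Expr.Small]

theorem small_solve : solve.Small 2 := by
  simp [solve, seed, colourMarked, recolour, processCliques, pass, update, attempt, load, enter,
    paintPair, selectBest, improve, output, Expr.colour, Expr.key, Stmt.Small, Expr.Small]

theorem algorithm_spec {G : SimpleGraph (Fin n)} (hk : distanceToCluster G ≤ k) :
    algorithm.Safe 11 (keyBound n (3 * k)) (graphInput G) ∧
      IsMaximumPerfectlyMatched G ((algorithm.eval (graphInput G)).vertexSet 1 n)
        ((algorithm.eval (graphInput G)).vertexSet 2 n) := by
  have hM := order_add_two_le_keyBound n (3 * k)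
  obtain ⟨X, hmarks, hpacking, hhits⟩ := (holdsMarks_graphInput G).eval_markPaths
  obtain ⟨hsafe, hbounded⟩ := small_markPaths.safe (m := 11) (by omega)
    (by decide) (bounded_graphInput G 11 (by omega : n ≤ keyBound n (3 * k)) (by omega))
  obtain ⟨hsafe', hbounded', hprepared⟩ := hmarks.isPrepared_eval hbounded (by decide) (by omega)
    (keyBound_mono n (hpacking.card_le hk))
  refine ⟨⟨hsafe, hsafe', (small_solve.safe (by omega) (by decide) hbounded').1⟩,
    hprepared.eval_solve hhits fun a ha => ?_⟩
  rw [Stmt.eval_arr (p := prepare) (by fin_cases ha <;> decide),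
    Stmt.eval_arr (p := markPaths) (by fin_cases ha <;> decide)]
  funext i
  fin_cases ha <;> rfl

end RAM

theorem exists_polynomial_eval_keyBound_le (p : Polynomial ℕ) :
    ∃ (c : ℕ) (q : Polynomial ℕ), ∀ n k : ℕ, p.eval (keyBound n (3 * k)) ≤ c ^ k * q.eval n := by
  obtain ⟨C, d, hp⟩ := exists_polynomial_eval_le_mul_pow p
  refine ⟨(9 ^ 3) ^ d, .C C * (4 * (.X + 1) ^ 2) ^ d, fun n k => ?_⟩
  have hsplit : keyBound n (3 * k) = 4 * (n + 1) ^ 2 * (9 ^ 3) ^ k := by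
    rw [keyBound, ← pow_mul]
    ring
  simp only [Polynomial.eval_mul, Polynomial.eval_pow, Polynomial.eval_add, Polynomial.eval_C,
    Polynomial.eval_X, Polynomial.eval_one, Polynomial.eval_ofNat]
  calc p.eval (keyBound n (3 * k)) ≤ C * keyBound n (3 * k) ^ d :=
        hp _ (le_trans (by omega) (RAM.order_add_two_le_keyBound n (3 * k)))
    _ = ((9 ^ 3) ^ d) ^ k * (C * (4 * (n + 1) ^ 2) ^ d) := by
        rw [hsplit, mul_pow, pow_right_comm]
        ring

theorem mainTheorem6_general :
    ∃ (P : RAM.Prog) (c : ℕ) (poly : Polynomial ℕ),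
      ∀ (n : ℕ) (G : SimpleGraph (Fin n)) (k : ℕ), distanceToCluster G ≤ k →
        ∃ (t : ℕ) (s : RAM.State),
          RAM.Exec P (RAM.graphInput G) t s ∧
          t ≤ c ^ k * poly.eval n ∧
          IsMaximumPerfectlyMatched G (s.vertexSet 1 n) (s.vertexSet 2 n) := by
  obtain ⟨c, poly, hpoly⟩ := exists_polynomial_eval_keyBound_le RAM.algorithm.cost
  refine ⟨RAM.algorithm.compile 11, c, poly, fun n G k hk => ?_⟩
  obtain ⟨hsafe, hmax⟩ := RAM.algorithm_spec hk
  obtain ⟨t, s, hexec, ht, hs, -⟩ :=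
    RAM.algorithm.compilesCorrectly (by decide) le_rfl (.refl 11 _) hsafe
  refine ⟨t, s, hexec, ht.trans (hpoly n k), ?_⟩
  simpa only [RAM.State.vertexSet, hs.2] using hmax

/-- One program finds, on every finite simple graph, a pair of perfectly matched sets of maximum
size (left in arrays `1` and `2`), and on `n`-vertex graphs with distance to cluster at most `k` it
takes at most `3 ^ k * k ^ k * poly(n)` steps; `k` is not part of the input. -/
theorem mainTheorem6 :
    ∃ (P : RAM.Prog) (poly : Polynomial ℕ),
      ∀ (n : ℕ) (G : SimpleGraph (Fin n)) (k : ℕ), distanceToCluster G ≤ k →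
        ∃ (t : ℕ) (s : RAM.State),
          RAM.Exec P (RAM.graphInput G) t s ∧
          t ≤ 3 ^ k * k ^ k * poly.eval n ∧
          IsMaximumPerfectlyMatched G (s.vertexSet 1 n) (s.vertexSet 2 n) := by
  obtain ⟨P, c, poly, h⟩ := mainTheorem6_general
  refine ⟨P, .C (c ^ c) * poly, fun n G k hk => ?_⟩
  obtain ⟨t, s, hexec, ht, hmax⟩ := h n G k hk
  refine ⟨t, s, hexec, ht.trans ?_, hmax⟩
  calc c ^ k * poly.eval n ≤ 3 ^ k * (c ^ c * k ^ k) * poly.eval n := by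
        gcongr
        exact (pow_le_pow_self_mul_pow_self c k).trans
          (Nat.le_mul_of_pos_left _ (by positivity))
    _ = 3 ^ k * k ^ k * (Polynomial.C (c ^ c) * poly).eval n := by
        simp only [Polynomial.eval_mul, Polynomial.eval_C]
        ring
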